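/- Let $F$ be Richard Thompson's group, given by the presentation $$F=\langle x_0,x_1,x_2,\dots \mid x_i^{-1}x_nx_i=x_{n+1}\ \text{ for } 0\le i<n\rangle ,$$ let $F'=[F,F]$ be its commutator subgroup and $F_{\mathrm{ab}}=F/F'$ its abelianization. For a group $G$ let $H^*(G)=\bigoplus_{n\ge 0}H^n(G;\mathbb Z)$ be the integral cohomology ring (trivial coefficients, cup product). Let $\Gamma(u)$ be the divided polynomial ring on one generator $u$ of degree $2$, i.e. the subring of $\mathbb Q[u]$ generated additively by the elements $u^{(i)}=u^i/i!$ $(i\ge 0)$, where $u^{(i)}$ has degree $2i$. Let $\bigwedge(a,b)$ be the exterior algebra over $\mathbb Z$ on two generators $a,b$ of degree $1$. Tensor products are over $\mathbb Z$ and are graded tensor products, i.e. $(x\otimes y)(x'\otimes y')=(-1)^{\deg y\,\deg x'}xx'\otimes yy'$ for homogeneous elements, with the total grading. Then: 1. There is an isomorphism of graded rings $H^*(F')\cong\Gamma(u)$. 2. There are isomorphisms of graded rings $$H^*(F)\;\cong\;H^*(F')\otimes H^*(F_{\mathrm{ab}})\;\cong\;\Gamma(u)\otimes\textstyle\bigwedge(a,b).$$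 In particular, the cup product $H^1(F)\otimes H^1(F)\to H^2(F)$ is nontrivial. -/

import Mathlib

namespace groupCohomology

open CategoryTheory

/-- Inhomogeneous cochains of degree `n` with (trivial) integer coefficients. -/
abbrev IntCochain (G : Type) (n : ℕ) : Type := (Fin n → G) → ℤ

/-- The cup product on cochains:
`(f ∪ g)(x₁, …, x_{p+q}) = f(x₁, …, x_p) * g(x_{p+1}, …, x_{p+q})`. -/
def cup {G : Type} {p q n : ℕ} (h : p + q = n) (f : IntCochain G p) (g : IntCochain G q) :
    IntCochain G n :=
  fun x => f (fun i => x ⟨i, by omega⟩) * g (fun j => x ⟨p + j, by omega⟩)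

theorem cup_add_left {G : Type} {p q n : ℕ} (h : p + q = n) (f f' : IntCochain G p) (g : IntCochain G q) :
    cup h (f + f') g = cup h f g + cup h f' g := by
  ext x; simp [cup, add_mul]

theorem cup_add_right {G : Type} {p q n : ℕ} (h : p + q = n) (f : IntCochain G p) (g g' : IntCochain G q) :
    cup h f (g + g') = cup h f g + cup h f g' := by
  ext x; simp [cup, mul_add]

theorem cup_zero_left {G : Type} {p q n : ℕ} (h : p + q = n) (g : IntCochain G q) :
    cup h (0 : IntCochain G p) g = 0 := by
  ext x; simp [cup]

theorem cup_zero_right {G : Type} {p q n : ℕ} (h : p + q = n) (f : IntCochain G p) :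
    cup h f (0 : IntCochain G q) = 0 := by
  ext x; simp [cup]

variable {G : Type} [Group G]

/-- The differential on inhomogeneous cochains with trivial integer coefficients. -/
def delta (n : ℕ) : IntCochain G n →+ IntCochain G (n+1) :=
  (inhomogeneousCochains.d (Rep.trivial ℤ G ℤ) n).hom.toAddMonoidHom

theorem delta_apply {n : ℕ} (f : IntCochain G n) (g : Fin (n+1) → G) :
    delta n f g = f (fun i => g i.succ) +
      ∑ j : Fin (n+1), (-1) ^ ((j : ℕ) + 1) * f (Fin.contractNth j (· * ·) g) := by
  simp [delta, inhomogeneousCochains.d_hom_apply]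

theorem delta_cup {p q n : ℕ} (h : p + q = n) (f : IntCochain G p) (g : IntCochain G q) :
    delta n (cup h f g) = cup (by omega) (delta p f) g +
      (-1) ^ p * cup (by omega : p + (q + 1) = n + 1) f (delta q g) := by
  subst h
  ext x
  have e1 : ∀ j : Fin p, cup rfl f g (Fin.contractNth (n := p + q) (Fin.castAdd (q + 1) j) (· * ·) x)
      = f (Fin.contractNth j.castSucc (· * ·) (fun i : Fin (p+1) => x ⟨i, by omega⟩)) *
        g (fun k => x ⟨p + 1 + k, by omega⟩) := by
    intro j
    unfold cup
    refine congrArg₂ (· * ·) (congrArg f ?_) (congrArg g ?_)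
    · ext k
      simp [Fin.contractNth]
    · ext k
      rw [Fin.contractNth_apply_of_gt _ _ _ _ (by simp; omega)]
      congr 1; ext; simp; omega
  have e2 : ∀ j : Fin (q + 1), cup rfl f g (Fin.contractNth (n := p + q) (Fin.natAdd p j) (· * ·) x)
      = f (fun i => x ⟨i, by omega⟩) *
        g (Fin.contractNth j (· * ·) (fun k : Fin (q+1) => x ⟨p + k, by omega⟩)) := by
    intro j
    unfold cup
    refine congrArg₂ (· * ·) (congrArg f ?_) (congrArg g ?_)
    · ext k
      rw [Fin.contractNth_apply_of_lt _ _ _ _ (by simp; omega)]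
      rfl
    · ext k
      simp [Fin.contractNth]
      rfl
  have hs := Fin.sum_univ_add (a := p) (b := q + 1) (fun j : Fin (p + (q + 1)) =>
    (-1 : ℤ) ^ ((j : ℕ) + 1) * cup rfl f g (Fin.contractNth (n := p + q) j (· * ·) x))
  refine (delta_apply _ _).trans ((congrArg _ hs).trans ?_)
  simp only [e1, e2]
  simp only [Pi.add_apply, Pi.mul_apply, Pi.pow_apply, Pi.neg_apply, Pi.one_apply]
  simp only [cup, delta_apply]
  rw [Fin.sum_univ_castSucc (n := p)]
  have e3 : Fin.contractNth (Fin.last p) (· * ·) (fun i : Fin (p+1) => x ⟨i, by omega⟩) =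
      fun i : Fin p => x ⟨i, by omega⟩ := by
    ext k
    rw [Fin.contractNth_apply_of_lt _ _ _ _ (by simp)]
    rfl
  rw [e3]
  simp only [Fin.val_castAdd, Fin.val_natAdd, Fin.val_castSucc, Fin.val_last, Fin.val_succ, Fin.succ_mk]
  have e4 : (fun j : Fin q => x ⟨p + (j + 1), by omega⟩) = fun j : Fin q => x ⟨p + 1 + j, by omega⟩ := by
    ext j; congr 2; omega
  have e5 : (fun j : Fin q => x ⟨p + j + 1, by omega⟩) = fun j : Fin q => x ⟨p + 1 + j, by omega⟩ := by
    ext j; congr 2; omega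
  simp only [e4, e5]
  simp only [add_mul, mul_add, Finset.sum_mul, Finset.mul_sum]
  have e6 : ∀ j : Fin (q+1), ∀ a b : ℤ, (-1 : ℤ) ^ (p + (j : ℕ) + 1) * (a * b)
     = (-1) ^ p * (a * ((-1) ^ ((j : ℕ) + 1) * b)) := by intros; ring
  simp only [e6]
  simp only [mul_assoc, pow_succ]
  ring


/-- Integral group cohomology `Hⁿ(G; ℤ)`. -/
abbrev IntCohomology (G : Type) [Group G] (n : ℕ) : Type := groupCohomology (Rep.trivial ℤ G ℤ) n

theorem d_eq_delta (n : ℕ) (f : IntCochain G n) :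
   ((inhomogeneousCochains (Rep.trivial ℤ G ℤ)).d n (n+1)).hom f = delta n f := by
  rw [inhomogeneousCochains.d_def]; rfl

theorem iCocycles_injective (n : ℕ) :
    Function.Injective (iCocycles (Rep.trivial ℤ G ℤ) n) :=
  (ModuleCat.mono_iff_injective (iCocycles (Rep.trivial ℤ G ℤ) n)).1 inferInstance

/-- A cochain killed by the differential, as an element of Mathlib's module of cocycles. -/
noncomputable def cocycleMk (n : ℕ) :
    (delta (G := G) n).ker →+ cocycles (Rep.trivial ℤ G ℤ) n where
  toFun f := cocyclesMk (A := Rep.trivial ℤ G ℤ) f.1 f.2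
  map_zero' := iCocycles_injective n (by
    rw [map_zero]; exact iCocycles_mk (A := Rep.trivial ℤ G ℤ) _ (map_zero (delta n)))
  map_add' f g := iCocycles_injective n (by
    rw [map_add]
    refine (iCocycles_mk (A := Rep.trivial ℤ G ℤ) _ (f + g).2).trans ?_
    exact (congrArg₂ (· + ·) (iCocycles_mk (A := Rep.trivial ℤ G ℤ) f.1 f.2)
      (iCocycles_mk (A := Rep.trivial ℤ G ℤ) g.1 g.2)).symm)

theorem iCocycles_cocycleMk (n : ℕ) (f : (delta (G := G) n).ker) :
    iCocycles (Rep.trivial ℤ G ℤ) n (cocycleMk n f) = f.1 :=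
  iCocycles_mk (A := Rep.trivial ℤ G ℤ) f.1 f.2

/-- The cohomology class of a cocycle. -/
noncomputable def cls (n : ℕ) : (delta (G := G) n).ker →+ IntCohomology G n :=
  (π (Rep.trivial ℤ G ℤ) n).hom.toAddMonoidHom.comp (cocycleMk n)

theorem cls_surjective (n : ℕ) : Function.Surjective (cls (G := G) n) := by
  intro x
  induction x using groupCohomology_induction_on with
  | h z =>
    have hz : delta n (iCocycles (Rep.trivial ℤ G ℤ) n z) = 0 := by
      rw [← d_eq_delta]
      exact congr($((inhomogeneousCochains (Rep.trivial ℤ G ℤ)).iCycles_d n (n+1)) z)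
    exact ⟨⟨_, hz⟩, congrArg (π (Rep.trivial ℤ G ℤ) n)
      (iCocycles_injective n (iCocycles_cocycleMk n _))⟩

theorem cls_eq_zero_iff (n : ℕ) (f : (delta (G := G) n).ker) :
    cls n f = 0 ↔ ∃ g : IntCochain G ((ComplexShape.up ℕ).prev n),
      ((inhomogeneousCochains (Rep.trivial ℤ G ℤ)).d _ n).hom g = f.1 := by
  let K := inhomogeneousCochains (Rep.trivial ℤ G ℤ)
  have h1 : cls n f = 0 ↔ K.homologyι n (cls n f) = 0 :=
    (map_eq_zero_iff _ ((ModuleCat.mono_iff_injective (K.homologyι n)).1 inferInstance)).symm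
  have h2 : K.homologyι n (cls n f) = K.pOpcycles n f.1 := by
    have := congr($(K.homology_π_ι n) (cocycleMk n f))
    refine this.trans ?_
    exact congrArg (K.pOpcycles n) (iCocycles_cocycleMk n f)
  rw [h1, h2]
  exact (K.sc n).moduleCat_pOpcycles_eq_zero_iff f.1

/-- A cochain is a coboundary if it is in the image of the differential. -/
def IsCoboundary : (n : ℕ) → IntCochain G n → Prop
  | 0, f => f = 0
  | n + 1, f => ∃ g, delta n g = f

theorem cls_eq_zero_iff_isCoboundary (n : ℕ) (f : (delta (G := G) n).ker) :
    cls n f = 0 ↔ IsCoboundary n f.1 := by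
  rw [cls_eq_zero_iff]
  cases n with
  | zero =>
    have h0 : (inhomogeneousCochains (Rep.trivial ℤ G ℤ)).d ((ComplexShape.up ℕ).prev 0) 0 = 0 :=
      HomologicalComplex.shape _ _ _ (by simp)
    rw [h0]
    exact ⟨fun ⟨g, hg⟩ => hg.symm, fun h => ⟨0, h.symm⟩⟩
  | succ n =>
    rw [(ComplexShape.up ℕ).prev_eq' (i := n + 1) (j := n) rfl]
    exact exists_congr fun g => by rw [d_eq_delta]


theorem delta_cup_eq_zero {p q n : ℕ} (h : p + q = n) {f : IntCochain G p} {g : IntCochain G q}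
    (hf : delta p f = 0) (hg : delta q g = 0) : delta n (cup h f g) = 0 := by
  rw [delta_cup, hf, hg, cup_zero_left, cup_zero_right, mul_zero, add_zero]

theorem isCoboundary_zero (n : ℕ) : IsCoboundary n (0 : IntCochain G n) := by
  cases n with
  | zero => rfl
  | succ n => exact ⟨0, map_zero _⟩

theorem isCoboundary_cup_left {p q n : ℕ} (h : p + q = n) {f : IntCochain G p}
    {g : IntCochain G q} (hf : IsCoboundary p f) (hg : delta q g = 0) :
    IsCoboundary n (cup h f g) := by
  cases p with
  | zero =>
    obtain rfl : f = 0 := hf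
    rw [cup_zero_left]
    exact isCoboundary_zero n
  | succ p =>
    obtain ⟨a, rfl⟩ := hf
    obtain ⟨m, rfl⟩ : ∃ m, n = m + 1 := ⟨p + q, by omega⟩
    refine ⟨cup (by omega) a g, ?_⟩
    rw [delta_cup, hg, cup_zero_right, mul_zero, add_zero]

theorem isCoboundary_cup_right {p q n : ℕ} (h : p + q = n) {f : IntCochain G p}
    {g : IntCochain G q} (hf : delta p f = 0) (hg : IsCoboundary q g) :
    IsCoboundary n (cup h f g) := by
  cases q with
  | zero =>
    obtain rfl : g = 0 := hg
    rw [cup_zero_right]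
    exact isCoboundary_zero n
  | succ q =>
    obtain ⟨b, rfl⟩ := hg
    obtain ⟨m, rfl⟩ : ∃ m, n = m + 1 := ⟨p + q, by omega⟩
    refine ⟨(-1 : ℤ) ^ p • cup (by omega) f b, ?_⟩
    rw [map_zsmul, delta_cup, hf, cup_zero_left, zero_add]
    ext x
    simp [← mul_assoc, ← mul_pow]

/-- The cup product of two cocycles. -/
def cupCocycle {p q n : ℕ} (h : p + q = n) (f : (delta (G := G) p).ker)
    (g : (delta (G := G) q).ker) : (delta (G := G) n).ker :=
  ⟨cup h f.1 g.1, delta_cup_eq_zero h f.2 g.2⟩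

/-- The cup product of two cohomology classes, computed on cocycles representing them. -/
noncomputable def cupClass {p q n : ℕ} (h : p + q = n) (x : IntCohomology G p)
    (y : IntCohomology G q) : IntCohomology G n :=
  cls n (cupCocycle h (Function.surjInv (cls_surjective p) x)
    (Function.surjInv (cls_surjective q) y))

theorem cupClass_cls {p q n : ℕ} (h : p + q = n) (f : (delta (G := G) p).ker)
    (g : (delta (G := G) q).ker) : cupClass h (cls p f) (cls q g) = cls n (cupCocycle h f g) := by
  unfold cupClass
  set f' := Function.surjInv (cls_surjective p) (cls p f) with hf'
  set g' := Function.surjInv (cls_surjective q) (cls q g) with hg'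
  have h1 : IsCoboundary p (f' - f).1 := by
    rw [← cls_eq_zero_iff_isCoboundary, map_sub, hf', Function.surjInv_eq (cls_surjective p), sub_self]
  have h2 : IsCoboundary q (g' - g).1 := by
    rw [← cls_eq_zero_iff_isCoboundary, map_sub, hg', Function.surjInv_eq (cls_surjective q), sub_self]
  have e1 : cupCocycle h f' g' = cupCocycle h f g + cupCocycle h (f' - f) g'
      + cupCocycle h f (g' - g) := by
    ext x
    simp only [cupCocycle, cup, AddSubgroup.coe_add, AddSubgroup.coe_sub, Pi.add_apply,
      Pi.sub_apply]
    ring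
  rw [e1, map_add, map_add,
    (cls_eq_zero_iff_isCoboundary n (cupCocycle h (f' - f) g')).2 (isCoboundary_cup_left h h1 g'.2),
    (cls_eq_zero_iff_isCoboundary n (cupCocycle h f (g' - g))).2 (isCoboundary_cup_right h f.2 h2),
    add_zero, add_zero]

theorem cupClass_add_left {p q n : ℕ} (h : p + q = n) (x x' : IntCohomology G p)
    (y : IntCohomology G q) : cupClass h (x + x') y = cupClass h x y + cupClass h x' y := by
  obtain ⟨f, rfl⟩ := cls_surjective p x
  obtain ⟨f', rfl⟩ := cls_surjective p x'
  obtain ⟨g, rfl⟩ := cls_surjective q y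
  rw [← map_add, cupClass_cls, cupClass_cls, cupClass_cls, ← map_add]
  exact congrArg _ (Subtype.ext (cup_add_left h _ _ _))

theorem cupClass_add_right {p q n : ℕ} (h : p + q = n) (x : IntCohomology G p)
    (y y' : IntCohomology G q) : cupClass h x (y + y') = cupClass h x y + cupClass h x y' := by
  obtain ⟨f, rfl⟩ := cls_surjective p x
  obtain ⟨g, rfl⟩ := cls_surjective q y
  obtain ⟨g', rfl⟩ := cls_surjective q y'
  rw [← map_add, cupClass_cls, cupClass_cls, cupClass_cls, ← map_add]
  exact congrArg _ (Subtype.ext (cup_add_right h _ _ _))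

theorem cupClass_assoc {p q r s t n : ℕ} (h : p + q = s) (h' : s + r = n) (k : q + r = t)
    (k' : p + t = n) (x : IntCohomology G p) (y : IntCohomology G q) (z : IntCohomology G r) :
    cupClass h' (cupClass h x y) z = cupClass k' x (cupClass k y z) := by
  obtain ⟨f, rfl⟩ := cls_surjective p x
  obtain ⟨g, rfl⟩ := cls_surjective q y
  obtain ⟨e, rfl⟩ := cls_surjective r z
  simp only [cupClass_cls]
  refine congrArg _ (Subtype.ext ?_)
  subst h k
  ext a
  simp only [cupCocycle, cup, mul_assoc, add_assoc]

/-- The cocycle of degree `0` with constant value `1`. -/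
def oneCocycle (G : Type) [Group G] : (delta (G := G) 0).ker :=
  ⟨fun _ => 1, by
    rw [AddMonoidHom.mem_ker]
    ext x
    simp⟩

/-- The unit class in degree `0`. -/
noncomputable def oneClass (G : Type) [Group G] : IntCohomology G 0 := cls 0 (oneCocycle G)

theorem cupClass_one_left {q : ℕ} (y : IntCohomology G q) :
    cupClass (zero_add q) (oneClass G) y = y := by
  obtain ⟨g, rfl⟩ := cls_surjective q y
  rw [oneClass, cupClass_cls]
  refine congrArg _ (Subtype.ext ?_)
  ext a
  simp [cupCocycle, cup, oneCocycle]

theorem cupClass_one_right {p : ℕ} (x : IntCohomology G p) :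
    cupClass (add_zero p) x (oneClass G) = x := by
  obtain ⟨f, rfl⟩ := cls_surjective p x
  rw [oneClass, cupClass_cls]
  refine congrArg _ (Subtype.ext ?_)
  ext a
  simp [cupCocycle, cup, oneCocycle]

theorem mk_cupClass {p q n : ℕ} (h : p + q = n) (x : IntCohomology G p) (y : IntCohomology G q) :
    (⟨p + q, cupClass rfl x y⟩ : Σ n, IntCohomology G n) = ⟨n, cupClass h x y⟩ := by
  subst h; rfl

theorem cupClass_zero_left {p q n : ℕ} (h : p + q = n) (y : IntCohomology G q) :
    cupClass h (0 : IntCohomology G p) y = 0 := by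
  have := cupClass_add_left h 0 0 y
  rwa [add_zero, left_eq_add] at this

theorem cupClass_zero_right {p q n : ℕ} (h : p + q = n) (x : IntCohomology G p) :
    cupClass h x (0 : IntCohomology G q) = 0 := by
  have := cupClass_add_right h x 0 0
  rwa [add_zero, left_eq_add] at this

noncomputable instance intCohomologyGOne : GradedMonoid.GOne (IntCohomology G) where
  one := oneClass G

noncomputable instance intCohomologyGMul : GradedMonoid.GMul (IntCohomology G) where
  mul x y := cupClass rfl x y

/-- The cohomology groups form a graded ring under the cup product. -/
noncomputable instance intCohomologyGRing : DirectSum.GRing (IntCohomology G) where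
  __ := intCohomologyGOne
  __ := intCohomologyGMul
  mul_zero x := cupClass_zero_right rfl x
  zero_mul y := cupClass_zero_left rfl y
  mul_add x y y' := cupClass_add_right rfl x y y'
  add_mul x x' y := cupClass_add_left rfl x x' y
  one_mul a := (mk_cupClass (zero_add a.1) (oneClass G) a.2).trans
    (congrArg (Sigma.mk a.1) (cupClass_one_left a.2))
  mul_one a := (mk_cupClass (add_zero a.1) a.2 (oneClass G)).trans
    (congrArg (Sigma.mk a.1) (cupClass_one_right a.2))
  mul_assoc a b c := (mk_cupClass (add_assoc a.1 b.1 c.1) (cupClass rfl a.2 b.2) c.2).trans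
    (congrArg (Sigma.mk _) (cupClass_assoc rfl _ rfl rfl a.2 b.2 c.2))
  natCast n := n • oneClass G
  natCast_zero := zero_nsmul _
  natCast_succ n := succ_nsmul _ _
  intCast n := n • oneClass G
  intCast_ofNat n := natCast_zsmul _ _
  intCast_negSucc_ofNat n := negSucc_zsmul _ _

end groupCohomology

/-- The integral cohomology ring `H^*(G; ℤ) = ⨁ₙ Hⁿ(G; ℤ)` with the cup product. -/
def CohomologyRing (G : Type) [Group G] : Type :=
  DirectSum ℕ (groupCohomology.IntCohomology G)

noncomputable instance CohomologyRing.instRing (G : Type) [Group G] : Ring (CohomologyRing G) :=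
  inferInstanceAs (Ring (DirectSum ℕ (groupCohomology.IntCohomology G)))

namespace CohomologyRing

open groupCohomology

variable {G : Type} [Group G]

/-- The inclusion of `Hⁿ(G; ℤ)` in the cohomology ring. -/
noncomputable def of (n : ℕ) : IntCohomology G n →+ CohomologyRing G :=
  DirectSum.of (IntCohomology G) n

variable (G) in
/-- The degree `n` part `Hⁿ(G; ℤ)` of the cohomology ring. -/
noncomputable def grading (n : ℕ) : Submodule ℤ (CohomologyRing G) :=
  (of (G := G) n).range.toIntSubmodule

theorem of_mul_of {p q : ℕ} (x : IntCohomology G p) (y : IntCohomology G q) :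
    of p x * of q y = of (p + q) (cupClass rfl x y) :=
  DirectSum.of_mul_of x y

/-- The decomposition of the cohomology ring into its homogeneous parts. -/
noncomputable def decomposeAux : CohomologyRing G →+ DirectSum ℕ fun n => grading G n :=
  DirectSum.toAddMonoid fun n =>
    (DirectSum.of (fun n => grading G n) n).comp (of (G := G) n).rangeRestrict

noncomputable instance instGradedAlgebra : GradedAlgebra (grading G) where
  one_mem := ⟨oneClass G, rfl⟩
  mul_mem := by
    rintro p q _ _ ⟨x, rfl⟩ ⟨y, rfl⟩
    exact ⟨cupClass rfl x y, (of_mul_of x y).symm⟩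
  decompose' := decomposeAux
  left_inv x := by
    induction x using DirectSum.induction_on with
    | zero => exact (congrArg _ (map_zero decomposeAux)).trans (map_zero _)
    | of n x =>
      unfold decomposeAux
      erw [DirectSum.toAddMonoid_of]
      exact DirectSum.coeAddMonoidHom_of _ _ _
    | add x y hx hy => erw [map_add, map_add, hx, hy]; rfl
  right_inv x := by
    induction x using DirectSum.induction_on with
    | zero => exact (congrArg decomposeAux (map_zero _)).trans (map_zero _)
    | of n x =>
      obtain ⟨_, ⟨x, rfl⟩⟩ := x
      erw [DirectSum.coeAddMonoidHom_of]
      exact DirectSum.toAddMonoid_of _ _ _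
    | add x y hx hy => erw [map_add, map_add, hx, hy]

end CohomologyRing

/-- The `i`-th divided power `u^i / i!` of the indeterminate `u` in `ℚ[u]`. -/
noncomputable def dividedPow (i : ℕ) : Polynomial ℚ :=
  Polynomial.monomial i ((i.factorial : ℚ)⁻¹)

theorem dividedPow_mul (i j : ℕ) :
    dividedPow i * dividedPow j = ((i + j).choose i) • dividedPow (i + j) := by
  have h : ((i + j).factorial : ℚ) ≠ 0 := by positivity
  have h1 : (i.factorial : ℚ) ≠ 0 := by positivity
  have h2 : (j.factorial : ℚ) ≠ 0 := by positivity
  rw [dividedPow, dividedPow, dividedPow, Polynomial.monomial_mul_monomial, Polynomial.smul_monomial,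
    nsmul_eq_mul, Nat.cast_add_choose]
  congr 1
  field_simp

/-- The divided polynomial ring `Γ(u)`: the subring of `ℚ[u]` generated additively by the
divided powers `u^i / i!`. -/
noncomputable def DividedPolynomialRing : Subring (Polynomial ℚ) where
  __ := AddSubgroup.closure (Set.range dividedPow)
  one_mem' :=
    AddSubgroup.subset_closure (k := Set.range dividedPow) ⟨0, by simp [dividedPow]⟩
  mul_mem' := by
    intro a b ha hb
    change a ∈ AddSubgroup.closure (Set.range dividedPow) at ha
    change b ∈ AddSubgroup.closure (Set.range dividedPow) at hb
    change a * b ∈ AddSubgroup.closure (Set.range dividedPow)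
    induction ha, hb using AddSubgroup.closure_induction₂ with
    | mem x y hx hy =>
      obtain ⟨i, rfl⟩ := hx
      obtain ⟨j, rfl⟩ := hy
      rw [dividedPow_mul]
      exact nsmul_mem (AddSubgroup.subset_closure (Set.mem_range_self _)) _
    | zero_left => simp
    | zero_right => simp
    | add_left x y z _ _ _ h1 h2 => rw [add_mul]; exact add_mem h1 h2
    | add_right x y z _ _ _ h1 h2 => rw [mul_add]; exact add_mem h1 h2
    | neg_left x y _ _ h => rw [neg_mul]; exact neg_mem h
    | neg_right x y _ _ h => rw [mul_neg]; exact neg_mem h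

namespace DividedPolynomialRing

theorem monomial_coeff_mem (x : Polynomial ℚ) (hx : x ∈ DividedPolynomialRing) (i : ℕ) :
    Polynomial.monomial i (x.coeff i) ∈ DividedPolynomialRing := by
  change x ∈ AddSubgroup.closure (Set.range dividedPow) at hx
  induction hx using AddSubgroup.closure_induction with
  | mem x hx =>
    obtain ⟨j, rfl⟩ := hx
    by_cases h : j = i
    · subst h
      have : Polynomial.monomial j ((dividedPow j).coeff j) = dividedPow j := by simp [dividedPow]
      rw [this]
      exact AddSubgroup.subset_closure ⟨_, rfl⟩
    · simp [dividedPow, Polynomial.coeff_monomial, h]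
  | zero => simp
  | add x y _ _ hx hy => rw [Polynomial.coeff_add, map_add]; exact add_mem hx hy
  | neg x _ hx => rw [Polynomial.coeff_neg, map_neg]; exact neg_mem hx

/-- The degree `n` part of `Γ(u)` where `u` has degree `2`: the elements in which only powers
`u^i` with `2 * i = n` occur. -/
def grading (n : ℕ) : Submodule ℤ DividedPolynomialRing where
  carrier := {x | ∀ i, 2 * i ≠ n → (x : Polynomial ℚ).coeff i = 0}
  zero_mem' := by simp
  add_mem' := by
    intro a b ha hb i hi
    simp [ha i hi, hb i hi]
  smul_mem' := by
    intro c x hx i hi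
    simp [hx i hi]

theorem grading_isInternal : DirectSum.IsInternal grading := by
  have hc : ∀ (w : DirectSum ℕ fun n => grading n) (i : ℕ),
      ((DirectSum.coeAddMonoidHom grading w : DividedPolynomialRing) : Polynomial ℚ).coeff i =
        ((w (2 * i) : DividedPolynomialRing) : Polynomial ℚ).coeff i := by
    intro w i
    induction w using DirectSum.induction_on with
    | zero => simp
    | of n x =>
      rw [DirectSum.coeAddMonoidHom_of]
      by_cases h : n = 2 * i
      · subst h; rw [DirectSum.of_eq_same]
      · rw [DirectSum.of_eq_of_ne _ _ _ (Ne.symm h), x.2 i (Ne.symm h)]; simp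
    | add x y hx hy => simp [hx, hy]
  constructor
  · rw [injective_iff_map_eq_zero]
    intro w hw
    ext n j
    by_cases h : 2 * j = n
    · subst h
      rw [← hc, hw]; simp
    · rw [(w n).2 j h]; simp
  · intro x
    refine ⟨∑ i ∈ (x : Polynomial ℚ).support, DirectSum.of (fun n => grading n) (2 * i)
      ⟨⟨Polynomial.monomial i ((x : Polynomial ℚ).coeff i), monomial_coeff_mem _ x.2 i⟩, ?_⟩, ?_⟩
    · intro j hj
      rw [Polynomial.coeff_monomial, if_neg (by omega)]
    · rw [map_sum]
      simp only [DirectSum.coeAddMonoidHom_of]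
      ext1
      rw [AddSubmonoidClass.coe_finsetSum]
      exact (Polynomial.as_sum_support (x : Polynomial ℚ)).symm

noncomputable instance instGradedAlgebra : GradedAlgebra grading where
  __ := grading_isInternal.chooseDecomposition
  one_mem := by
    intro i hi
    simp [Polynomial.coeff_one]
    omega
  mul_mem := by
    intro m n x y hx hy i hi
    change ((x : Polynomial ℚ) * (y : Polynomial ℚ)).coeff i = 0
    rw [Polynomial.coeff_mul]
    refine Finset.sum_eq_zero fun k hk => ?_
    have hk := Finset.HasAntidiagonal.mem_antidiagonal.1 hk
    by_cases h : 2 * k.1 = m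
    · rw [hy k.2 (by omega), mul_zero]
    · rw [hx k.1 h, zero_mul]

end DividedPolynomialRing

open scoped TensorProduct

/-- The total degree `n` part of the (graded) tensor product of two graded rings: it is spanned by
the `a ⊗ b` with `a` of degree `i`, `b` of degree `j` and `i + j = n`. -/
noncomputable def tensorGrading {R A B : Type*} [CommRing R] [Ring A] [Ring B] [Algebra R A] [Algebra R B]
    (𝒜 : ℕ → Submodule R A) (ℬ : ℕ → Submodule R B) [GradedAlgebra 𝒜] [GradedAlgebra ℬ]
    (n : ℕ) : Submodule R (𝒜 ᵍ⊗[R] ℬ) :=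
  Submodule.span R {t | ∃ i j, i + j = n ∧ ∃ a ∈ 𝒜 i, ∃ b ∈ ℬ j, t = a ᵍ⊗ₜ[R] b}

/-- The grading of the exterior algebra `Λ(a, b)` over `ℤ` on two generators `a`, `b` of
degree `1`. -/
abbrev exteriorGrading (n : ℕ) : Submodule ℤ (ExteriorAlgebra ℤ (Fin 2 → ℤ)) :=
  ⋀[ℤ]^n (Fin 2 → ℤ)

/-- The relators of the presentation `⟨x₀, x₁, x₂, … ; xᵢ⁻¹ xₙ xᵢ = xₙ₊₁ for i < n⟩`. -/
def thompsonRels : Set (FreeGroup ℕ) :=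
  {r | ∃ i n : ℕ, i < n ∧ r = (FreeGroup.of i)⁻¹ * FreeGroup.of n * FreeGroup.of i *
    (FreeGroup.of (n + 1))⁻¹}

/-- Thompson's group `F`, given by the presentation
`⟨x₀, x₁, x₂, … ; xᵢ⁻¹ xₙ xᵢ = xₙ₊₁ for i < n⟩`. -/
abbrev ThompsonF : Type := PresentedGroup thompsonRels

/-! An upper bound on the cohomology comes from a cubical free resolution, a lower bound from
evaluating explicit cocycles on tori, and the two bounds meet.

Upper bound. The relation `x n * x i = x i * x (n + 1)` makes F a group of right fractions of its
positive monoid, and the cubes `(g; i₁ < … < iₙ)` with boundary `bd` resolve ℤ freely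
(`exists_bd_eq`, `exists_bd_eq_of_aug`). If all generators act on the coefficients by one
automorphism τ, a cocycle of degree at least 2 is, up to a coboundary, the suspension of a cocycle
of one degree less (`exists_eq_add_susp`). So the number of generators found in degree 1 bounds all
higher degrees: two for F with trivial coefficients and, by Shapiro's lemma, one for the kernel of
`deg` (`exists_generator_degKer`).

Lower bound. F acts on ℚ by piecewise linear maps whose slopes are powers of 2. The discrete
Godbillon-Vey cocycle sums, over points d, the logarithm of the left slope of one argument times the
jump of the logarithmic slope of the next. Summing over increasing k-tuples of points gives its k-th
divided power (`gvCocycle`). Together with `deg₀` and `deg` these form the mixed cocycles. On tori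
spanned by commuting bumps, some of which touch in pairs, they evaluate to a diagonal matrix with
entries ±1 (`torusEval_mixedCocycle`). With the upper bound this yields a ℤ-basis of `H^*(F)`
(`mixedBasis`). The dual tori detect every class, so graded commutation with degree-one classes and
the divided power relation (`gvClass_one_mul`) can be checked on them.

Commutator subgroup. F' is the increasing union of conjugates, by powers of `x 0`, of the shifted
copy of the kernel of `deg` (`toCommutator_succ`, `exists_toCommutator_eq`). On the cohomology of
that kernel the shift is the identity in even degrees and zero in odd degrees. Hence the
Mittag-Leffler condition holds, the lim¹ term vanishes (`isCoboundary_of_telescope`), and the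
restricted divided powers form a basis of `H^*(F')` (`commBasis`).

Conclusion. The abelianization is a retract of F through two commuting elements, so its cohomology
is a summand of `H^*(F)` with basis 1, a, b, ab (`abBasis`). All rings involved then have
homogeneous bases, and bases with the same degrees and structure constants give graded ring
isomorphisms (`GradedBasis.exists_ringEquiv`). -/

namespace ThompsonF

/-! ### Thompson's group, its piecewise linear action, and the slopes -/

/-- The generator `xᵢ`. -/
def x (i : ℕ) : ThompsonF := PresentedGroup.of i

theorem x_mul_x {i n : ℕ} (h : i < n) : x n * x i = x i * x (n + 1) := by
  have h1 : PresentedGroup.mk thompsonRels ((FreeGroup.of i)⁻¹ * FreeGroup.of n * FreeGroup.of i *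
      (FreeGroup.of (n + 1))⁻¹) = 1 := PresentedGroup.one_of_mem ⟨i, n, h, rfl⟩
  simp only [map_mul, map_inv] at h1
  change (x i)⁻¹ * x n * x i * (x (n + 1))⁻¹ = 1 at h1
  rw [mul_inv_eq_one, mul_assoc, inv_mul_eq_iff_eq_mul] at h1
  exact h1

section lift
variable {G : Type*} [Group G] (f : ℕ → G) (hf : ∀ i n, i < n → f n * f i = f i * f (n + 1))

/-- The homomorphism out of Thompson's group given by images of the generators. -/
def lift : ThompsonF →* G :=
  PresentedGroup.toGroup (f := f) (by
    rintro r ⟨i, n, h, rfl⟩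
    simp only [map_mul, map_inv, FreeGroup.lift_apply_of]
    rw [mul_inv_eq_one, mul_assoc, hf i n h, inv_mul_cancel_left])

@[simp] theorem lift_x (i : ℕ) : lift f hf (x i) = f i := PresentedGroup.toGroup.of _
end lift

theorem closure_range_x : Subgroup.closure (Set.range x) = ⊤ :=
  PresentedGroup.closure_range_of _

theorem induction_on {p : ThompsonF → Prop} (g : ThompsonF) (h1 : p 1)
    (hx : ∀ i g, p g → p (x i * g)) (hi : ∀ i g, p g → p ((x i)⁻¹ * g)) : p g := by
  have hg : g ∈ Subgroup.closure (Set.range x) := by rw [closure_range_x]; trivial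
  induction hg using Subgroup.closure_induction_left with
  | one => exact h1
  | mul_left a ha b _ hb => obtain ⟨i, rfl⟩ := ha; exact hx i b hb
  | inv_mul_cancel a ha b _ hb => obtain ⟨i, rfl⟩ := ha; exact hi i b hb

theorem hom_ext {G : Type*} [Group G] {f g : ThompsonF →* G} (h : ∀ i, f (x i) = g (x i)) :
    f = g :=
  PresentedGroup.ext h

/-- The piecewise linear homeomorphism by which `xᵢ` acts: slope `1/2` on `[i, i + 2]` and
translation by `-1` to the right of it. -/
def gen (i : ℕ) : Equiv.Perm ℚ where
  toFun t := if t ≤ i then t else if t ≤ i + 2 then i + (t - i) / 2 else t - 1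
  invFun t := if t ≤ i then t else if t ≤ i + 1 then i + (t - i) * 2 else t + 1
  left_inv t := by grind
  right_inv t := by grind

theorem gen_apply (i : ℕ) (t : ℚ) :
    gen i t = if t ≤ i then t else if t ≤ i + 2 then i + (t - i) / 2 else t - 1 := rfl

theorem gen_inv_apply (i : ℕ) (t : ℚ) :
    (gen i)⁻¹ t = if t ≤ i then t else if t ≤ i + 1 then i + (t - i) * 2 else t + 1 := rfl

theorem gen_strictMono (i : ℕ) : StrictMono (gen i) := by
  intro a b h
  simp only [gen_apply]
  grind

/-- The binary logarithms of the left and right slopes of `xᵢ`, at the point with image `d`. -/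
def genSlope (i : ℕ) (d : ℚ) : Multiplicative (ℤ × ℤ) :=
  Multiplicative.ofAdd (if (i : ℚ) < d ∧ d ≤ i + 1 then -1 else 0,
    if (i : ℚ) ≤ d ∧ d < i + 1 then -1 else 0)

/-- Permutations of `ℚ` with pairs of integers ("slopes") attached to the points. -/
abbrev Germs : Type := (ℚ → Multiplicative (ℤ × ℤ)) ⋊[mulAutArrow] Equiv.Perm ℚ

/-- The action of Thompson's group on `ℚ`, with slopes. -/
def germ : ThompsonF →* Germs :=
  lift (fun i => ⟨genSlope i, gen i⟩) (by
    -- The relation is a finite case check on piecewise linear formulas, once for each slope and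
    -- once for the underlying permutation.
    intro i n h
    have h' : (i : ℚ) + 1 ≤ n := by exact_mod_cast h
    have arrow (g : Equiv.Perm ℚ) (f : ℚ → Multiplicative (ℤ × ℤ)) (d : ℚ) :
        (mulAutArrow g f) d = f (g⁻¹ d) := rfl
    ext d
    · simp only [SemidirectProduct.mul_left, Pi.mul_apply, arrow, genSlope, toAdd_mul, toAdd_ofAdd,
        gen_inv_apply, Prod.fst_add]
      push_cast
      grind
    · simp only [SemidirectProduct.mul_left, Pi.mul_apply, arrow, genSlope, toAdd_mul, toAdd_ofAdd,
        gen_inv_apply, Prod.snd_add]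
      push_cast
      grind
    · simp only [SemidirectProduct.mul_right, Equiv.Perm.mul_apply, gen_apply]
      push_cast
      grind)

/-- The action of Thompson's group on `ℚ`. -/
def act : ThompsonF →* Equiv.Perm ℚ := SemidirectProduct.rightHom.comp germ

/-- The logarithm of the left slope of `g` at the point with image `d`. -/
def lslope (g : ThompsonF) (d : ℚ) : ℤ := ((germ g).left d).toAdd.1

/-- The logarithm of the right slope of `g` at the point with image `d`. -/
def rslope (g : ThompsonF) (d : ℚ) : ℤ := ((germ g).left d).toAdd.2

/-- The jump of the logarithm of the slope of `g` at the point with image `d`. -/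
def jump (g : ThompsonF) (d : ℚ) : ℤ := rslope g d - lslope g d

@[simp] theorem act_x (i : ℕ) : act (x i) = gen i := by
  simp [act, germ]

theorem lslope_x (i : ℕ) (d : ℚ) : lslope (x i) d = if (i : ℚ) < d ∧ d ≤ i + 1 then -1 else 0 := by
  simp [lslope, germ, genSlope]

theorem rslope_x (i : ℕ) (d : ℚ) : rslope (x i) d = if (i : ℚ) ≤ d ∧ d < i + 1 then -1 else 0 := by
  simp [rslope, germ, genSlope]

theorem jump_x (i : ℕ) (d : ℚ) :
    jump (x i) d = (if d = i then -1 else 0) + if d = i + 1 then 1 else 0 := by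
  simp only [jump, rslope_x, lslope_x]
  grind

theorem lslope_mul (g h : ThompsonF) (d : ℚ) :
    lslope (g * h) d = lslope g d + lslope h ((act g)⁻¹ d) := by
  simp only [lslope, map_mul, SemidirectProduct.mul_left]
  rfl

theorem rslope_mul (g h : ThompsonF) (d : ℚ) :
    rslope (g * h) d = rslope g d + rslope h ((act g)⁻¹ d) := by
  simp only [rslope, map_mul, SemidirectProduct.mul_left]
  rfl

theorem jump_mul (g h : ThompsonF) (d : ℚ) :
    jump (g * h) d = jump g d + jump h ((act g)⁻¹ d) := by
  simp only [jump, rslope_mul, lslope_mul]; ring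

@[simp] theorem lslope_one (d : ℚ) : lslope 1 d = 0 := by simp [lslope]
@[simp] theorem rslope_one (d : ℚ) : rslope 1 d = 0 := by simp [rslope]
@[simp] theorem jump_one (d : ℚ) : jump 1 d = 0 := by simp [jump]

theorem lslope_inv (g : ThompsonF) (d : ℚ) : lslope g⁻¹ d = -lslope g (act g d) := by
  have := lslope_mul g g⁻¹ (act g d)
  simp at this; omega

theorem jump_inv (g : ThompsonF) (d : ℚ) : jump g⁻¹ d = -jump g (act g d) := by
  have := jump_mul g g⁻¹ (act g d)
  simp at this; omega

theorem act_strictMono (g : ThompsonF) : StrictMono (act g) := by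
  induction g using induction_on with
  | h1 => simpa using strictMono_id
  | hx i g hg =>
    rw [map_mul, act_x, Equiv.Perm.coe_mul]
    exact (gen_strictMono i).comp hg
  | hi i g hg =>
    rw [map_mul, map_inv, act_x, Equiv.Perm.coe_mul]
    refine StrictMono.comp (fun a b h => ?_) hg
    by_contra! h'
    have := (gen_strictMono i).monotone h'
    simp at this
    exact absurd h (not_lt.2 this)

/-- The jump is a crossed homomorphism, so the breakpoints of a product come from those of its
factors. This is what makes the sums over ℚ below finite. -/
theorem finite_support_jump (g : ThompsonF) : (Function.support (jump g)).Finite := by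
  have hx (i : ℕ) : (Function.support (jump (x i))).Finite := by
    refine (Set.toFinite {(i : ℚ), (i : ℚ) + 1}).subset fun d hd => ?_
    rw [Function.mem_support, jump_x] at hd
    by_contra h
    simp only [Set.mem_insert_iff, Set.mem_singleton_iff, not_or] at h
    simp [h] at hd
  have hmul (g h : ThompsonF) (hg : (Function.support (jump g)).Finite)
      (hh : (Function.support (jump h)).Finite) : (Function.support (jump (g * h))).Finite := by
    refine (hg.union (hh.image (act g))).subset fun d hd => ?_
    rw [Function.mem_support, jump_mul] at hd
    by_cases h0 : jump g d = 0
    · right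
      exact ⟨(act g)⁻¹ d, fun h1 => hd (by rw [h0, h1]; rfl), by simp⟩
    · exact Or.inl h0
  induction g using induction_on with
  | h1 => simp [Function.support]
  | hx i g hg => exact hmul _ _ (hx i) hg
  | hi i g hg =>
    refine hmul _ _ (((hx i).image ⇑(act (x i))⁻¹).subset fun d hd => ?_) hg
    rw [Function.mem_support, jump_inv, neg_ne_zero] at hd
    exact ⟨_, hd, by simp⟩

/-- The homomorphism sending all generators to `1`. -/
def deg : ThompsonF →* Multiplicative ℤ := lift (fun _ => Multiplicative.ofAdd 1) (fun _ _ _ => rfl)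

/-- The homomorphism sending `x₀` to `1` and all other generators to `0`. -/
def deg₀ : ThompsonF →* Multiplicative ℤ :=
  lift (fun i => Multiplicative.ofAdd (if i = 0 then 1 else 0)) (fun i n h => by
    rw [mul_comm]; congr 3; simp; omega)

@[simp] theorem deg_x (i : ℕ) : deg (x i) = Multiplicative.ofAdd 1 := lift_x _ _ _
@[simp] theorem deg₀_x (i : ℕ) : deg₀ (x i) = Multiplicative.ofAdd (if i = 0 then 1 else 0) :=
  lift_x _ _ _

/-- The endomorphism `xᵢ ↦ xᵢ₊₁`. -/
def shift : ThompsonF →* ThompsonF := lift (fun i => x (i + 1)) (fun _ _ h => x_mul_x (by omega))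

@[simp] theorem shift_x (i : ℕ) : shift (x i) = x (i + 1) := lift_x _ _ _

/-- On the image of the shift, shifting again is conjugation by `x 0`. This turns the shift into the
bonding map of the telescope exhausting F'. -/
theorem shift_shift (g : ThompsonF) : shift (shift g) = (x 0)⁻¹ * shift g * x 0 := by
  have : shift.comp shift = (MulAut.conj (x 0)⁻¹).toMonoidHom.comp shift :=
    hom_ext fun i => by
      simp [mul_assoc, x_mul_x (Nat.succ_pos i)]
  simpa using DFunLike.congr_fun this g

end ThompsonF

/-! ### The positive monoid: divisibility, common multiples, injectivity of the shift -/

namespace ThompsonF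

/-- The submonoid generated by the `xᵢ`. -/
def pos : Submonoid ThompsonF := Submonoid.closure (Set.range x)

theorem x_mem_pos (i : ℕ) : x i ∈ pos := Submonoid.subset_closure ⟨i, rfl⟩

@[elab_as_elim]
theorem pos_induction {p : ThompsonF → Prop} {g : ThompsonF} (hg : g ∈ pos) (h1 : p 1)
    (hx : ∀ i g, g ∈ pos → p g → p (x i * g)) : p g := by
  induction hg using Submonoid.closure_induction_left with
  | one => exact h1
  | mul_left a ha b hb h => obtain ⟨i, rfl⟩ := ha; exact hx i b hb h

/-- `xᵢ` divides `p` in the positive monoid. -/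
def Dvd (i : ℕ) (p : ThompsonF) : Prop := (x i)⁻¹ * p ∈ pos

/-- The next three rules compute right slopes at integer points letter by letter. For a positive
element the right slope at `i` is minus the exponent of the largest power of `x i` splitting off on
the left. -/
theorem rslope_x_mul_of_lt {i j : ℕ} (h : i < j) (g : ThompsonF) :
    rslope (x j * g) i = rslope g i := by
  have h' : (i : ℚ) < j := by exact_mod_cast h
  rw [rslope_mul, rslope_x, act_x, gen_inv_apply, if_neg (by grind), if_pos h'.le, zero_add]

theorem rslope_x_mul_of_gt {i j : ℕ} (h : j < i) (g : ThompsonF) :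
    rslope (x j * g) i = rslope g (i + 1 : ℕ) := by
  have h' : (j : ℚ) + 1 ≤ i := by exact_mod_cast h
  rw [rslope_mul, rslope_x, act_x, gen_inv_apply, if_neg (by grind), if_neg (by grind)]
  rcases h'.eq_or_lt with h' | h'
  · rw [if_pos (by grind), zero_add, ← h']; push_cast; congr 1; grind
  · rw [if_neg (by grind), zero_add]; push_cast; rfl

theorem rslope_x_mul_self (i : ℕ) (g : ThompsonF) :
    rslope (x i * g) i = -1 + rslope g i := by
  rw [rslope_mul, rslope_x, act_x, gen_inv_apply, if_pos (by grind), if_pos le_rfl]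

theorem rslope_nonpos {p : ThompsonF} (hp : p ∈ pos) : ∀ i : ℕ, rslope p i ≤ 0 := by
  refine pos_induction hp (by simp) fun j g hg ih i => ?_
  rcases lt_trichotomy i j with h | rfl | h
  · rw [rslope_x_mul_of_lt h]; exact ih i
  · rw [rslope_x_mul_self]; linarith [ih i]
  · rw [rslope_x_mul_of_gt h]; exact ih _

/-- Divisibility in the monoid becomes a condition on the homeomorphism, visible at one point. This
replaces a normal form for positive words. -/
theorem dvd_iff {p : ThompsonF} (hp : p ∈ pos) {i : ℕ} : Dvd i p ↔ rslope p i < 0 := by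
  constructor
  · intro h
    have := rslope_nonpos h i
    have h2 := rslope_x_mul_self i ((x i)⁻¹ * p)
    rw [mul_inv_cancel_left] at h2
    omega
  · suffices H : ∀ i : ℕ, rslope p i < 0 → Dvd i p from H i
    refine pos_induction hp (by simp) fun j g hg ih i hi => ?_
    rcases lt_trichotomy i j with h | rfl | h
    · rw [rslope_x_mul_of_lt h] at hi
      -- The letter `x i` slides past `x j` by the defining relation, so splitting it off is a
      -- question about `g` alone.
      have : (x i)⁻¹ * (x j * g) = x (j + 1) * ((x i)⁻¹ * g) := by
        rw [inv_mul_eq_iff_eq_mul, ← mul_assoc, ← mul_assoc, ← x_mul_x h]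
        group
      rw [Dvd, this]
      exact mul_mem (x_mem_pos _) (ih _ hi)
    · rw [Dvd, inv_mul_cancel_left]; exact hg
    · rw [rslope_x_mul_of_gt h] at hi
      have : (x i)⁻¹ * (x j * g) = x j * ((x (i + 1))⁻¹ * g) := by
        rw [inv_mul_eq_iff_eq_mul, ← mul_assoc, ← mul_assoc, x_mul_x h]
        group
      rw [Dvd, this]
      exact mul_mem (x_mem_pos _) (ih _ hi)

theorem Dvd.mem {i : ℕ} {p : ThompsonF} (h : Dvd i p) : p ∈ pos := by
  have := mul_mem (x_mem_pos i) h
  rwa [mul_inv_cancel_left] at this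

/-- Two divisors are simultaneous: after splitting off `x i`, a larger divisor survives with its
index raised by one. In `Dvd.of_gt` a smaller one survives unchanged. These rules make the faces of
a cube below `t` stay below `t`. -/
theorem Dvd.succ_of_lt {i j : ℕ} (hij : i < j) {p : ThompsonF} (hi : Dvd i p) (hj : Dvd j p) :
    Dvd (j + 1) ((x i)⁻¹ * p) := by
  rw [dvd_iff hi, ← rslope_x_mul_of_gt hij, mul_inv_cancel_left]
  exact (dvd_iff hj.mem).1 hj

theorem Dvd.of_gt {i j : ℕ} (hij : j < i) {p : ThompsonF} (hi : Dvd i p) (hj : Dvd j p) :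
    Dvd j ((x i)⁻¹ * p) := by
  rw [dvd_iff hi, ← rslope_x_mul_of_lt hij, mul_inv_cancel_left]
  exact (dvd_iff hj.mem).1 hj

theorem Dvd.mul_right {i : ℕ} {p q : ThompsonF} (h : Dvd i p) (hq : q ∈ pos) : Dvd i (p * q) := by
  rw [Dvd, ← mul_assoc]; exact mul_mem h hq

theorem exists_dvd {p : ThompsonF} (hp : p ∈ pos) : p = 1 ∨ ∃ i, Dvd i p := by
  refine pos_induction hp (Or.inl rfl) fun i g hg _ => Or.inr ⟨i, ?_⟩
  rw [Dvd, inv_mul_cancel_left]; exact hg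

/-- The number of letters of a positive element. -/
def len (p : ThompsonF) : ℕ := (deg p).toAdd.toNat

theorem exists_deg_eq {p : ThompsonF} (hp : p ∈ pos) : ∃ n : ℕ, deg p = Multiplicative.ofAdd (n : ℤ) := by
  refine pos_induction hp ⟨0, by simp⟩ fun i g _ ⟨n, hn⟩ => ⟨n + 1, ?_⟩
  rw [map_mul, hn, deg_x, ← ofAdd_add]; push_cast; rw [add_comm]

theorem Dvd.len_lt {i : ℕ} {p : ThompsonF} (h : Dvd i p) : len ((x i)⁻¹ * p) < len p := by
  obtain ⟨n, hn⟩ := exists_deg_eq h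
  have h2 : deg p = Multiplicative.ofAdd ((n + 1 : ℕ) : ℤ) := by
    have : p = x i * ((x i)⁻¹ * p) := by group
    rw [this, map_mul, hn, deg_x, ← ofAdd_add]; push_cast; rw [add_comm]
  simp only [len, hn, h2, toAdd_ofAdd]
  omega

/-- Common multiples are built by stacking the squares given by the relations, one letter of `p` at
a time; what is left over on the right is at most one letter. -/
theorem ore_x (i : ℕ) {p : ThompsonF} (hp : p ∈ pos) :
    ∃ q ∈ pos, ∃ r ∈ pos, (r = 1 ∨ ∃ j, r = x j) ∧ x i * q = p * r := by
  revert i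
  refine pos_induction hp (fun i => ⟨1, one_mem _, x i, x_mem_pos i, Or.inr ⟨i, rfl⟩, by simp⟩)
    fun j g hg ih i => ?_
  -- Two distinct letters close up to a square in which the larger index is raised by one.
  obtain rfl | ⟨a, b, hab⟩ : i = j ∨ ∃ a b, x i * x a = x j * x b := by
    rcases lt_trichotomy i j with h | h | h
    · exact Or.inr ⟨j + 1, i, (x_mul_x h).symm⟩
    · exact Or.inl h
    · exact Or.inr ⟨j, i + 1, x_mul_x h⟩
  · exact ⟨g, hg, 1, one_mem _, Or.inl rfl, by simp⟩
  · obtain ⟨q, hq, r, hr, hr', e⟩ := ih b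
    exact ⟨x a * q, mul_mem (x_mem_pos a) hq, r, hr, hr', by
      rw [← mul_assoc, hab, mul_assoc, e, mul_assoc]⟩

theorem ore {p : ThompsonF} (hp : p ∈ pos) :
    ∀ q ∈ pos, ∃ r ∈ pos, ∃ s ∈ pos, p * r = q * s := by
  refine pos_induction hp (fun q hq => ⟨q, hq, 1, one_mem _, by simp⟩) fun i g hg ih q hq => ?_
  obtain ⟨a, ha, b, hb, -, e⟩ := ore_x i hq
  obtain ⟨r, hr, s, hs, e'⟩ := ih _ ha
  exact ⟨r, hr, b * s, mul_mem hb hs, by rw [mul_assoc, e', ← mul_assoc, e, mul_assoc]⟩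

theorem exists_eq_mul_inv (g : ThompsonF) : ∃ p ∈ pos, ∃ q ∈ pos, g = p * q⁻¹ := by
  induction g using induction_on with
  | h1 => exact ⟨1, one_mem _, 1, one_mem _, by simp⟩
  | hx i g ih =>
    obtain ⟨p, hp, q, hq, rfl⟩ := ih
    exact ⟨x i * p, mul_mem (x_mem_pos i) hp, q, hq, by group⟩
  | hi i g ih =>
    obtain ⟨p, hp, q, hq, rfl⟩ := ih
    obtain ⟨r, hr, s, hs, e⟩ := ore (x_mem_pos i) _ hp
    refine ⟨r, hr, q * s, mul_mem hq hs, ?_⟩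
    rw [inv_mul_eq_iff_eq_mul, ← mul_assoc, e]
    group

/-- The partial order on Thompson's group with positive cone `pos`. -/
theorem exists_upper_bound (g h : ThompsonF) : ∃ t, g⁻¹ * t ∈ pos ∧ h⁻¹ * t ∈ pos := by
  obtain ⟨p, hp, q, hq, e⟩ := exists_eq_mul_inv (g⁻¹ * h)
  refine ⟨h * q, ?_, by simpa using hq⟩
  rw [← mul_assoc, e]; simpa using hp

/-- The shift moves every index and every integer point by one, so it both preserves and reflects
divisors. -/
theorem rslope_shift {p : ThompsonF} (hp : p ∈ pos) :
    ∀ i : ℕ, rslope (shift p) (i + 1 : ℕ) = rslope p i := by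
  refine pos_induction hp (by simp) fun j g _ ih i => ?_
  rw [map_mul, shift_x]
  rcases lt_trichotomy i j with h | rfl | h
  · rw [rslope_x_mul_of_lt h, rslope_x_mul_of_lt (by omega), ih]
  · rw [rslope_x_mul_self, rslope_x_mul_self, ih]
  · rw [rslope_x_mul_of_gt h, rslope_x_mul_of_gt (by omega), ih]

/-- A first letter of `p` is detected on `shift p`, hence also divides `q`; cancel it and induct. -/
theorem eq_of_shift_eq {p : ThompsonF} (hp : p ∈ pos) :
    ∀ q ∈ pos, shift p = shift q → p = q := by
  refine pos_induction hp (fun q hq h => ?_) fun i g hg ih q hq h => ?_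
  · rcases exists_dvd hq with rfl | ⟨i, hi⟩
    · rfl
    · have h1 := (dvd_iff hq).1 hi
      rw [← rslope_shift hq, ← h] at h1
      simp at h1
  · have hi : Dvd i q := by
      rw [dvd_iff hq, ← rslope_shift hq, ← h, rslope_shift (mul_mem (x_mem_pos i) hg),
        ← dvd_iff (mul_mem (x_mem_pos i) hg), Dvd, inv_mul_cancel_left]
      exact hg
    rw [ih _ hi (by rw [map_mul, ← h, map_mul, map_inv]; group), mul_inv_cancel_left]

theorem shift_injective : Function.Injective shift := by
  rw [injective_iff_map_eq_one]
  intro g h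
  obtain ⟨p, hp, q, hq, rfl⟩ := exists_eq_mul_inv g
  rw [map_mul, map_inv, mul_inv_eq_one] at h
  rw [mul_inv_eq_one]
  exact eq_of_shift_eq hp q hq h

end ThompsonF

/-! ### The cubical chain complex -/

namespace ThompsonF

open Finsupp

/-- Shapes of cubes: the word `(h₁, h₂, …)` stands for the increasing sequence `i₁ = h₁`,
`iₖ₊₁ = iₖ + 1 + hₖ₊₁`. -/
inductive Shape : ℕ → Type
  | nil : Shape 0
  | cons {n : ℕ} (h : ℕ) (w : Shape n) : Shape (n + 1)

/-- Adding `k` to all entries of the increasing sequence. -/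
def bump (k : ℕ) : ∀ {n : ℕ}, Shape n → Shape n
  | 0, w => w
  | _ + 1, .cons h w => .cons (h + k) w

@[simp] theorem bump_nil (k : ℕ) : bump k .nil = .nil := rfl

@[simp] theorem bump_cons (k h : ℕ) {n : ℕ} (w : Shape n) :
    bump k (.cons h w) = .cons (h + k) w := rfl

theorem bump_bump (a b : ℕ) {n : ℕ} (w : Shape n) : bump a (bump b w) = bump (b + a) w := by
  cases w with
  | nil => rfl
  | cons h w => simp [add_assoc]

/-- Free abelian groups on the cubes with a vertex in Thompson's group. -/
abbrev Cubes (n : ℕ) : Type := (ThompsonF × Shape n) →₀ ℤ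

/-- Prepending a direction. -/
noncomputable def cone {A : Type} (h : ℕ) {n : ℕ} : ((A × Shape n) →₀ ℤ) →ₗ[ℤ] ((A × Shape (n + 1)) →₀ ℤ) :=
  lmapDomain ℤ ℤ fun y => (y.1, .cons h y.2)

noncomputable def bumpMap {A : Type} (k : ℕ) {n : ℕ} : ((A × Shape n) →₀ ℤ) →ₗ[ℤ] ((A × Shape n) →₀ ℤ) :=
  lmapDomain ℤ ℤ fun y => (y.1, bump k y.2)

noncomputable def vertexMap {A B : Type} (f : A → B) {n : ℕ} : ((A × Shape n) →₀ ℤ) →ₗ[ℤ] ((B × Shape n) →₀ ℤ) :=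
  lmapDomain ℤ ℤ fun y => (f y.1, y.2)

@[simp] theorem cone_single {A : Type} (h : ℕ) {n : ℕ} (g : A) (w : Shape n) (r : ℤ) :
    cone h (single (g, w) r) = single (g, .cons h w) r := mapDomain_single

@[simp] theorem bumpMap_single {A : Type} (h : ℕ) {n : ℕ} (g : A) (w : Shape n) (r : ℤ) :
    bumpMap h (single (g, w) r) = single (g, bump h w) r := mapDomain_single

@[simp] theorem vertexMap_single {A B : Type} (f : A → B) {n : ℕ} (g : A) (w : Shape n) (r : ℤ) :
    vertexMap f (single (g, w) r) = single (f g, w) r := mapDomain_single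

/-- Linear maps agree if they agree on cubes. -/
theorem cube_ext {A M : Type} [AddCommGroup M] {n : ℕ} {f f' : ((A × Shape n) →₀ ℤ) →ₗ[ℤ] M}
    (h : ∀ g w, f (single (g, w) 1) = f' (single (g, w) 1)) : f = f' :=
  Finsupp.lhom_ext' fun y => LinearMap.ext_ring (h y.1 y.2)

/-- The boundary of a cube, all whose directions are moved by `c`. -/
noncomputable def bd : ∀ (n c : ℕ), Cubes (n + 1) →ₗ[ℤ] Cubes n
  | 0, c => linearCombination ℤ fun
      | (g, .cons h w) => single (g, w) 1 - single (g * x (c + h), w) 1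
  | n + 1, c => linearCombination ℤ fun
      -- Without its first direction, the word has to absorb the gap `h + 1`. On the opposite face
      -- the vertex has moved by `x (c + h)`, past which all larger indices go up by one; hence `h +
      -- 2`.
      | (g, .cons h w) => single (g, bump (h + 1) w) 1 -
          single (g * x (c + h), bump (h + 2) w) 1 - cone h (bd n (c + h + 1) (single (g, w) 1))

theorem bd_zero_cone (c h : ℕ) (z : Cubes 0) :
    bd 0 c (cone h z) = z - vertexMap (· * x (c + h)) z := by
  suffices H : bd 0 c ∘ₗ cone h = LinearMap.id - vertexMap (· * x (c + h)) from
    LinearMap.congr_fun H z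
  exact cube_ext fun g w => by simp [bd]

theorem bd_succ_cone (n c h : ℕ) (z : Cubes (n + 1)) :
    bd (n + 1) c (cone h z) = bumpMap (h + 1) z - bumpMap (h + 2) (vertexMap (· * x (c + h)) z) -
      cone h (bd n (c + h + 1) z) := by
  suffices H : bd (n + 1) c ∘ₗ cone h = bumpMap (h + 1) -
      bumpMap (h + 2) ∘ₗ vertexMap (· * x (c + h)) - cone h ∘ₗ bd n (c + h + 1) from
    LinearMap.congr_fun H z
  exact cube_ext fun g w => by simp [bd]

theorem bumpMap_cone {A : Type} (k h : ℕ) {n : ℕ} (z : (A × Shape n) →₀ ℤ) :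
    bumpMap k (cone h z) = cone (h + k) z := by
  suffices H : bumpMap k ∘ₗ cone (A := A) (n := n) h = cone (h + k) from LinearMap.congr_fun H z
  exact cube_ext fun g w => by simp

theorem bumpMap_bumpMap {A : Type} (k h : ℕ) {n : ℕ} (z : (A × Shape n) →₀ ℤ) :
    bumpMap k (bumpMap h z) = bumpMap (h + k) z := by
  suffices H : bumpMap k ∘ₗ bumpMap (A := A) (n := n) h = bumpMap (h + k) from
    LinearMap.congr_fun H z
  exact cube_ext fun g w => by simp [bump_bump]

theorem bumpMap_zero_dim {A : Type} (k : ℕ) (z : (A × Shape 0) →₀ ℤ) : bumpMap k z = z := by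
  suffices H : bumpMap (A := A) (n := 0) k = LinearMap.id from LinearMap.congr_fun H z
  exact cube_ext fun g w => by cases w; simp

theorem vertexMap_cone {A B : Type} (f : A → B) (h : ℕ) {n : ℕ} (z : (A × Shape n) →₀ ℤ) :
    vertexMap f (cone h z) = cone h (vertexMap f z) := by
  suffices H : vertexMap f ∘ₗ cone (n := n) h = cone h ∘ₗ vertexMap f from LinearMap.congr_fun H z
  exact cube_ext fun g w => by simp

theorem vertexMap_bumpMap {A B : Type} (f : A → B) (h : ℕ) {n : ℕ} (z : (A × Shape n) →₀ ℤ) :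
    vertexMap f (bumpMap h z) = bumpMap h (vertexMap f z) := by
  suffices H : vertexMap f ∘ₗ bumpMap (n := n) h = bumpMap h ∘ₗ vertexMap f from
    LinearMap.congr_fun H z
  exact cube_ext fun g w => by simp

theorem vertexMap_comm {A : Type} (f f' : A → A) (h : ∀ a, f (f' a) = f' (f a)) {n : ℕ}
    (z : (A × Shape n) →₀ ℤ) : vertexMap f (vertexMap f' z) = vertexMap f' (vertexMap f z) := by
  suffices H : vertexMap (n := n) f ∘ₗ vertexMap f' = vertexMap f' ∘ₗ vertexMap f from
    LinearMap.congr_fun H z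
  exact cube_ext fun g w => by simp [h]

theorem cone_induction {A : Type} {n : ℕ} {p : ((A × Shape (n + 1)) →₀ ℤ) → Prop}
    (z : (A × Shape (n + 1)) →₀ ℤ) (h0 : p 0) (hadd : ∀ a b, p a → p b → p (a + b))
    (hcone : ∀ h z, p (cone h z)) : p z := by
  induction z using Finsupp.induction_linear with
  | zero => exact h0
  | add a b ha hb => exact hadd a b ha hb
  | single y r =>
    obtain ⟨g, _ | ⟨h, w⟩⟩ := y
    rw [← cone_single]
    exact hcone h _

theorem bd_bumpMap (n c k : ℕ) (z : Cubes (n + 1)) :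
    bd n c (bumpMap k z) = bumpMap k (bd n (c + k) z) := by
  induction z using cone_induction with
  | h0 => simp
  | hadd a b ha hb => simp only [map_add, ha, hb]
  | hcone h z =>
    rw [bumpMap_cone]
    cases n with
    | zero =>
      rw [bd_zero_cone, bd_zero_cone, bumpMap_zero_dim, show c + (h + k) = c + k + h by ring]
    | succ n =>
      rw [bd_succ_cone, bd_succ_cone, map_sub, map_sub, bumpMap_bumpMap, bumpMap_bumpMap,
        bumpMap_cone, show c + (h + k) = c + k + h by ring, show h + k + 1 = h + 1 + k by ring,
        show h + k + 2 = h + 2 + k by ring]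

/-- For `i` below all directions, translating the vertices by `x i` raises the directions by one,
again by the defining relation. This matches the two opposite faces in the proof of `bd_bd`. -/
theorem bd_rmul {n : ℕ} : ∀ {c i : ℕ} (_ : i < c) (z : Cubes (n + 1)),
    bd n (c + 1) (vertexMap (· * x i) z) = vertexMap (· * x i) (bd n c z) := by
  induction n with
  | zero =>
    intro c i hi z
    induction z using cone_induction with
    | h0 => simp
    | hadd a b ha hb => simp only [map_add, ha, hb]
    | hcone h z =>
      rw [vertexMap_cone, bd_zero_cone, bd_zero_cone, map_sub]
      congr 1
      suffices H : vertexMap (n := 0) (· * x (c + 1 + h)) ∘ₗ vertexMap (· * x i) =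
        vertexMap (· * x i) ∘ₗ vertexMap (· * x (c + h)) from LinearMap.congr_fun H z
      exact cube_ext fun g w => by
        simp [mul_assoc, show c + 1 + h = c + h + 1 by ring, x_mul_x (show i < c + h by omega)]
  | succ n ih =>
    intro c i hi z
    induction z using cone_induction with
    | h0 => simp
    | hadd a b ha hb => simp only [map_add, ha, hb]
    | hcone h z =>
      rw [vertexMap_cone, bd_succ_cone, bd_succ_cone, map_sub, map_sub, vertexMap_bumpMap,
        vertexMap_bumpMap, vertexMap_cone, ← ih (show i < c + h + 1 by omega),
        show c + 1 + h + 1 = c + h + 1 + 1 by ring]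
      congr 3
      suffices H : vertexMap (n := n + 1) (· * x (c + 1 + h)) ∘ₗ vertexMap (· * x i) =
        vertexMap (· * x i) ∘ₗ vertexMap (· * x (c + h)) from LinearMap.congr_fun H z
      exact cube_ext fun g w => by
        simp [mul_assoc, show c + 1 + h = c + h + 1 by ring, x_mul_x (show i < c + h by omega)]

theorem bd_lmul (g : ThompsonF) {n : ℕ} : ∀ (c : ℕ) (z : Cubes (n + 1)),
    bd n c (vertexMap (g * ·) z) = vertexMap (g * ·) (bd n c z) := by
  induction n with
  | zero =>
    intro c z
    induction z using cone_induction with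
    | h0 => simp
    | hadd a b ha hb => simp only [map_add, ha, hb]
    | hcone h z =>
      rw [vertexMap_cone, bd_zero_cone, bd_zero_cone, map_sub,
        vertexMap_comm _ _ (fun a => by simp [mul_assoc])]
  | succ n ih =>
    intro c z
    induction z using cone_induction with
    | h0 => simp
    | hadd a b ha hb => simp only [map_add, ha, hb]
    | hcone h z =>
      rw [vertexMap_cone, bd_succ_cone, bd_succ_cone, map_sub, map_sub, vertexMap_bumpMap,
        vertexMap_bumpMap, vertexMap_cone, ← ih,
        vertexMap_comm (· * x (c + h)) (g * ·) (fun a => by simp [mul_assoc])]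

/-- Taking the boundary of the two faces in the first direction reproduces, with opposite sign, the
first-direction faces of the inner boundary; the rest vanishes by induction. -/
theorem bd_bd {n : ℕ} : ∀ (c : ℕ) (z : Cubes (n + 2)), bd n c (bd (n + 1) c z) = 0 := by
  induction n with
  | zero =>
    intro c z
    induction z using cone_induction with
    | h0 => simp
    | hadd a b ha hb => simp only [map_add, ha, hb, add_zero]
    | hcone h z =>
      rw [bd_succ_cone, map_sub, map_sub, bd_bumpMap, bd_bumpMap, bd_zero_cone,
        show c + (h + 2) = c + h + 1 + 1 by ring, bd_rmul (by omega), bumpMap_zero_dim,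
        bumpMap_zero_dim, show c + (h + 1) = c + h + 1 by ring, sub_self]
  | succ n ih =>
    intro c z
    induction z using cone_induction with
    | h0 => simp
    | hadd a b ha hb => simp only [map_add, ha, hb, add_zero]
    | hcone h z =>
      rw [bd_succ_cone, map_sub, map_sub, bd_bumpMap, bd_bumpMap, bd_succ_cone,
        show c + (h + 2) = c + h + 1 + 1 by ring, bd_rmul (by omega), ih, map_zero, sub_zero,
        show c + (h + 1) = c + h + 1 by ring, sub_self]

/-- The augmentation. -/
noncomputable def aug : Cubes 0 →ₗ[ℤ] ℤ := linearCombination ℤ fun _ => 1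

@[simp] theorem aug_single (y : ThompsonF × Shape 0) (r : ℤ) : aug (single y r) = r := by
  simp [aug]

theorem aug_vertexMap (f : ThompsonF → ThompsonF) (z : Cubes 0) : aug (vertexMap f z) = aug z := by
  suffices H : aug ∘ₗ vertexMap f = aug from LinearMap.congr_fun H z
  exact cube_ext fun g w => by simp

theorem aug_bd (z : Cubes 1) : aug (bd 0 0 z) = 0 := by
  induction z using cone_induction with
  | h0 => simp
  | hadd a b ha hb => simp only [map_add, ha, hb, add_zero]
  | hcone h z => rw [bd_zero_cone, map_sub, aug_vertexMap, sub_self]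

/-- The 1-skeleton is the Cayley graph of the generators, which is connected. -/
theorem exists_bd_eq_of_aug {z : Cubes 0} (hz : aug z = 0) : ∃ y, bd 0 0 y = z := by
  have step (g : ThompsonF) (i : ℕ) :
      (single (g, Shape.nil) 1 - single (g * x i, Shape.nil) 1 : Cubes 0) ∈ LinearMap.range (bd 0 0) :=
    ⟨single (g, .cons i .nil) 1, by simp [bd]⟩
  have key (g : ThompsonF) : ∀ a : ThompsonF,
      (single (a, Shape.nil) 1 - single (a * g, Shape.nil) 1 : Cubes 0) ∈ LinearMap.range (bd 0 0) := by
    induction g using induction_on with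
    | h1 => exact fun a => by rw [mul_one, sub_self]; exact zero_mem _
    | hx i g ih =>
      intro a
      have := add_mem (step a i) (ih (a * x i))
      rwa [sub_add_sub_cancel, mul_assoc] at this
    | hi i g ih =>
      intro a
      have := sub_mem (ih (a * (x i)⁻¹)) (step (a * (x i)⁻¹) i)
      rwa [inv_mul_cancel_right, sub_sub_sub_cancel_left, mul_assoc] at this
  have : ∀ z : Cubes 0, z - single (1, Shape.nil) (aug z) ∈ LinearMap.range (bd 0 0) := by
    intro z
    induction z using Finsupp.induction_linear with
    | zero => simp
    | add a b ha hb =>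
      rw [map_add, single_add, add_sub_add_comm]
      exact add_mem ha hb
    | single y r =>
      obtain ⟨g, _ | _⟩ := y
      have := Submodule.smul_mem _ (-r) (key g 1)
      simp only [one_mul, smul_sub, smul_single, smul_eq_mul, mul_one, single_neg, sub_neg_eq_add,
        neg_add_eq_sub] at this
      rw [aug_single]
      exact this
  have h := this z
  rw [hz, single_zero, sub_zero] at h
  exact h

end ThompsonF

/-! ### Exactness of the cubical complex -/

namespace ThompsonF

open Finsupp

theorem _root_.Finsupp.apply_mem_of_mem_supported {α M : Type*} [AddCommGroup M] {s : Set α}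
    {N : Submodule ℤ M} (f : (α →₀ ℤ) →ₗ[ℤ] M) (h : ∀ y ∈ s, f (single y 1) ∈ N)
    {z : α →₀ ℤ} (hz : z ∈ supported ℤ ℤ s) : f z ∈ N := by
  rw [supported_eq_span_single] at hz
  have : Submodule.span ℤ ((fun i => single i (1 : ℤ)) '' s) ≤ N.comap f :=
    Submodule.span_le.2 (by rintro _ ⟨y, hy, rfl⟩; exact h y hy)
  exact this hz

/-- All directions of the cube (moved by `c`) divide `p`. -/
def AllDvd (p : ThompsonF) : ∀ {n : ℕ}, ℕ → Shape n → Prop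
  | _, _, .nil => True
  | _, c, .cons h w => Dvd (c + h) p ∧ AllDvd p (c + h + 1) w

theorem allDvd_bump {p : ThompsonF} {n : ℕ} (c k : ℕ) (w : Shape n) :
    AllDvd p c (bump k w) ↔ AllDvd p (c + k) w := by
  cases w with
  | nil => rfl
  | cons h w =>
    simp only [bump_cons, AllDvd]
    rw [show c + (h + k) = c + k + h by ring]

/-- Moving the vertex up along `x i` keeps the remaining directions below `t`, with indices raised
as the far face demands. -/
theorem AllDvd.inv_mul {p : ThompsonF} {i : ℕ} (hi : Dvd i p) {n : ℕ} {w : Shape n} : ∀ {c : ℕ},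
    i < c → AllDvd p c w → AllDvd ((x i)⁻¹ * p) (c + 1) w := by
  induction w with
  | nil => exact fun _ _ => trivial
  | cons h w ih =>
    intro c hc hw
    refine ⟨?_, ?_⟩
    · rw [show c + 1 + h = c + h + 1 by ring]
      exact hi.succ_of_lt (by omega) hw.1
    · rw [show c + 1 + h + 1 = c + h + 1 + 1 by ring]
      exact ih (by omega) hw.2

theorem AllDvd.mul_right {p q : ThompsonF} (hq : q ∈ pos) {n : ℕ} {w : Shape n} : ∀ {c : ℕ},
    AllDvd p c w → AllDvd (p * q) c w := by
  induction w with
  | nil => exact fun _ => trivial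
  | cons h w ih => exact fun hw => ⟨hw.1.mul_right hq, ih hw.2⟩

/-- The part of the boundary that does not move the vertices. -/
noncomputable def bdFix : ∀ n : ℕ, Cubes (n + 1) →ₗ[ℤ] Cubes n
  | 0 => linearCombination ℤ fun
      | (g, .cons _ w) => single (g, w) 1
  | n + 1 => linearCombination ℤ fun
      | (g, .cons h w) => single (g, bump (h + 1) w) 1 - cone h (bdFix n (single (g, w) 1))

theorem bdFix_zero_cone (h : ℕ) (z : Cubes 0) : bdFix 0 (cone h z) = z := by
  suffices H : bdFix 0 ∘ₗ cone h = LinearMap.id from LinearMap.congr_fun H z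
  exact cube_ext fun g w => by simp [bdFix]

theorem bdFix_succ_cone (n h : ℕ) (z : Cubes (n + 1)) :
    bdFix (n + 1) (cone h z) = bumpMap (h + 1) z - cone h (bdFix n z) := by
  suffices H : bdFix (n + 1) ∘ₗ cone h = bumpMap (h + 1) - cone h ∘ₗ bdFix n from
    LinearMap.congr_fun H z
  exact cube_ext fun g w => by simp [bdFix]

theorem bdFix_bumpMap (n k : ℕ) (z : Cubes (n + 1)) :
    bdFix n (bumpMap k z) = bumpMap k (bdFix n z) := by
  induction z using cone_induction with
  | h0 => simp
  | hadd a b ha hb => simp only [map_add, ha, hb]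
  | hcone h z =>
    rw [bumpMap_cone]
    cases n with
    | zero => rw [bdFix_zero_cone, bdFix_zero_cone, bumpMap_zero_dim]
    | succ n =>
      rw [bdFix_succ_cone, bdFix_succ_cone, map_sub, bumpMap_bumpMap, bumpMap_cone,
        show h + k + 1 = h + 1 + k by ring]

/-- The vertices moved by the rest of the boundary are moved up. -/
theorem bd_sub_bdFix_mem (t g : ThompsonF) {n : ℕ} (w : Shape (n + 1)) : ∀ {c : ℕ},
    AllDvd (g⁻¹ * t) c w → bd n c (single (g, w) 1) - bdFix n (single (g, w) 1) ∈
      supported ℤ ℤ {y : ThompsonF × Shape n | ∃ i ≥ c, y.1 = g * x i ∧ Dvd i (g⁻¹ * t) ∧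
        AllDvd (y.1⁻¹ * t) c y.2} := by
  induction n with
  | zero =>
    intro c hw
    obtain _ | ⟨h, w⟩ := w
    rw [← cone_single, bd_zero_cone, bdFix_zero_cone, sub_sub_cancel_left, vertexMap_single]
    refine neg_mem (single_mem_supported ℤ _ ⟨c + h, by omega, rfl, hw.1, ?_⟩)
    cases w
    trivial
  | succ n ih =>
    intro c hw
    obtain _ | ⟨h, w⟩ := w
    rw [← cone_single, bd_succ_cone, bdFix_succ_cone, vertexMap_single, bumpMap_single,
      bumpMap_single]
    have e (A B C D : Cubes (n + 1)) : A - B - C - (A - D) = -B - (C - D) := by abel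
    rw [e, ← map_sub]
    refine sub_mem (neg_mem (single_mem_supported ℤ _ ⟨c + h, by omega, rfl, hw.1, ?_⟩)) ?_
    · rw [allDvd_bump, mul_inv_rev, mul_assoc, show c + (h + 2) = c + h + 1 + 1 by ring]
      exact hw.2.inv_mul hw.1 (by omega)
    · refine apply_mem_of_mem_supported _ ?_ (ih w hw.2)
      rintro ⟨g', w'⟩ ⟨i, hi, rfl, hd, hw'⟩
      rw [cone_single]
      refine single_mem_supported ℤ _ ⟨i, by omega, rfl, hd, ?_, hw'⟩
      rw [mul_inv_rev, mul_assoc]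
      exact hd.of_gt (by omega) hw.1

/-- Inserting the direction `i` as the first one, where possible. -/
noncomputable def insMap (i : ℕ) {n : ℕ} : Cubes n →ₗ[ℤ] Cubes (n + 1) :=
  linearCombination ℤ fun
    | (g, .nil) => single (g, .cons i .nil) 1
    | (g, .cons h w) => if i < h then single (g, .cons i (.cons (h - i - 1) w)) 1 else 0

theorem insMap_bumpMap (i : ℕ) {n : ℕ} (z : Cubes n) :
    insMap i (bumpMap (i + 1) z) = cone i z := by
  suffices H : insMap i ∘ₗ bumpMap (n := n) (i + 1) = cone i from LinearMap.congr_fun H z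
  refine cube_ext fun g w => ?_
  cases w with
  | nil => simp [insMap]
  | cons h w =>
    simp [insMap, show i < h + (i + 1) by omega, show h + (i + 1) - i - 1 = h by omega]

theorem insMap_cone_self (i : ℕ) {n : ℕ} (z : Cubes n) : insMap i (cone i z) = 0 := by
  suffices H : insMap i ∘ₗ cone (n := n) i = 0 from LinearMap.congr_fun H z
  exact cube_ext fun g w => by simp [insMap]

/-- At a fixed vertex a cube is a finite set of indices and `bdFix` is the augmented simplicial
boundary. Joining with the point `i` is the usual contraction; `i ≤ h` is needed because `insMap`
only inserts in front. -/
theorem insMap_homotopy (i : ℕ) {n : ℕ} (g : ThompsonF) {h : ℕ} (hi : i ≤ h) (w : Shape n) :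
    bdFix (n + 1) (insMap i (single (g, .cons h w) 1)) +
      insMap i (bdFix n (single (g, .cons h w) 1)) = single (g, .cons h w) 1 := by
  obtain rfl | hi := hi.eq_or_lt
  · rw [← cone_single, insMap_cone_self, map_zero, zero_add]
    cases n with
    | zero => rw [bdFix_zero_cone, ← bumpMap_zero_dim (i + 1) (single (g, w) 1), insMap_bumpMap,
        bumpMap_zero_dim]
    | succ n => rw [bdFix_succ_cone, map_sub, insMap_bumpMap, insMap_cone_self, sub_zero]
  · obtain ⟨k, rfl⟩ := Nat.exists_eq_add_of_lt hi
    have e : single (g, .cons (i + k + 1) w) 1 =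
        bumpMap (i + 1) (single (g, .cons k w) 1 : Cubes (n + 1)) := by
      rw [bumpMap_single, bump_cons, show i + k + 1 = k + (i + 1) by ring]
    rw [e, insMap_bumpMap, bdFix_succ_cone, bdFix_bumpMap, insMap_bumpMap, sub_add_cancel]

/-- The smallest index of a divisor. -/
noncomputable def firstDvd (p : ThompsonF) : ℕ := sInf {i | Dvd i p}

open Classical in
/-- The contracting homotopy for the part of the boundary that does not move the vertices. -/
noncomputable def contr (t : ThompsonF) {n : ℕ} : Cubes n →ₗ[ℤ] Cubes (n + 1) :=
  linearCombination ℤ fun y => if ∃ i, Dvd i (y.1⁻¹ * t)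
    then insMap (firstDvd (y.1⁻¹ * t)) (single y 1) else 0

/-- The cubes below `t` at a bounded distance. -/
noncomputable def below (t : ThompsonF) (n m : ℕ) : Submodule ℤ (Cubes n) :=
  supported ℤ ℤ {y | y.1⁻¹ * t ∈ pos ∧ AllDvd (y.1⁻¹ * t) 0 y.2 ∧ len (y.1⁻¹ * t) < m}

/-- The faces not counted in `bdFix` have their vertex moved up along a divisor, so the distance to
`t` drops strictly. -/
theorem bd_sub_bdFix_mem_below (t : ThompsonF) {n m : ℕ} {z : Cubes (n + 1)}
    (hz : z ∈ below t (n + 1) (m + 1)) : bd n 0 z - bdFix n z ∈ below t n m := by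
  refine apply_mem_of_mem_supported (bd n 0 - bdFix n) ?_ hz
  rintro ⟨g, w⟩ ⟨h1, h2, h3⟩
  refine supported_mono ?_ (bd_sub_bdFix_mem t g w h2)
  rintro ⟨g', w'⟩ ⟨i, _, rfl, hi, h⟩
  have e : (g * x i)⁻¹ * t = (x i)⁻¹ * (g⁻¹ * t) := by group
  have hl := hi.len_lt
  dsimp only at h h3 ⊢
  simp only [Set.mem_ofPred_eq]
  rw [e] at h ⊢
  exact ⟨hi, h, by omega⟩

theorem contr_mem_below (t : ThompsonF) {n m : ℕ} {z : Cubes n} (hz : z ∈ below t n m) :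
    contr t z ∈ below t (n + 1) m := by
  refine apply_mem_of_mem_supported (contr t) ?_ hz
  rintro ⟨g, w⟩ ⟨h1, h2, h3⟩
  simp only [contr, linearCombination_single, one_smul]
  split_ifs with h
  · have hf : Dvd (firstDvd (g⁻¹ * t)) (g⁻¹ * t) := Nat.sInf_mem h
    cases w with
    | nil =>
      simp only [insMap, linearCombination_single, one_smul]
      refine single_mem_supported ℤ _ ⟨h1, ⟨?_, trivial⟩, h3⟩
      rw [zero_add]
      exact hf
    | cons k w =>
      simp only [insMap, linearCombination_single, one_smul]
      split_ifs with h'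
      · refine single_mem_supported ℤ _ ⟨h1, ⟨?_, ?_⟩, h3⟩
        · rw [zero_add]
          exact hf
        · dsimp only at h' ⊢
          have e : 0 + firstDvd (g⁻¹ * t) + 1 + (k - firstDvd (g⁻¹ * t) - 1) = 0 + k := by omega
          rw [AllDvd, e]
          exact h2
      · exact zero_mem _
  · exact zero_mem _

theorem bdFix_single_mem (g : ThompsonF) {n : ℕ} (w : Shape (n + 1)) :
    bdFix n (single (g, w) 1) ∈ supported ℤ ℤ {y : ThompsonF × Shape n | y.1 = g} := by
  induction n with
  | zero =>
    obtain _ | ⟨h, w⟩ := w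
    rw [← cone_single, bdFix_zero_cone]
    exact single_mem_supported ℤ _ rfl
  | succ n ih =>
    obtain _ | ⟨h, w⟩ := w
    rw [← cone_single, bdFix_succ_cone, bumpMap_single]
    refine sub_mem (single_mem_supported ℤ _ rfl) (apply_mem_of_mem_supported _ ?_ (ih w))
    rintro ⟨g', w'⟩ rfl
    rw [cone_single]
    exact single_mem_supported ℤ _ rfl

/-- The cubes at `g` below `t` are all finite subsets of the set of divisors of `g⁻¹ * t`, hence a
full simplex, contracted to its smallest vertex. -/
theorem contr_homotopy (t : ThompsonF) {n m : ℕ} {z : Cubes (n + 1)}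
    (hz : z ∈ below t (n + 1) m) : bdFix (n + 1) (contr t z) + contr t (bdFix n z) = z := by
  have : bdFix (n + 1) (contr t z) + contr t (bdFix n z) - z ∈ (⊥ : Submodule ℤ _) := by
    refine apply_mem_of_mem_supported (bdFix (n + 1) ∘ₗ contr t + contr t ∘ₗ bdFix n -
      LinearMap.id) ?_ hz
    rintro ⟨g, _ | ⟨h, w⟩⟩ ⟨h1, h2, h3⟩
    have hd : ∃ i, Dvd i (g⁻¹ * t) := ⟨0 + h, h2.1⟩
    have hc {k : ℕ} {z : Cubes k} (hz : z ∈ supported ℤ ℤ {y : ThompsonF × Shape k | y.1 = g}) :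
        contr t z = insMap (firstDvd (g⁻¹ * t)) z := by
      have : contr t z - insMap (firstDvd (g⁻¹ * t)) z ∈ (⊥ : Submodule ℤ _) := by
        refine apply_mem_of_mem_supported (contr t - insMap (firstDvd (g⁻¹ * t))) ?_ hz
        rintro ⟨g', w'⟩ rfl
        rw [Submodule.mem_bot, LinearMap.sub_apply, sub_eq_zero]
        simp only [contr, linearCombination_single, one_smul]
        rw [if_pos hd]
      rwa [Submodule.mem_bot, sub_eq_zero] at this
    rw [Submodule.mem_bot, LinearMap.sub_apply, sub_eq_zero]
    refine Eq.trans ?_ (insMap_homotopy (firstDvd (g⁻¹ * t)) g (Nat.sInf_le ?_) w)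
    · rw [LinearMap.add_apply, LinearMap.comp_apply, LinearMap.comp_apply,
        hc (single_mem_supported ℤ _ rfl), hc (bdFix_single_mem g _)]
    · have := h2.1
      rwa [zero_add] at this
  rwa [Submodule.mem_bot, sub_eq_zero] at this

/-- Induction on the distance to `t`: the contraction is exact for the leading part `bdFix`, and its
error for the full boundary is closer to `t`. -/
theorem exists_bd_eq_of_mem_below (t : ThompsonF) {n : ℕ} (m : ℕ) : ∀ {z : Cubes (n + 1)},
    z ∈ below t (n + 1) m → bd n 0 z = 0 → ∃ y, bd (n + 1) 0 y = z := by
  induction m with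
  | zero =>
    intro z hz _
    refine ⟨0, ?_⟩
    have : z ∈ supported ℤ ℤ (∅ : Set (ThompsonF × Shape (n + 1))) :=
      supported_mono (fun y hy => absurd hy.2.2 (Nat.not_lt_zero _)) hz
    rw [supported_empty, Submodule.mem_bot] at this
    rw [map_zero, this]
  | succ m ih =>
    intro z hz h
    -- Since `bd n 0 z = 0`, `bdFix n z` is minus the part of the boundary closer to `t`. So both
    -- terms of `z - bd (contr t z) = contr t (bdFix n z) - (bd - bdFix) (contr t z)` are closer to
    -- `t`.
    obtain ⟨y, hy⟩ := ih (z := z - bd (n + 1) 0 (contr t z)) (by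
      have h1 := contr_homotopy t hz
      have h2 := contr_mem_below t (bd_sub_bdFix_mem_below t hz)
      have h3 := bd_sub_bdFix_mem_below t (contr_mem_below t hz)
      rw [h, zero_sub, map_neg] at h2
      convert sub_mem (neg_mem h2) h3 using 1
      nth_rewrite 1 [← h1]
      abel) (by rw [map_sub, h, bd_bd, sub_zero])
    exact ⟨y + contr t z, by rw [map_add, hy, sub_add_cancel]⟩

theorem exists_allDvd {n : ℕ} (w : Shape n) : ∀ c : ℕ, ∃ p ∈ pos, AllDvd p c w := by
  induction w with
  | nil => exact fun c => ⟨1, one_mem _, trivial⟩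
  | cons h w ih =>
    intro c
    obtain ⟨p, hp, hw⟩ := ih (c + h + 1)
    obtain ⟨r, hr, s, hs, e⟩ := ore (x_mem_pos (c + h)) p hp
    refine ⟨x (c + h) * r, mul_mem (x_mem_pos _) hr, ?_, ?_⟩
    · rw [Dvd, inv_mul_cancel_left]
      exact hr
    · rw [e]
      exact hw.mul_right hs

/-- By the Ore condition finitely many cubes have a common upper bound; finiteness of the support
bounds their distances. -/
theorem exists_mem_below {n : ℕ} (z : Cubes n) : ∃ t m, z ∈ below t n m := by
  have key : ∃ t, z ∈ supported ℤ ℤ {y : ThompsonF × Shape n |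
      y.1⁻¹ * t ∈ pos ∧ AllDvd (y.1⁻¹ * t) 0 y.2} := by
    induction z using Finsupp.induction_linear with
    | zero => exact ⟨1, zero_mem _⟩
    | add a b ha hb =>
      obtain ⟨t, ht⟩ := ha
      obtain ⟨t', ht'⟩ := hb
      obtain ⟨s, hs, hs'⟩ := exists_upper_bound t t'
      have mono {t : ThompsonF} (h : t⁻¹ * s ∈ pos) {y : ThompsonF × Shape n}
          (hy : y.1⁻¹ * t ∈ pos ∧ AllDvd (y.1⁻¹ * t) 0 y.2) :
          y.1⁻¹ * s ∈ pos ∧ AllDvd (y.1⁻¹ * s) 0 y.2 := by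
        have e : y.1⁻¹ * s = y.1⁻¹ * t * (t⁻¹ * s) := by group
        rw [e]
        exact ⟨mul_mem hy.1 h, hy.2.mul_right h⟩
      exact ⟨s, add_mem (supported_mono (fun y hy => mono hs hy) ht)
        (supported_mono (fun y hy => mono hs' hy) ht')⟩
    | single y r =>
      obtain ⟨p, hp, hw⟩ := exists_allDvd y.2 0
      refine ⟨y.1 * p, single_mem_supported ℤ _ ?_⟩
      simp only [Set.mem_ofPred_eq, inv_mul_cancel_left]
      exact ⟨hp, hw⟩
  obtain ⟨t, ht⟩ := key
  refine ⟨t, z.support.sup (fun y => len (y.1⁻¹ * t)) + 1, fun y hy => ⟨(ht hy).1, (ht hy).2, ?_⟩⟩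
  exact Nat.lt_succ_of_le (Finset.le_sup (f := fun y => len (y.1⁻¹ * t)) hy)

theorem exists_bd_eq {n : ℕ} {z : Cubes (n + 1)} (hz : bd n 0 z = 0) :
    ∃ y, bd (n + 1) 0 y = z := by
  obtain ⟨t, m, h⟩ := exists_mem_below z
  exact exists_bd_eq_of_mem_below t m h hz

end ThompsonF

/-! ### Group cohomology from a free resolution with chosen bases -/

open CategoryTheory Finsupp

theorem Rep.exact_of_forall_exists {k G : Type} [CommRing k] [Group G]
    (S : ShortComplex (Rep.{0} k G)) (h : ∀ y, S.g.hom y = 0 → ∃ x, S.f.hom x = y) : S.Exact := by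
  apply (forget₂ _ (ModuleCat k)).reflects_exact_of_faithful
  rw [ShortComplex.moduleCat_exact_iff]
  exact h

/-- A bound on cocycles modulo boundaries is transported to abstract homology through its embedding
in the opcycles. Stating boundaries with `prev` covers degree 0 as well. -/
theorem CochainComplex.exists_span_homology {k : Type} [CommRing k]
    (K : CochainComplex (ModuleCat.{0} k) ℕ) {n r : ℕ} (e : Fin r → K.X n)
    (he : ∀ i, K.d n (n + 1) (e i) = 0)
    (hs : ∀ z, K.d n (n + 1) z = 0 → ∃ m : Fin r → k, ∃ y,
      K.d ((ComplexShape.up ℕ).prev n) n y = z - ∑ i, m i • e i) :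
    ∃ c : Fin r → K.homology n, ∀ h, ∃ m : Fin r → k, h = ∑ i, m i • c i := by
  have hmk (x : K.X n) (hx : K.d n (n + 1) x = 0) : ∃ z, K.iCycles n z = x :=
    ⟨K.cyclesMk x (n + 1) (by simp) hx, K.i_cyclesMk x (n + 1) (by simp) hx⟩
  choose e' he' using fun i => hmk (e i) (he i)
  refine ⟨fun i => K.homologyπ n (e' i), fun h => ?_⟩
  obtain ⟨z, rfl⟩ := (ModuleCat.epi_iff_surjective (K.homologyπ n)).1 inferInstance h
  obtain ⟨m, y, hy⟩ := hs (K.iCycles n z) congr($(K.iCycles_d n (n + 1)) z)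
  refine ⟨m, ?_⟩
  rw [← sub_eq_zero]
  have h0 : K.homologyπ n (z - ∑ i, m i • e' i) = 0 := by
    apply (ModuleCat.mono_iff_injective (K.homologyι n)).1 inferInstance
    rw [map_zero]
    have := congr($(K.homology_π_ι n) (z - ∑ i, m i • e' i))
    refine this.trans (((K.sc n).moduleCat_pOpcycles_eq_zero_iff _).2 ⟨y, hy.trans ?_⟩)
    change _ = K.iCycles n (z - ∑ i, m i • e' i)
    simp only [map_sub, map_sum, map_smul, he']
  rw [← h0]
  simp only [map_sub, map_sum, map_smul]

/-- A resolution of the trivial representation by free representations with bases `S n`. -/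
structure FreeResolution (k G : Type) [CommRing k] [Group G] where
  S : ℕ → Type
  D (n : ℕ) : ((G × S (n + 1)) →₀ k) →ₗ[k] ((G × S n) →₀ k)
  D_smul (n : ℕ) (g : G) (z : (G × S (n + 1)) →₀ k) :
    D n (lmapDomain k k (fun y => (g * y.1, y.2)) z) =
      lmapDomain k k (fun y => (g * y.1, y.2)) (D n z)
  D_D (n : ℕ) (z : (G × S (n + 2)) →₀ k) : D n (D (n + 1) z) = 0
  exact (n : ℕ) (z : (G × S (n + 1)) →₀ k) : D n z = 0 → ∃ y, D (n + 1) y = z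
  exact_aug (z : (G × S 0) →₀ k) : linearCombination k (fun _ => (1 : k)) z = 0 ↔ ∃ y, D 0 y = z
  nonempty : Nonempty (S 0)

namespace FreeResolution

variable {k G : Type} [CommRing k] [Group G] (R : FreeResolution k G)

/-- The action on the terms. -/
noncomputable def ρ (n : ℕ) : Representation k G ((G × R.S n) →₀ k) where
  toFun g := lmapDomain k k (fun y => (g * y.1, y.2))
  map_one' := by
    simp only [one_mul]
    exact lmapDomain_id k k
  map_mul' g h := by
    rw [Module.End.mul_eq_comp, ← lmapDomain_comp]
    congr 1
    ext y <;> simp [mul_assoc]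

theorem ρ_single {n : ℕ} (g a : G) (w : R.S n) (r : k) :
    R.ρ n g (single (a, w) r) = single (g * a, w) r :=
  mapDomain_single

variable {N : Type} [AddCommGroup N] [Module k N] {σ : Representation k G N}

variable (σ) in
/-- The equivariant map with given values on the basis. -/
noncomputable def ofBasis {n : ℕ} (f : R.S n → N) : (R.ρ n).IntertwiningMap σ :=
  LinearMap.intertwiningMap_of_isIntertwiningMap _ _
    (linearCombination k fun y => σ y.1 (f y.2)) (by
      intro g z
      suffices H : (linearCombination k fun y : G × R.S n => σ y.1 (f y.2)) ∘ₗ R.ρ n g =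
          σ g ∘ₗ linearCombination k fun y => σ y.1 (f y.2) from LinearMap.congr_fun H z
      refine Finsupp.lhom_ext' fun ⟨a, w⟩ => LinearMap.ext_ring ?_
      simp [ρ_single])

theorem ofBasis_apply {n : ℕ} (f : R.S n → N) (z : (G × R.S n) →₀ k) :
    R.ofBasis σ f z = linearCombination k (fun y => σ y.1 (f y.2)) z := rfl

theorem ofBasis_single {n : ℕ} (f : R.S n → N) (g : G) (w : R.S n) :
    R.ofBasis σ f (single (g, w) 1) = σ g (f w) := by
  rw [ofBasis_apply]
  simp

theorem intertwining_ext {n : ℕ} {f f' : (R.ρ n).IntertwiningMap σ}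
    (h : ∀ w, f (single (1, w) 1) = f' (single (1, w) 1)) : f = f' := by
  refine Representation.IntertwiningMap.ext (Finsupp.lhom_ext' fun y => LinearMap.ext_ring ?_)
  have := congrArg (σ y.1) (h y.2)
  rw [← f.isIntertwining, ← f'.isIntertwining, ρ_single, mul_one] at this
  exact this

instance projective_ρ (n : ℕ) : Projective (Rep.of (R.ρ n)) where
  factors {E X} f e he := by
    rw [Rep.epi_iff_surjective] at he
    choose s hs using fun w : R.S n => he (f.hom (single (1, w) 1))
    refine ⟨Rep.ofHom (R.ofBasis E.ρ s), Rep.hom_ext (R.intertwining_ext fun w => ?_)⟩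
    change e.hom (R.ofBasis E.ρ s _) = _
    rw [ofBasis_single, map_one, Module.End.one_apply, hs]

/-- The differential as an equivariant map. -/
noncomputable def dHom (n : ℕ) : Rep.of (R.ρ (n + 1)) ⟶ Rep.of (R.ρ n) :=
  Rep.ofHom (LinearMap.intertwiningMap_of_isIntertwiningMap _ _ (R.D n) (R.D_smul n))

noncomputable def complex : ChainComplex (Rep.{0} k G) ℕ :=
  ChainComplex.of (fun n => Rep.of (R.ρ n)) R.dHom fun n =>
    Rep.hom_ext (Representation.IntertwiningMap.ext (LinearMap.ext fun z => R.D_D n z))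

noncomputable def aug : Rep.of (R.ρ 0) ⟶ Rep.trivial k G k :=
  Rep.ofHom (R.ofBasis (Rep.trivial k G k).ρ fun _ => (1 : k))

theorem aug_apply (z : (G × R.S 0) →₀ k) :
    R.aug.hom z = linearCombination k (fun _ => (1 : k)) z := rfl

theorem complex_d (n : ℕ) : R.complex.d (n + 1) n = R.dHom n :=
  ChainComplex.of_d (fun n => Rep.of (R.ρ n)) R.dHom n

theorem d_aug : R.complex.d 1 0 ≫ R.aug = 0 := by
  rw [complex_d]
  refine Rep.hom_ext (Representation.IntertwiningMap.ext (LinearMap.ext fun z => ?_))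
  exact (R.exact_aug _).2 ⟨z, rfl⟩

noncomputable def π : R.complex ⟶ (ChainComplex.single₀ (Rep.{0} k G)).obj (Rep.trivial k G k) :=
  (R.complex.toSingle₀Equiv _).symm ⟨R.aug, R.d_aug⟩

theorem π_f_zero : R.π.f 0 = R.aug := ChainComplex.toSingle₀Equiv_symm_apply_f_zero _ _

/-- Exactness is a statement about underlying modules, so the fields of the structure supply it
degree by degree. -/
theorem quasiIso_π : QuasiIso R.π where
  quasiIsoAt m := by
    cases m with
    | zero =>
      rw [ChainComplex.quasiIsoAt₀_iff, ShortComplex.quasiIso_iff_of_zeros' _ rfl rfl rfl]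
      constructor
      · refine Rep.exact_of_forall_exists _ fun y hy => ?_
        change (R.π.f 0).hom y = 0 at hy
        rw [π_f_zero] at hy
        obtain ⟨z, hz⟩ := (R.exact_aug y).1 hy
        refine ⟨z, ?_⟩
        change (R.complex.d 1 0).hom z = y
        rw [complex_d]
        exact hz
      · rw [Rep.epi_iff_surjective]
        intro r
        obtain ⟨w⟩ := R.nonempty
        refine ⟨(single (1, w) r : (G × R.S 0) →₀ k), ?_⟩
        change (R.π.f 0).hom _ = r
        rw [π_f_zero]
        refine (R.aug_apply _).trans ?_
        exact (linearCombination_single k (show k from r) (1, w)).trans (mul_one (show k from r))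
    | succ m =>
      rw [quasiIsoAt_iff_exactAt' (hL := ChainComplex.exactAt_succ_single_obj ..),
          HomologicalComplex.exactAt_iff' _ (m + 2) (m + 1) m (by simp) (by simp)]
      refine Rep.exact_of_forall_exists _ fun y hy => ?_
      change (R.complex.d (m + 1) m).hom y = 0 at hy
      rw [complex_d] at hy
      obtain ⟨z, hz⟩ := R.exact m y hy
      refine ⟨z, ?_⟩
      change (R.complex.d (m + 2) (m + 1)).hom z = y
      rw [complex_d]
      exact hz

noncomputable def resolution : ProjectiveResolution (Rep.trivial k G k) where
  complex := R.complex
  projective n := R.projective_ρ n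
  π := R.π
  quasiIso := R.quasiIso_π

variable (A : Rep.{0} k G)

/-- The differential on cochains. -/
noncomputable def cochainD {n : ℕ} (f : R.S n → A) (w : R.S (n + 1)) : A :=
  R.ofBasis A.ρ f (R.D n (single (1, w) 1))

/-- A cochain is a boundary if it is in the image of the differential. -/
def IsBoundary : ∀ {n : ℕ}, (R.S n → A) → Prop
  | 0, f => f = 0
  | _ + 1, f => ∃ y, R.cochainD A y = f

/-- Equivariant maps correspond to functions on the basis. -/
noncomputable def basisEquiv (n : ℕ) : (Rep.of (R.ρ n) ⟶ A) ≃ₗ[k] (R.S n → A) where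
  toFun f w := f.hom (single (1, w) 1)
  map_add' _ _ := rfl
  map_smul' _ _ := rfl
  invFun f := Rep.ofHom (R.ofBasis A.ρ f)
  left_inv f := Rep.hom_ext (R.intertwining_ext fun w => by
    change R.ofBasis A.ρ _ _ = _
    rw [ofBasis_single, map_one, Module.End.one_apply])
  right_inv f := by
    ext w
    change R.ofBasis A.ρ _ _ = _
    rw [ofBasis_single, map_one, Module.End.one_apply]

theorem basisEquiv_symm_cochainD {n : ℕ} (f : R.S n → A) :
    (R.basisEquiv A (n + 1)).symm (R.cochainD A f) =
      R.dHom n ≫ (R.basisEquiv A n).symm f :=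
  (LinearEquiv.symm_apply_eq _).2 rfl

/-- Any projective resolution computes the cohomology, and equivariant maps out of its terms are
functions on the bases, so explicit cochains suffice. -/
theorem exists_span_groupCohomology {n r : ℕ} (e : Fin r → (R.S n → A))
    (he : ∀ i, R.cochainD A (e i) = 0)
    (hs : ∀ z, R.cochainD A z = 0 → ∃ m : Fin r → k, R.IsBoundary A (z - ∑ i, m i • e i)) :
    ∃ c : Fin r → groupCohomology A n, ∀ h, ∃ m : Fin r → k, h = ∑ i, m i • c i := by
  let K := R.resolution.complex.linearYonedaObj k A
  have hd (m : ℕ) (f : R.S m → A) : K.d m (m + 1) ((R.basisEquiv A m).symm f) =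
      (R.basisEquiv A (m + 1)).symm (R.cochainD A f) := by
    have h := R.complex_d m
    exact (congrArg (fun d : Rep.of (R.ρ (m + 1)) ⟶ Rep.of (R.ρ m) =>
      d ≫ (R.basisEquiv A m).symm f) h).trans (R.basisEquiv_symm_cochainD A f).symm
  obtain ⟨c, hc⟩ := CochainComplex.exists_span_homology K (n := n)
    (fun i => (R.basisEquiv A n).symm (e i))
    (fun i => by rw [hd, he]; exact map_zero (R.basisEquiv A (n + 1)).symm)
    (fun z hz => by
      obtain ⟨f, rfl⟩ := (R.basisEquiv A n).symm.surjective z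
      rw [hd] at hz
      obtain ⟨m, hm⟩ := hs f ((R.basisEquiv A (n + 1)).symm.injective
        (hz.trans (map_zero (R.basisEquiv A (n + 1)).symm).symm))
      refine ⟨m, ?_⟩
      have key : (R.basisEquiv A n).symm (f - ∑ i, m i • e i) = (R.basisEquiv A n).symm f -
          ∑ i, m i • (R.basisEquiv A n).symm (e i) := by
        rw [map_sub, map_sum]
        simp only [map_smul]
      cases n with
      | zero =>
        refine ⟨0, (map_zero _).trans (Eq.trans ?_ key)⟩
        rw [show f - ∑ i, m i • e i = 0 from hm, map_zero]
        rfl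
      | succ n =>
        obtain ⟨y, hy⟩ := hm
        rw [(ComplexShape.up ℕ).prev_eq' (i := n + 1) (j := n) rfl]
        refine ⟨(R.basisEquiv A n).symm y, (hd n y).trans (Eq.trans ?_ key)⟩
        rw [hy])
  let φ := groupCohomologyIso A n R.resolution
  refine ⟨fun i => φ.inv (c i), fun h => ?_⟩
  obtain ⟨m, hm⟩ := hc (φ.hom h)
  refine ⟨m, ?_⟩
  have h1 : φ.inv (φ.hom h) = h := congr($(φ.hom_inv_id) h)
  rw [← h1, hm, map_sum]
  simp only [map_smul]

end FreeResolution

theorem Finsupp.linearCombination_single_one {α k M : Type*} [Semiring k] [AddCommMonoid M]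
    [Module k M] (v : α → M) (a : α) : linearCombination k v (single a 1) = v a := by
  rw [linearCombination_single, one_smul]

/-! ### Cubical cochains and suspension -/

namespace ThompsonF

open Finsupp

/-- The cubical resolution. -/
noncomputable def cubeResolution : FreeResolution ℤ ThompsonF where
  S := Shape
  D n := bd n 0
  D_smul _ g z := bd_lmul g 0 z
  D_D _ z := bd_bd 0 z
  exact _ _ h := exists_bd_eq h
  exact_aug _ := ⟨fun h => exists_bd_eq_of_aug h, fun ⟨y, hy⟩ => hy ▸ aug_bd y⟩
  nonempty := ⟨.nil⟩

section cochains

variable {k N : Type} [CommRing k] [AddCommGroup N] [Module k N] (τ : N ≃ₗ[k] N)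

/-- The differential of cubical cochains, if all generators act by `τ`. -/
def cubeD : ∀ {n : ℕ}, (Shape n → N) → Shape (n + 1) → N
  | 0, f, .cons _ w => f w - τ (f w)
  | _ + 1, f, .cons h w =>
      f (bump (h + 1) w) - τ (f (bump (h + 2) w)) - cubeD (fun v => f (.cons h v)) w

theorem cubeD_add {n : ℕ} (f g : Shape n → N) : cubeD τ (f + g) = cubeD τ f + cubeD τ g := by
  induction n with
  | zero =>
    ext w
    obtain _ | ⟨h, w⟩ := w
    simp only [cubeD, Pi.add_apply, map_add]
    abel
  | succ n ih =>
    ext w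
    obtain _ | ⟨h, w⟩ := w
    have := congrFun (ih (fun v => f (.cons h v)) (fun v => g (.cons h v))) w
    simp only [Pi.add_apply, cubeD, map_add] at this ⊢
    rw [show (fun v => f (.cons h v) + g (.cons h v)) =
      (fun v => f (.cons h v)) + fun v => g (.cons h v) from rfl, this]
    abel

/-- The differential as an additive map. -/
def cubeDHom (n : ℕ) : (Shape n → N) →+ (Shape (n + 1) → N) :=
  AddMonoidHom.mk' (cubeD τ) (cubeD_add τ)

theorem cubeD_zero {n : ℕ} : cubeD τ (0 : Shape n → N) = 0 := map_zero (cubeDHom τ n)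

theorem cubeD_sub {n : ℕ} (f g : Shape n → N) : cubeD τ (f - g) = cubeD τ f - cubeD τ g :=
  map_sub (cubeDHom τ n) f g

theorem cubeD_comp {n : ℕ} (φ : N ≃ₗ[k] N) (h : ∀ v, φ (τ v) = τ (φ v)) (f : Shape n → N) :
    cubeD τ (fun w => φ (f w)) = fun w => φ (cubeD τ f w) := by
  induction n with
  | zero =>
    ext w
    obtain _ | ⟨k, w⟩ := w
    simp only [cubeD, map_sub, h]
  | succ n ih =>
    ext w
    obtain _ | ⟨k, w⟩ := w
    simp only [cubeD, map_sub, h, ih]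

theorem cubeD_bump {n : ℕ} (j : ℕ) (f : Shape n → N) :
    cubeD τ (fun w => f (bump j w)) = fun w => cubeD τ f (bump j w) := by
  cases n with
  | zero =>
    ext w
    obtain _ | ⟨h, _ | _⟩ := w
    rfl
  | succ n =>
    ext w
    obtain _ | ⟨h, w⟩ := w
    simp only [bump_cons, cubeD, bump_bump]
    rw [show h + 1 + j = h + j + 1 by ring, show h + 2 + j = h + j + 2 by ring]

theorem cubeD_cubeD {n : ℕ} (f : Shape n → N) : cubeD τ (cubeD τ f) = 0 := by
  induction n with
  | zero =>
    ext w
    obtain _ | ⟨h, _ | ⟨h', _ | _⟩⟩ := w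
    simp [cubeD]
  | succ n ih =>
    ext w
    obtain _ | ⟨h, w⟩ := w
    have e : (fun v => cubeD τ f (.cons h v)) = (fun v => f (bump (h + 1) v)) -
        (fun v => τ (f (bump (h + 2) v))) - cubeD τ (fun v => f (.cons h v)) := rfl
    rw [cubeD, e, cubeD_sub, cubeD_sub, ih, sub_zero, cubeD_bump,
      cubeD_comp τ τ (fun _ => rfl) fun v => f (bump (h + 2) v), cubeD_bump]
    exact sub_self _

/-- The suspension of cubical cochains. -/
def susp {n : ℕ} (c : Shape n → N) : Shape (n + 1) → N
  | .cons 0 _ => 0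
  | .cons (h + 1) w => (τ⁻¹ ^ h) (c w)

theorem apply_inv_pow_succ (h : ℕ) (v : N) : τ ((τ⁻¹ ^ (h + 1)) v) = (τ⁻¹ ^ h) v := by
  rw [pow_succ', LinearEquiv.mul_apply]
  exact τ.apply_symm_apply _

theorem inv_pow_apply_comm (h : ℕ) (v : N) : (τ⁻¹ ^ h) (τ v) = τ ((τ⁻¹ ^ h) v) := by
  have : τ⁻¹ ^ h * τ = τ * τ⁻¹ ^ h := ((Commute.refl τ).inv_left.pow_left h).eq
  exact LinearEquiv.congr_fun this v

/-- The values of a suspension in successive positive directions differ by τ, so the two faces in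
the first direction cancel and only the inner boundary remains. -/
theorem cubeD_susp {n : ℕ} (c : Shape n → N) : cubeD τ (susp τ c) = -susp τ (cubeD τ c) := by
  ext w
  obtain _ | ⟨h, _ | ⟨k, w⟩⟩ := w
  have e1 : bump (h + 1) (.cons k w) = .cons (k + h + 1) w := rfl
  have e2 : bump (h + 2) (.cons k w) = .cons (k + h + 1 + 1) w := rfl
  rw [cubeD, e1, e2, susp, susp, apply_inv_pow_succ, sub_self, zero_sub, Pi.neg_apply]
  congr 1
  cases h with
  | zero => exact congrFun (cubeD_zero τ) _
  | succ h =>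
    exact congrFun (cubeD_comp τ (τ⁻¹ ^ h) (inv_pow_apply_comm τ h) c) _

/-- A cochain whose coboundary has prescribed values in the direction `0`. -/
def normalizer {n : ℕ} (f : Shape (n + 2) → N) : ℕ → Shape n → N
  | 0, _ => 0
  | 1, _ => 0
  | h + 2, w => τ⁻¹ (normalizer f (h + 1) w - f (.cons 0 (.cons h w)))

/-- The cocycle condition in the first directions 0 and 1 determines a cocycle by its values in
direction 1, once those in direction 0 have been removed. This drives the bound in all degrees. -/
theorem exists_eq_add_susp {n : ℕ} {f : Shape (n + 2) → N} (hf : cubeD τ f = 0) :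
    ∃ g c : Shape (n + 1) → N, cubeD τ c = 0 ∧ f = cubeD τ g + susp τ c := by
  -- The recursion solves the equation that the coboundary of `g` agrees with `f` in the first
  -- direction 0; the start values 0 make the inner term disappear.
  let g : Shape (n + 1) → N := fun | .cons h w => normalizer τ f h w
  have hττ (v : N) : τ (τ⁻¹ v) = v := τ.apply_symm_apply v
  have key : ∀ f' : Shape (n + 2) → N, cubeD τ f' = 0 → (∀ w, f' (.cons 0 w) = 0) →
      ∃ c, cubeD τ c = 0 ∧ f' = susp τ c := by
    intro f' hf' h0
    have hz : (fun v => f' (.cons 0 v)) = 0 := funext h0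
    have h1 (h : ℕ) (w : Shape (n + 1)) : f' (.cons (h + 1) w) = τ (f' (.cons (h + 2) w)) := by
      have := congrFun hf' (.cons 0 (.cons h w))
      rw [cubeD, hz, cubeD_zero] at this
      simpa [sub_eq_zero] using this
    have h2 (h : ℕ) (w : Shape (n + 1)) : f' (.cons (h + 1) w) = (τ⁻¹ ^ h) (f' (.cons 1 w)) := by
      induction h with
      | zero => rfl
      | succ h ih =>
        apply τ.injective
        rw [← h1, apply_inv_pow_succ, ih]
    refine ⟨fun w => f' (.cons 1 w), ?_, ?_⟩
    · ext w
      obtain _ | ⟨h, w⟩ := w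
      have := congrFun hf' (.cons 1 (.cons h w))
      rw [cubeD] at this
      simp only [bump_cons] at this
      rw [h1 (h + 1), sub_self, zero_sub, Pi.zero_apply, neg_eq_zero] at this
      exact this
    · ext w
      obtain _ | ⟨_ | h, w⟩ := w
      · exact h0 w
      · exact h2 h w
  obtain ⟨c, hc, e⟩ := key (f - cubeD τ g) (by rw [cubeD_sub, hf, cubeD_cubeD, sub_zero]) (by
    intro w
    obtain _ | ⟨h, w⟩ := w
    have hz : (fun v => g (.cons 0 v)) = 0 := rfl
    rw [Pi.sub_apply, cubeD, hz, cubeD_zero]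
    simp only [bump_cons, zero_add]
    simp only [g, normalizer, hττ]
    simp)
  exact ⟨g, c, hc, by rw [← e, add_sub_cancel]⟩

theorem susp_add {n : ℕ} (c c' : Shape n → N) : susp τ (c + c') = susp τ c + susp τ c' := by
  ext w
  obtain _ | ⟨_ | h, w⟩ := w
  · exact (add_zero 0).symm
  · exact map_add (τ⁻¹ ^ h) _ _

theorem susp_sum {n r : ℕ} (m : Fin r → k) (e : Fin r → Shape n → N) :
    susp τ (∑ i, m i • e i) = ∑ i, m i • susp τ (e i) := by
  ext w
  simp only [Finset.sum_apply, Pi.smul_apply]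
  obtain _ | ⟨_ | h, w⟩ := w
  · simp only [susp, smul_zero, Finset.sum_const_zero]
  · simp only [susp, Finset.sum_apply, Pi.smul_apply, map_sum, map_smul]

/-- The cubical cohomology in degree `n + 1` is generated by `r` elements. -/
def SpanBy (n r : ℕ) : Prop :=
  ∃ e : Fin r → Shape (n + 1) → N, (∀ i, cubeD τ (e i) = 0) ∧
    ∀ z, cubeD τ z = 0 → ∃ m : Fin r → k, ∃ y, cubeD τ y = z - ∑ i, m i • e i

theorem SpanBy.succ {n r : ℕ} (h : SpanBy τ n r) : SpanBy τ (n + 1) r := by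
  obtain ⟨e, he, hs⟩ := h
  refine ⟨fun i => susp τ (e i), fun i => ?_, fun z hz => ?_⟩
  · have h0 : susp τ (0 : Shape (n + 2) → N) = 0 := by
      have := susp_add τ (0 : Shape (n + 2) → N) 0
      rwa [add_zero, left_eq_add] at this
    rw [cubeD_susp, he, h0, neg_zero]
  · obtain ⟨g, c, hc, rfl⟩ := exists_eq_add_susp τ hz
    obtain ⟨m, y, hy⟩ := hs c hc
    refine ⟨m, g - susp τ y, ?_⟩
    rw [cubeD_sub, cubeD_susp, hy, sub_neg_eq_add, add_sub_assoc, ← susp_sum]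
    congr 1
    rw [eq_sub_iff_add_eq, ← susp_add, sub_add_cancel]

theorem SpanBy.of_zero {r : ℕ} (h : SpanBy τ 0 r) : ∀ n, SpanBy τ n r
  | 0 => h
  | n + 1 => (SpanBy.of_zero h n).succ

theorem cubeD_one_apply (f : Shape 1 → N) (h h' : ℕ) :
    cubeD τ f (.cons h (.cons h' .nil)) = f (.cons (h' + h + 1) .nil) -
      τ (f (.cons (h' + h + 2) .nil)) - (f (.cons h .nil) - τ (f (.cons h .nil))) := rfl

/-- In degree 1, surjectivity of `1 - τ` removes the value in direction 0; the rest is then constant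
and fixed by τ. -/
theorem spanBy_one_of_surjective (u : N) (hu : τ u = u) (h1 : ∀ v, ∃ w, w - τ w = v)
    (h2 : ∀ v, τ v = v → ∃ m : k, v = m • u) (n : ℕ) : SpanBy τ n 1 := by
  refine SpanBy.of_zero τ ⟨fun _ => fun | .cons 0 _ => 0 | .cons (_ + 1) _ => u, fun _ => ?_,
    fun z hz => ?_⟩ n
  · ext w
    obtain _ | ⟨_ | h, _ | ⟨h', _ | _⟩⟩ := w <;> simp [cubeD_one_apply, hu]
  · obtain ⟨y, hy⟩ := h1 (z (.cons 0 .nil))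
    have H (h h' : ℕ) := congrFun hz (.cons h (.cons h' .nil))
    simp only [cubeD_one_apply, Pi.zero_apply] at H
    have e1 (h : ℕ) : z (.cons (h + 1) .nil) - (y - τ y) =
        τ (z (.cons (h + 2) .nil) - (y - τ y)) := by
      have := H 0 h
      rw [← hy, sub_eq_zero, add_zero, sub_eq_iff_eq_add] at this
      rw [this]
      simp only [map_sub]
      abel
    -- Comparing the cocycle condition on the cube `(1, 2)` with the recursion just obtained from
    -- `(0, 2)` leaves exactly τ-invariance.
    have e2 : τ (z (.cons 1 .nil) - (y - τ y)) = z (.cons 1 .nil) - (y - τ y) := by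
      have h1 := H 1 0
      have h2 := e1 1
      rw [map_sub, sub_eq_sub_iff_add_eq_add] at h2
      rw [zero_add, sub_eq_zero, sub_eq_sub_iff_add_eq_add] at h1
      rw [map_sub, sub_eq_sub_iff_add_eq_add]
      simp only [Nat.reduceAdd] at h1 h2
      have : z (.cons 2 .nil) + (τ (z (.cons 1 .nil)) + (y - τ y)) =
          z (.cons 2 .nil) + (z (.cons 1 .nil) + τ (y - τ y)) := by
        rw [← add_assoc, h1, add_assoc, ← h2]
        exact add_left_comm _ _ _
      exact add_left_cancel this
    obtain ⟨m, hm⟩ := h2 _ e2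
    have e3 (h : ℕ) : z (.cons (h + 1) .nil) - (y - τ y) = m • u := by
      induction h with
      | zero => exact hm
      | succ h ih => exact τ.injective (by rw [← e1, ih, map_smul, hu])
    refine ⟨fun _ => m, fun _ => y, ?_⟩
    ext w
    obtain _ | ⟨_ | h, _ | _⟩ := w
    · simpa [cubeD] using hy
    · simp only [cubeD, Finset.univ_unique, Finset.sum_singleton, Pi.sub_apply, Pi.smul_apply]
      rw [← e3 h, sub_sub_cancel]

/-- With trivial action a 1-cocycle is constant on positive directions, so only its values in
directions 0 and 1 are free. -/
theorem spanBy_two (τ : k ≃ₗ[k] k) (hτ : ∀ v, τ v = v) (n : ℕ) : SpanBy τ n 2 := by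
  refine SpanBy.of_zero τ ⟨![fun | .cons 0 _ => 1 | .cons (_ + 1) _ => 0,
    fun | .cons 0 _ => 0 | .cons (_ + 1) _ => 1], fun i => ?_, fun z hz => ?_⟩ n
  · ext w
    fin_cases i <;> obtain _ | ⟨_ | h, _ | ⟨h', _ | _⟩⟩ := w <;> simp [cubeD_one_apply, hτ]
  · have H (l : ℕ) : z (.cons (l + 1) .nil) = z (.cons 1 .nil) := by
      induction l with
      | zero => rfl
      | succ l ih =>
        have := congrFun hz (.cons 0 (.cons l .nil))
        rw [cubeD_one_apply, hτ, hτ, sub_self, sub_zero, Pi.zero_apply, sub_eq_zero] at this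
        rw [← ih]
        exact this.symm
    refine ⟨![z (.cons 0 .nil), z (.cons 1 .nil)], 0, ?_⟩
    rw [cubeD_zero]
    ext w
    obtain _ | ⟨_ | l, _ | _⟩ := w <;> simp [H]

end cochains

/-- All generators act alike, so the offset `c` of the directions is invisible to the coefficients.
-/
theorem linearCombination_bd {N : Type} [AddCommGroup N] [Module ℤ N] (τ : N ≃ₗ[ℤ] N)
    (ρ : Representation ℤ ThompsonF N) (hρ : ∀ i v, ρ (x i) v = τ v)
    {n : ℕ} : ∀ (c : ℕ) (f : Shape n → N) (w : Shape (n + 1)),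
    linearCombination ℤ (fun y : ThompsonF × Shape n => ρ y.1 (f y.2)) (bd n c (single (1, w) 1)) =
      cubeD τ f w := by
  induction n with
  | zero =>
    intro c f w
    obtain _ | ⟨h, w⟩ := w
    rw [← cone_single, bd_zero_cone, vertexMap_single, map_sub, linearCombination_single_one,
      linearCombination_single_one, map_one, one_mul, hρ, Module.End.one_apply]
    rfl
  | succ n ih =>
    intro c f w
    obtain _ | ⟨h, w⟩ := w
    rw [← cone_single, bd_succ_cone, vertexMap_single, bumpMap_single, bumpMap_single, map_sub,
      map_sub, linearCombination_single_one, linearCombination_single_one, map_one,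
      one_mul, hρ, Module.End.one_apply, cubeD, ← ih (c + h + 1)]
    congr 1
    exact linearCombination_mapDomain _ _ _

theorem exists_span_groupCohomology {N : Type} [AddCommGroup N] [Module ℤ N]
    (ρ : Representation ℤ ThompsonF N) (τ : N ≃ₗ[ℤ] N) (hρ : ∀ i v, ρ (x i) v = τ v) {n r : ℕ}
    (h : SpanBy τ n r) : ∃ c : Fin r → groupCohomology (Rep.of ρ) (n + 1),
      ∀ h, ∃ m : Fin r → ℤ, h = ∑ i, m i • c i := by
  have hd {n : ℕ} (f : Shape n → N) : cubeResolution.cochainD (Rep.of ρ) f = cubeD τ f :=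
    funext fun w => linearCombination_bd τ ρ hρ 0 f w
  obtain ⟨e, he, hs⟩ := h
  obtain ⟨c, hc⟩ := cubeResolution.exists_span_groupCohomology (Rep.of ρ) e
    (fun i => (hd _).trans (he i)) fun z hz => by
      obtain ⟨m, y, hy⟩ := hs z ((hd z).symm.trans hz)
      exact ⟨m, y, (hd y).trans hy⟩
  refine ⟨c, fun h => ?_⟩
  obtain ⟨m, hm⟩ := hc h
  refine ⟨m, hm.trans (Finset.sum_congr rfl fun i _ => ?_)⟩
  exact int_smul_eq_zsmul _ (m i) (c i)

/-! ### Bounds for F and for the kernel of the degree -/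

open groupCohomology

theorem exists_span_intCohomology (n : ℕ) :
    ∃ c : Fin 2 → IntCohomology ThompsonF (n + 1), ∀ h, ∃ m : Fin 2 → ℤ, h = ∑ i, m i • c i :=
  exists_span_groupCohomology (Representation.trivial ℤ ThompsonF ℤ) (LinearEquiv.refl ℤ ℤ) (fun _ _ => rfl)
    (spanBy_two _ (fun _ => rfl) n)

/-- The kernel of the degree. -/
abbrev degKer : Subgroup ThompsonF := deg.ker

theorem exists_sub_shift_eq (c : ℤ → ℤ) : ∃ d : ℤ → ℤ, ∀ k, d k - d (k + 1) = c k := by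
  -- A discrete primitive based at 0; one of the two sums is always empty.
  refine ⟨fun k => ∑ i ∈ Finset.Ico k 0, c i - ∑ i ∈ Finset.Ico 0 k, c i, fun k => ?_⟩
  dsimp only
  rcases lt_or_ge k 0 with h | h
  · rw [Finset.Ico_eq_empty (a := 0) (b := k) (by omega),
      Finset.Ico_eq_empty (a := 0) (b := k + 1) (by omega), ← Finset.insert_Ico_add_one_left_eq_Ico h,
      Finset.sum_insert (by simp)]
    simp
  · rw [Finset.Ico_eq_empty (a := k) (by omega), Finset.Ico_eq_empty (a := k + 1) (by omega),
      ← Finset.insert_Ico_right_eq_Ico_add_one h, Finset.sum_insert (by simp)]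
    simp

/-- By Shapiro's lemma the coefficients become the coinduced module, that is integer sequences on
which every generator acts by the same shift τ. There `1 - τ` is surjective and the fixed vectors
are the constants. -/
theorem exists_generator_degKer (n : ℕ) :
    ∃ c : IntCohomology degKer (n + 1), ∀ h, ∃ m : ℤ, h = m • c := by
  let σ := Representation.trivial ℤ degKer ℤ
  let ρ := Representation.coind degKer.subtype σ
  let N := Representation.coindV degKer.subtype σ
  let τ : N ≃ₗ[ℤ] N := LinearEquiv.ofLinearMap (ρ (x 0)) (ρ (x 0)⁻¹)
    (by rw [← Module.End.mul_eq_comp, ← map_mul, mul_inv_cancel, map_one]; rfl)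
    (by rw [← Module.End.mul_eq_comp, ← map_mul, inv_mul_cancel, map_one]; rfl)
  -- Elements of the coinduced module are functions on the quotient by `degKer`, that is, of the
  -- degree only.
  have hinv (f : N) (g h : ThompsonF) (e : deg g = deg h) : f.1 g = f.1 h := by
    have := f.2 ⟨g * h⁻¹, by rw [MonoidHom.mem_ker, map_mul, map_inv, e, mul_inv_cancel]⟩ h
    simpa using this
  have hmk (d : ℤ → ℤ) : ∃ f : N, ∀ g, f.1 g = d (deg g).toAdd := by
    refine ⟨⟨fun g => d (deg g).toAdd, fun s h => ?_⟩, fun g => rfl⟩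
    have : deg (degKer.subtype s) = 1 := s.2
    change d (deg (_ * h)).toAdd = d (deg h).toAdd
    rw [map_mul, this, one_mul]
  have hτ (f : N) (g : ThompsonF) : (τ f).1 g = f.1 (g * x 0) := rfl
  have hpow (g : ThompsonF) : deg g = deg (x 0 ^ (deg g).toAdd) := by
    rw [map_zpow, deg_x, ← ofAdd_zsmul]
    simp
  obtain ⟨u, hu⟩ := hmk fun _ => 1
  obtain ⟨c, hc⟩ := exists_span_groupCohomology ρ τ
    (fun i v => Subtype.ext (funext fun g => hinv v (g * x i) (g * x 0) (by simp)))
    (spanBy_one_of_surjective τ u (Subtype.ext (funext fun g => by rw [hτ, hu, hu])) (by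
      intro v
      obtain ⟨d, hd⟩ := exists_sub_shift_eq fun k => v.1 (x 0 ^ k)
      obtain ⟨w, hw⟩ := hmk d
      refine ⟨w, Subtype.ext (funext fun g => ?_)⟩
      change w.1 g - (τ w).1 g = v.1 g
      rw [hτ, hw, hw, map_mul, deg_x, toAdd_mul, toAdd_ofAdd, hd, hinv v g _ (hpow g)]) (by
      intro v hv
      refine ⟨v.1 1, Subtype.ext (funext fun g => ?_)⟩
      change v.1 g = v.1 1 * u.1 g
      rw [hu, mul_one, hinv v g _ (hpow g)]
      have h1 (g : ThompsonF) : v.1 (g * x 0) = v.1 g := by rw [← hτ, hv]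
      generalize (deg g).toAdd = k
      induction k with
      | zero => rw [zpow_zero]
      | succ k ih => rw [zpow_add_one, h1, ih]
      | pred k ih => rw [← h1, ← zpow_add_one, sub_add_cancel, ih]) n)
  let φ := groupCohomology.coindIso (Rep.trivial ℤ degKer ℤ) (n + 1)
  refine ⟨φ.hom (c 0), fun h => ?_⟩
  obtain ⟨m, hm⟩ := hc (φ.inv h)
  refine ⟨m 0, ?_⟩
  rw [Fin.sum_univ_one] at hm
  have h1 : φ.hom (φ.inv h) = h := congr($(φ.inv_hom_id) h)
  rw [← h1, hm]
  exact map_zsmul φ.hom.hom _ _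

end ThompsonF

/-! ### Maps on cohomology classes, pullback, and evaluation on tori -/

namespace groupCohomology

section descend
variable {G M : Type} [Group G] [AddCommGroup M]

/-- A homomorphism on cocycles killing the coboundaries, on cohomology. -/
noncomputable def descend {n : ℕ} (φ : (delta (G := G) n).ker →+ M)
    (h : ∀ f : (delta (G := G) n).ker, IsCoboundary n f.1 → φ f = 0) : IntCohomology G n →+ M :=
  (cls n).liftOfRightInverse _ (Function.surjInv_eq (cls_surjective n))
    ⟨φ, fun f hf => h f ((cls_eq_zero_iff_isCoboundary n f).1 hf)⟩

theorem descend_cls {n : ℕ} (φ : (delta (G := G) n).ker →+ M)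
    (h : ∀ f : (delta (G := G) n).ker, IsCoboundary n f.1 → φ f = 0) (f : (delta (G := G) n).ker) :
    descend φ h (cls n f) = φ f :=
  AddMonoidHom.liftOfRightInverse_comp_apply _ _ _ _ _

end descend

section pull
variable {G H K : Type} [Group G] [Group H] [Group K] (φ : G →* H)

/-- The pullback of cochains. -/
def pull (n : ℕ) : IntCochain H n →+ IntCochain G n where
  toFun f x := f fun i => φ (x i)
  map_zero' := rfl
  map_add' _ _ := rfl

theorem pull_apply {n : ℕ} (f : IntCochain H n) (x : Fin n → G) :
    pull φ n f x = f fun i => φ (x i) := rfl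

theorem delta_pull {n : ℕ} (f : IntCochain H n) : delta n (pull φ n f) = pull φ (n + 1) (delta n f) := by
  ext x
  simp only [delta_apply, pull_apply]
  congr 1
  refine Finset.sum_congr rfl fun j _ => ?_
  congr 2
  ext i
  simp only [Fin.contractNth]
  split_ifs <;> simp

theorem isCoboundary_pull {n : ℕ} {f : IntCochain H n} (h : IsCoboundary n f) :
    IsCoboundary n (pull φ n f) := by
  cases n with
  | zero => exact (congrArg (pull φ 0) (show f = 0 from h)).trans (map_zero _)
  | succ n =>
    obtain ⟨g, rfl⟩ := h
    exact ⟨pull φ n g, delta_pull φ g⟩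

theorem isCoboundary_add {n : ℕ} {f g : IntCochain G n} (hf : IsCoboundary n f)
    (hg : IsCoboundary n g) : IsCoboundary n (f + g) := by
  cases n with
  | zero =>
    obtain rfl : f = 0 := hf
    rwa [zero_add]
  | succ n =>
    obtain ⟨a, rfl⟩ := hf
    obtain ⟨b, rfl⟩ := hg
    exact ⟨a + b, map_add _ _ _⟩

theorem isCoboundary_neg {n : ℕ} {f : IntCochain G n} (hf : IsCoboundary n f) :
    IsCoboundary n (-f) := by
  cases n with
  | zero =>
    obtain rfl : f = 0 := hf
    exact neg_zero
  | succ n =>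
    obtain ⟨a, rfl⟩ := hf
    exact ⟨-a, map_neg _ _⟩

theorem isCoboundary_sub {n : ℕ} {f g : IntCochain G n} (hf : IsCoboundary n f)
    (hg : IsCoboundary n g) : IsCoboundary n (f - g) :=
  sub_eq_add_neg f g ▸ isCoboundary_add hf (isCoboundary_neg hg)

theorem delta_delta {n : ℕ} (f : IntCochain G n) : delta (n + 1) (delta n f) = 0 := by
  rw [← d_eq_delta, ← d_eq_delta]
  exact congr($((inhomogeneousCochains (Rep.trivial ℤ G ℤ)).d_comp_d n (n + 1) (n + 2)) f)

theorem delta_of_isCoboundary {n : ℕ} {f : IntCochain G n} (hf : IsCoboundary n f) :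
    delta n f = 0 := by
  cases n with
  | zero =>
    obtain rfl : f = 0 := hf
    exact map_zero _
  | succ n =>
    obtain ⟨a, rfl⟩ := hf
    exact delta_delta a

/-- The pullback of cocycles. -/
def pullCocycle (n : ℕ) : (delta (G := H) n).ker →+ (delta (G := G) n).ker where
  toFun f := ⟨pull φ n f.1, by
    rw [AddMonoidHom.mem_ker, delta_pull, (show delta n f.1 = 0 from f.2), map_zero]⟩
  map_zero' := rfl
  map_add' _ _ := rfl

end pull

section torus
variable {G : Type} [Group G]

/-- The evaluation of a cochain on the fundamental cycle of a torus. -/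
def torusEval {n : ℕ} (t : Fin n → G) : IntCochain G n →+ ℤ where
  toFun f := ∑ σ : Equiv.Perm (Fin n), (Equiv.Perm.sign σ : ℤ) * f fun i => t (σ i)
  map_zero' := by simp
  map_add' f g := by simp [mul_add, Finset.sum_add_distrib]

theorem torusEval_apply {n : ℕ} (t : Fin n → G) (f : IntCochain G n) : torusEval t f =
    ∑ σ : Equiv.Perm (Fin n), (Equiv.Perm.sign σ : ℤ) * f fun i => t (σ i) := rfl

theorem sum_sign_mul_eq_zero {n : ℕ} (F : Equiv.Perm (Fin n) → ℤ)
    (e : Equiv.Perm (Fin n) ≃ Equiv.Perm (Fin n))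
    (he : ∀ σ, Equiv.Perm.sign (e σ) = -Equiv.Perm.sign σ) (h : ∀ σ, F (e σ) = F σ) :
    ∑ σ : Equiv.Perm (Fin n), (Equiv.Perm.sign σ : ℤ) * F σ = 0 := by
  have := Equiv.sum_comp e fun σ : Equiv.Perm (Fin n) => (Equiv.Perm.sign σ : ℤ) * F σ
  simp only [he, h] at this
  simp only [Units.val_neg, neg_mul, Finset.sum_neg_distrib] at this
  omega

theorem torusEval_eq_zero_of_eq {n : ℕ} (t : Fin n → G) {i j : Fin n} (hij : i ≠ j) (h : t i = t j)
    (f : IntCochain G n) : torusEval t f = 0 := by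
  refine sum_sign_mul_eq_zero _ (Equiv.mulLeft (Equiv.swap i j)) (fun σ => ?_) fun σ => ?_
  · rw [Equiv.coe_mulLeft, map_mul, Equiv.Perm.sign_swap hij, neg_one_mul]
  · congr 1
    ext k
    simp only [Equiv.coe_mulLeft, Equiv.Perm.mul_apply, Equiv.swap_apply_def]
    split_ifs with h1 h2
    · rw [h1, h]
    · rw [h2, h]
    · rfl

/-- The signed sum over permutations is a cycle: the inner faces cancel under adjacent
transpositions because the entries commute, and the two outer faces cancel under rotation. -/
theorem torusEval_delta {n : ℕ} (t : Fin (n + 1) → G) (ht : ∀ i j, Commute (t i) (t j))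
    (f : IntCochain G n) : torusEval t (delta n f) = 0 := by
  have hmid (j : Fin n) : ∑ σ : Equiv.Perm (Fin (n + 1)), (Equiv.Perm.sign σ : ℤ) *
      f (Fin.contractNth j.castSucc (· * ·) fun i => t (σ i)) = 0 := by
    refine sum_sign_mul_eq_zero _ (Equiv.mulRight (Equiv.swap j.castSucc j.succ)) (fun σ => ?_)
      fun σ => ?_
    · rw [Equiv.coe_mulRight, map_mul, Equiv.Perm.sign_swap (Fin.castSucc_lt_succ).ne, mul_neg_one]
    congr 1
    ext i
    simp only [Equiv.coe_mulRight, Equiv.Perm.mul_apply]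
    rcases lt_trichotomy i j with h | rfl | h
    · rw [Fin.contractNth_apply_of_lt _ _ _ _ (by simpa using h),
        Fin.contractNth_apply_of_lt _ _ _ _ (by simpa using h), Equiv.swap_apply_of_ne_of_ne]
      · simpa using h.ne
      · exact fun e => absurd (congrArg Fin.val e) (by simp; omega)
    · rw [Fin.contractNth_apply_of_eq _ _ _ _ (by simp),
        Fin.contractNth_apply_of_eq _ _ _ _ (by simp), Equiv.swap_apply_left,
        Equiv.swap_apply_right]
      exact ht _ _
    · rw [Fin.contractNth_apply_of_gt _ _ _ _ (by simpa using h),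
        Fin.contractNth_apply_of_gt _ _ _ _ (by simpa using h), Equiv.swap_apply_of_ne_of_ne]
      · exact fun e => absurd (congrArg Fin.val e) (by simp; omega)
      · simpa using h.ne'
  -- Rotating the arguments turns the last face into the first and costs the sign of an `(n +
  -- 1)`-cycle.
  have hrot : ∑ σ : Equiv.Perm (Fin (n + 1)), (Equiv.Perm.sign σ : ℤ) *
      f (fun i => t (σ i.castSucc)) = (-1) ^ n * ∑ σ : Equiv.Perm (Fin (n + 1)),
        (Equiv.Perm.sign σ : ℤ) * f (fun i => t (σ i.succ)) := by
    rw [← Equiv.sum_comp (Equiv.mulRight (finRotate (n + 1))), Finset.mul_sum]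
    refine Finset.sum_congr rfl fun σ _ => ?_
    have e (i : Fin n) : finRotate (n + 1) i.castSucc = i.succ := by
      rw [finRotate_apply, Fin.coeSucc_eq_succ]
    simp only [Equiv.coe_mulRight, map_mul, sign_finRotate, Equiv.Perm.mul_apply, e]
    push_cast
    ring
  have hlast (y : Fin (n + 1) → G) : Fin.contractNth (Fin.last n) (· * ·) y =
      fun i => y i.castSucc := by
    ext i
    rw [Fin.contractNth_apply_of_lt _ _ _ _ (by simp)]
  simp only [torusEval_apply, delta_apply, mul_add, Finset.sum_add_distrib, Finset.mul_sum]
  rw [Finset.sum_comm, Fin.sum_univ_castSucc]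
  have hz : ∑ j : Fin n, ∑ σ : Equiv.Perm (Fin (n + 1)), (Equiv.Perm.sign σ : ℤ) *
      ((-1) ^ ((j.castSucc : ℕ) + 1) * f (Fin.contractNth j.castSucc (· * ·) fun i => t (σ i))) =
        0 := by
    refine Finset.sum_eq_zero fun j _ => ?_
    simp only [mul_left_comm _ ((-1 : ℤ) ^ _)]
    rw [← Finset.mul_sum, hmid, mul_zero]
  rw [hz, zero_add]
  simp only [mul_left_comm _ ((-1 : ℤ) ^ _), hlast]
  rw [← Finset.mul_sum, hrot, Fin.val_last, ← mul_assoc, ← pow_add,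
    show n + 1 + n = 2 * n + 1 by ring, pow_succ, pow_mul]
  simp

theorem torusEval_of_isCoboundary {n : ℕ} (t : Fin n → G) (ht : ∀ i j, Commute (t i) (t j))
    {f : IntCochain G n} (hf : IsCoboundary n f) : torusEval t f = 0 := by
  cases n with
  | zero =>
    obtain rfl : f = 0 := hf
    exact map_zero _
  | succ n =>
    obtain ⟨g, rfl⟩ := hf
    exact torusEval_delta t ht g

/-- The evaluation of a cohomology class on a torus. -/
noncomputable def torusEvalClass {n : ℕ} (t : Fin n → G) (ht : ∀ i j, Commute (t i) (t j)) :
    IntCohomology G n →+ ℤ :=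
  descend ((torusEval t).comp (delta n).ker.subtype) fun _ h => torusEval_of_isCoboundary t ht h

theorem torusEvalClass_cls {n : ℕ} (t : Fin n → G) (ht : ∀ i j, Commute (t i) (t j))
    (f : (delta (G := G) n).ker) : torusEvalClass t ht (cls n f) = torusEval t f.1 :=
  descend_cls _ _ f

theorem torusEval_pull {H : Type} [Group H] (φ : G →* H) {n : ℕ} (t : Fin n → G)
    (f : IntCochain H n) : torusEval t (pull φ n f) = torusEval (fun i => φ (t i)) f := rfl

/-- Graded commutativity on tori, for a factor of degree `1`. -/
theorem torusEval_cup_comm {n : ℕ} (t : Fin (n + 1) → G) (a : IntCochain G 1) (f : IntCochain G n)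
    (h : 1 + n = n + 1) : torusEval t (cup h a f) = (-1) ^ n * torusEval t (cup rfl f a) := by
  rw [torusEval_apply, torusEval_apply, Finset.mul_sum,
    ← Equiv.sum_comp (Equiv.mulRight (finRotate (n + 1)))
      fun σ : Equiv.Perm (Fin (n + 1)) => (-1 : ℤ) ^ n * ((Equiv.Perm.sign σ : ℤ) * _)]
  refine Finset.sum_congr rfl fun σ _ => ?_
  have e (i : Fin n) : finRotate (n + 1) i.castSucc = i.succ := by
    rw [finRotate_apply, Fin.coeSucc_eq_succ]
  have h1 : cup rfl f a (fun i => t (σ (finRotate (n + 1) i))) =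
      f (fun i => t (σ i.succ)) * a (fun _ => t (σ 0)) := by
    refine congrArg₂ (· * ·) (congrArg f (funext fun i => congrArg (fun j => t (σ j)) (e i)))
      (congrArg a (funext fun i => congrArg (fun j => t (σ j)) ?_))
    rw [← finRotate_last]
    congr 1
    ext
    simp
  have h2 : cup h a f (fun i => t (σ i)) = a (fun _ => t (σ 0)) * f (fun i => t (σ i.succ)) := by
    refine congrArg₂ (· * ·) (congrArg a (funext fun i => congrArg (fun j => t (σ j)) ?_))
      (congrArg f (funext fun i => congrArg (fun j => t (σ j)) ?_))
    · ext
      simp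
    · ext
      simp [add_comm]
  simp only [Equiv.coe_mulRight, Equiv.Perm.mul_apply, map_mul, sign_finRotate]
  rw [h1, h2]
  push_cast
  have : (-1 : ℤ) ^ n * (-1) ^ n = 1 := by rw [← mul_pow]; simp
  linear_combination (-(Equiv.Perm.sign σ : ℤ) * (a fun _ => t (σ 0)) * f fun i => t (σ i.succ)) * this

/-- A homomorphism to the integers, as a cocycle. -/
def homCocycle (φ : G →* Multiplicative ℤ) : (delta (G := G) 1).ker :=
  ⟨fun y => (φ (y 0)).toAdd, by
    rw [AddMonoidHom.mem_ker]
    ext y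
    simp [Fin.contractNth]⟩

end torus

/-! ### Cocycles as sums of products of crossed homomorphisms -/

/-- This is the cocycle identity for a product of differences along a sequence of vertices. The
first two terms combine to the first difference times the leading term of the identity one degree
lower. -/
theorem alternating_prod_eq_zero {n : ℕ} (a : Fin n → Fin (n + 2) → ℤ) :
    ∑ k : Fin (n + 2), (-1 : ℤ) ^ (k : ℕ) *
      ∏ i, (a i (k.succAbove i.succ) - a i (k.succAbove i.castSucc)) = 0 := by
  induction n with
  | zero => simp
  | succ n ih =>
    have h := ih fun i j => a i.succ j.succ
    set Q : Fin (n + 2) → ℤ := fun k => ∏ i : Fin n,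
      (a i.succ (k.succAbove i.succ).succ - a i.succ (k.succAbove i.castSucc).succ) with hQ
    have h0 : ∏ i, (a i ((0 : Fin (n + 3)).succAbove i.succ) -
        a i ((0 : Fin (n + 3)).succAbove i.castSucc)) =
          (a 0 (Fin.succ 0).succ - a 0 (Fin.succ 0)) * Q 0 := by
      rw [Fin.prod_univ_succ]
      simp [hQ]
    have h1 : ∏ i, (a i ((Fin.succ (0 : Fin (n + 2))).succAbove i.succ) -
        a i ((Fin.succ (0 : Fin (n + 2))).succAbove i.castSucc)) =
          (a 0 (Fin.succ 0).succ - a 0 0) * Q 0 := by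
      rw [Fin.prod_univ_succ]
      simp [hQ, ← Fin.succ_castSucc, -Fin.castSucc_succ, -Fin.succ_zero_eq_one]
    have h2 (k : Fin (n + 1)) : ∏ i, (a i (k.succ.succ.succAbove i.succ) -
        a i (k.succ.succ.succAbove i.castSucc)) = (a 0 (Fin.succ 0) - a 0 0) * Q k.succ := by
      rw [Fin.prod_univ_succ]
      simp [hQ, ← Fin.succ_castSucc, -Fin.castSucc_succ, -Fin.succ_zero_eq_one]
    rw [Fin.sum_univ_succ] at h
    rw [Fin.sum_univ_succ, Fin.sum_univ_succ, h0, h1]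
    simp only [h2]
    have e : ∑ i : Fin (n + 1), (-1 : ℤ) ^ (i.succ.succ : ℕ) * ((a 0 (Fin.succ 0) - a 0 0) * Q i.succ) =
        -(a 0 (Fin.succ 0) - a 0 0) * ∑ i : Fin (n + 1), (-1) ^ (i.succ : ℕ) * Q i.succ := by
      rw [Finset.mul_sum]
      refine Finset.sum_congr rfl fun i _ => ?_
      rw [Fin.val_succ i.succ, pow_succ]
      ring
    rw [e]
    simp only [Fin.val_zero, Fin.val_succ (0 : Fin (n + 2)), pow_zero, one_mul, zero_add, pow_one] at h ⊢
    linear_combination -(a 0 (Fin.succ 0) - a 0 0) * h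

section sumCocycle
variable {G X : Type} [Group G] [MulAction G X]

/-- The cochain given by a sum, over a set with an action, of products of crossed homomorphisms. -/
noncomputable def sumCochain {n : ℕ} (c : Fin n → G → X → ℤ) : IntCochain G n := fun y =>
  ∑ᶠ d : X, ∏ j, c j (y j) ((Fin.partialProd y j.castSucc)⁻¹ • d)

/-- At each point a crossed homomorphism is a difference of values at consecutive partial products,
so the coboundary vanishes pointwise before summing. -/
theorem delta_sumCochain {n : ℕ} (c : Fin n → G → X → ℤ)
    (hc : ∀ j g h d, c j (g * h) d = c j g d + c j h (g⁻¹ • d))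
    (hfin : ∀ y : Fin n → G, (Function.support fun d : X =>
      ∏ j, c j (y j) ((Fin.partialProd y j.castSucc)⁻¹ • d)).Finite) :
    delta n (sumCochain c) = 0 := by
  have hdiff (j : Fin n) (g h : G) (d : X) : c j h (g⁻¹ • d) = c j (g * h) d - c j g d := by
    rw [hc]; ring
  refine funext fun y => ?_
  let v := Fin.partialProd y
  let P (k : Fin (n + 2)) (d : X) : ℤ :=
    ∏ i, (c i (v (k.succAbove i.succ)) d - c i (v (k.succAbove i.castSucc)) d)
  have hP (j : Fin (n + 1)) (d : X) : ∏ i, c i (Fin.contractNth j (· * ·) y i)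
      ((Fin.partialProd (Fin.contractNth j (· * ·) y) i.castSucc)⁻¹ • d) = P j.succ d := by
    refine Finset.prod_congr rfl fun i _ => ?_
    rw [hdiff, ← Fin.partialProd_succ, Fin.partialProd_contractNth]
    rfl
  have h0 (d : X) : ∏ i, c i (y (Fin.succ i))
      ((Fin.partialProd (fun i : Fin n => y i.succ) i.castSucc)⁻¹ • d) = P 0 (y 0 • d) := by
    refine Finset.prod_congr rfl fun i _ => ?_
    have e : (Fin.partialProd (fun i : Fin n => y i.succ) i.castSucc)⁻¹ • d =
        (v i.succ.castSucc)⁻¹ • (y 0 • d) := by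
      rw [← mul_smul]
      congr 1
      have : v i.succ.castSucc =
          y 0 * Fin.partialProd (fun i : Fin n => y i.succ) i.castSucc := by
        rw [← Fin.succ_castSucc]
        exact Fin.partialProd_succ' y i.castSucc
      rw [this]
      group
    rw [e, hdiff, ← Fin.partialProd_succ]
    rfl
  -- Dropping the first argument changes the base vertex; this is undone by translating the index
  -- set by `y 0`.
  have e0 : sumCochain c (fun i => y i.succ) = ∑ᶠ d, P 0 d := by
    unfold sumCochain
    simp only [h0]
    exact finsum_comp_equiv (MulAction.toPerm (y 0))
  have eS (j : Fin (n + 1)) : sumCochain c (Fin.contractNth j (· * ·) y) = ∑ᶠ d, P j.succ d := by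
    unfold sumCochain
    simp only [hP]
  have hf : ∀ k, (Function.support (P k)).Finite := by
    refine Fin.cases ?_ fun j => ?_
    · have := hfin fun i => y i.succ
      simp only [h0] at this
      refine (this.image (y 0 • ·)).subset fun d hd => ⟨(y 0)⁻¹ • d, ?_, ?_⟩
      · simpa using hd
      · simp
    · have := hfin (Fin.contractNth j (· * ·) y)
      simpa only [hP] using this
  have key : ∑ᶠ d, ∑ k : Fin (n + 2), (-1) ^ (k : ℕ) * P k d = 0 := by
    have (d : X) : ∑ k : Fin (n + 2), (-1) ^ (k : ℕ) * P k d = 0 :=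
      alternating_prod_eq_zero fun i k => c i (v k) d
    simp only [this, finsum_zero]
  rw [finsum_sum_comm _ _ fun k _ => (hf k).subset fun d hd h => hd (by simp [h]),
    Fin.sum_univ_succ] at key
  rw [delta_apply, e0]
  simp only [eS, mul_finsum]
  simpa using key

end sumCocycle

end groupCohomology

/-! ### The Godbillon-Vey cocycles and the bumps -/

namespace ThompsonF

open groupCohomology

/-- Increasing tuples of rational numbers. -/
def IncTuple (k : ℕ) : Type := {d : Fin k → ℚ // StrictMono d}

instance (k : ℕ) : MulAction ThompsonF (IncTuple k) where
  smul g d := ⟨fun i => act g (d.1 i), (act_strictMono g).comp d.2⟩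
  one_smul d := Subtype.ext (funext fun i => by
    change act 1 (d.1 i) = _
    rw [map_one, Equiv.Perm.one_apply])
  mul_smul g h d := Subtype.ext (funext fun i => by
    change act (g * h) (d.1 i) = act g (act h (d.1 i))
    rw [map_mul, Equiv.Perm.mul_apply])

theorem smul_val {k : ℕ} (g : ThompsonF) (d : IncTuple k) (i : Fin k) :
    (g • d).1 i = act g (d.1 i) := rfl

/-- The factors of the `k`-th divided power of the discrete Godbillon-Vey cocycle. -/
def gvFactor (k : ℕ) (j : Fin (2 * k)) (g : ThompsonF) (d : IncTuple k) : ℤ :=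
  if (j : ℕ) % 2 = 0 then lslope g (d.1 ⟨j / 2, by omega⟩) else jump g (d.1 ⟨j / 2, by omega⟩)

theorem gvFactor_mul (k : ℕ) (j : Fin (2 * k)) (g h : ThompsonF) (d : IncTuple k) :
    gvFactor k j (g * h) d = gvFactor k j g d + gvFactor k j h (g⁻¹ • d) := by
  simp only [gvFactor, smul_val, lslope_mul, jump_mul, map_inv]
  split_ifs <;> rfl

/-- The two factors belonging to the `i`-th entry of the tuple. -/
theorem gvFactor_partialProd {k : ℕ} (y : Fin (2 * k) → ThompsonF) (d : IncTuple k) (i : Fin k) :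
    gvFactor k ⟨2 * i, by omega⟩ (y ⟨2 * i, by omega⟩)
        ((Fin.partialProd y (Fin.castSucc ⟨2 * i, by omega⟩))⁻¹ • d) =
      lslope (y ⟨2 * i, by omega⟩)
        ((act (Fin.partialProd y (Fin.castSucc ⟨2 * i, by omega⟩)))⁻¹ (d.1 i)) ∧
    gvFactor k ⟨2 * i + 1, by omega⟩ (y ⟨2 * i + 1, by omega⟩)
        ((Fin.partialProd y (Fin.castSucc ⟨2 * i + 1, by omega⟩))⁻¹ • d) =
      jump (y ⟨2 * i + 1, by omega⟩) ((act (y ⟨2 * i, by omega⟩))⁻¹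
        ((act (Fin.partialProd y (Fin.castSucc ⟨2 * i, by omega⟩)))⁻¹ (d.1 i))) := by
  have h1 (h : 2 * (i : ℕ) / 2 < k) : (⟨2 * (i : ℕ) / 2, h⟩ : Fin k) = i :=
    Fin.ext (show 2 * (i : ℕ) / 2 = i by omega)
  have h2 (h : (2 * (i : ℕ) + 1) / 2 < k) : (⟨(2 * (i : ℕ) + 1) / 2, h⟩ : Fin k) = i :=
    Fin.ext (show (2 * (i : ℕ) + 1) / 2 = i by omega)
  constructor
  · rw [gvFactor, if_pos (by simp), smul_val, map_inv]
    simp only [h1]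
  · rw [gvFactor, if_neg (by simp), smul_val, map_inv]
    simp only [h2]
    have : Fin.partialProd y (Fin.castSucc ⟨2 * i + 1, by omega⟩) =
        Fin.partialProd y (Fin.castSucc ⟨2 * i, by omega⟩) * y ⟨2 * i, by omega⟩ :=
      Fin.partialProd_succ y ⟨2 * i, by omega⟩
    rw [this, map_mul, mul_inv_rev, Equiv.Perm.mul_apply]

/-- The jump factors alone confine each entry of the tuple to a finite set. -/
theorem finite_support_gv {k : ℕ} (y : Fin (2 * k) → ThompsonF) : (Function.support
    fun d : IncTuple k => ∏ j, gvFactor k j (y j) ((Fin.partialProd y j.castSucc)⁻¹ • d)).Finite := by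
  let S (i : Fin k) : Set ℚ := {q | jump (y ⟨2 * i + 1, by omega⟩) ((act (y ⟨2 * i, by omega⟩))⁻¹
    ((act (Fin.partialProd y (Fin.castSucc ⟨2 * i, by omega⟩)))⁻¹ q)) ≠ 0}
  have hS (i : Fin k) : (S i).Finite :=
    ((finite_support_jump (y ⟨2 * i + 1, by omega⟩)).preimage
      (Equiv.injective (act (y ⟨2 * i, by omega⟩))⁻¹).injOn).preimage
        (Equiv.injective (act (Fin.partialProd y (Fin.castSucc ⟨2 * i, by omega⟩)))⁻¹).injOn
  refine ((Set.Finite.pi' hS).preimage Subtype.val_injective.injOn).subset fun d hd i => ?_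
  have := Finset.prod_ne_zero_iff.1 hd ⟨2 * i + 1, by omega⟩ (Finset.mem_univ _)
  rw [(gvFactor_partialProd y d i).2] at this
  exact this

/-- The `k`-th divided power of the discrete Godbillon-Vey cocycle. -/
noncomputable def gvCocycle (k : ℕ) : (delta (G := ThompsonF) (2 * k)).ker :=
  ⟨sumCochain (gvFactor k), delta_sumCochain _ (gvFactor_mul k) finite_support_gv⟩

theorem gvCocycle_apply (k : ℕ) (y : Fin (2 * k) → ThompsonF) : (gvCocycle k).1 y =
    ∑ᶠ d : IncTuple k, ∏ j, gvFactor k j (y j) ((Fin.partialProd y j.castSucc)⁻¹ • d) := rfl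

/-- A bump with support `[i, i + 2]`. -/
def bmp (i : ℕ) : ThompsonF := x i * (x (i + 1))⁻¹

theorem act_bmp_inv (i : ℕ) (d : ℚ) : (act (bmp i))⁻¹ d = gen (i + 1) ((gen i)⁻¹ d) := by
  simp [bmp]

theorem act_bmp_inv_eq (i : ℕ) (d : ℚ) (h : d ≤ i ∨ i + 2 ≤ d) : (act (bmp i))⁻¹ d = d := by
  rw [act_bmp_inv, gen_inv_apply, gen_apply]
  push_cast
  grind

theorem act_bmp_inv_mem (i : ℕ) (d : ℚ) (h : i < d ∧ d ≤ i + 2) :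
    i < (act (bmp i))⁻¹ d ∧ (act (bmp i))⁻¹ d ≤ i + 2 := by
  rw [act_bmp_inv, gen_inv_apply, gen_apply]
  push_cast
  grind

theorem lslope_bmp (i : ℕ) (d : ℚ) : lslope (bmp i) d =
    lslope (x i) d - lslope (x (i + 1)) (gen (i + 1) ((gen i)⁻¹ d)) := by
  rw [bmp, lslope_mul, lslope_inv, act_x, act_x]
  ring

theorem rslope_bmp (i : ℕ) (d : ℚ) : rslope (bmp i) d =
    rslope (x i) d - rslope (x (i + 1)) (gen (i + 1) ((gen i)⁻¹ d)) := by
  have := rslope_mul (x (i + 1)) (x (i + 1))⁻¹ (gen (i + 1) ((gen i)⁻¹ d))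
  rw [mul_inv_cancel, rslope_one, act_x,
    show (gen (i + 1))⁻¹ (gen (i + 1) _) = _ from (gen (i + 1)).symm_apply_apply _] at this
  rw [bmp, rslope_mul, act_x]
  linarith

/-- The left end is excluded here but allowed in `jump_bmp_ne`. This asymmetry fixes the order in
which two touching bumps give a contribution. -/
theorem lslope_bmp_ne (i : ℕ) (d : ℚ) (h : lslope (bmp i) d ≠ 0) : i < d ∧ d ≤ i + 2 := by
  by_contra h'
  apply h
  rw [lslope_bmp, lslope_x, lslope_x, gen_inv_apply, gen_apply]
  push_cast
  grind

theorem jump_bmp_ne (i : ℕ) (d : ℚ) (h : jump (bmp i) d ≠ 0) : i ≤ d ∧ d ≤ i + 2 := by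
  by_contra h'
  apply h
  rw [jump, lslope_bmp, rslope_bmp, lslope_x, lslope_x, rslope_x, rslope_x, gen_inv_apply, gen_apply]
  push_cast
  grind

/-- When a second bump starts where the first one ends, this value and that of `jump_bmp_left` meet
at the common point and multiply to -1. -/
theorem lslope_bmp_right (i : ℕ) : lslope (bmp i) (i + 2) = 1 := by
  rw [lslope_bmp, lslope_x, lslope_x, gen_inv_apply, gen_apply]
  push_cast
  grind

theorem jump_bmp_left (i : ℕ) : jump (bmp i) i = -1 := by
  rw [jump, lslope_bmp, rslope_bmp, lslope_x, lslope_x, rslope_x, rslope_x, gen_inv_apply, gen_apply]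
  push_cast
  grind

theorem commute_x_bmp {i n : ℕ} (h : i + 2 ≤ n) : Commute (x n) (bmp i) := by
  have h1 := x_mul_x (show i < n by omega)
  have h2 := x_mul_x (show i + 1 < n by omega)
  rw [Commute, SemiconjBy, bmp, ← mul_assoc, h1, mul_assoc, mul_assoc, mul_right_inj,
    ← mul_inv_eq_iff_eq_mul.symm, mul_assoc, h2, inv_mul_cancel_left]

theorem commute_bmp {i j : ℕ} (h : i + 2 ≤ j) : Commute (bmp j) (bmp i) :=
  (commute_x_bmp h).mul_left (commute_x_bmp (by omega)).inv_left

theorem deg_bmp (i : ℕ) : deg (bmp i) = 1 := by simp [bmp]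

theorem deg₀_bmp_succ (i : ℕ) : deg₀ (bmp (i + 1)) = 1 := by simp [bmp]

theorem deg₀_bmp_zero : deg₀ (bmp 0) = Multiplicative.ofAdd 1 := by simp [bmp]

theorem shift_bmp (i : ℕ) : shift (bmp i) = bmp (i + 1) := by simp [bmp]

end ThompsonF

/-! ### The commuting letters and the Godbillon-Vey values on them -/

namespace ThompsonF

open groupCohomology

/-- The left end of the support of a letter. -/
def letterPos (c K : ℕ) : ℕ → ℕ
  | 0 => 0
  | 1 => 5 * K + 3 + c
  | j + 2 => 5 * (j / 2) + 2 * (j % 2) + 3 + c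

/-- Pairwise commuting elements: one of germ `1` at `0`, one of degree `1`, and `K` pairs of bumps
with adjacent supports. -/
def letter (c K : ℕ) : ℕ → ThompsonF
  | 0 => bmp 0
  | 1 => x (5 * K + 3 + c)
  | j + 2 => if j < 2 * K then bmp (5 * (j / 2) + 2 * (j % 2) + 3 + c) else 1

theorem letter_cases (c K j : ℕ) : letter c K j = 1 ∨
    j < 2 * K + 2 ∧ j ≠ 1 ∧ letter c K j = bmp (letterPos c K j) ∨
    j = 1 ∧ letter c K j = x (letterPos c K j) := by
  match j with
  | 0 => simp [letter, letterPos]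
  | 1 => simp [letter, letterPos]
  | j + 2 =>
    simp only [letter, letterPos]
    split_ifs with h
    · exact Or.inr (Or.inl ⟨by omega, by omega, rfl⟩)
    · exact Or.inl rfl

/-- The bumps have width 2 and each pair occupies a period of 5, so supports are disjoint up to the
common point of a pair and pairs are separated by a gap. -/
theorem letterPos_add_two_le {c K i j : ℕ} (hi : i < 2 * K + 2) (hj : j < 2 * K + 2) (hij : i ≠ j)
    (h : letterPos c K i ≤ letterPos c K j) (hc : i ≠ 1) : letterPos c K i + 2 ≤ letterPos c K j := by
  match i, j with
  | 0, 0 => omega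
  | 0, 1 => simp only [letterPos] at *; omega
  | 0, j + 2 => simp only [letterPos] at *; omega
  | i + 2, 0 => simp only [letterPos] at *; omega
  | i + 2, 1 => simp only [letterPos] at *; omega
  | i + 2, j + 2 => simp only [letterPos] at *; omega

theorem letterPos_lt {c K j : ℕ} (hj : j < 2 * K + 2) (hc : j ≠ 1) :
    letterPos c K j + 2 ≤ letterPos c K 1 := by
  match j with
  | 0 => simp only [letterPos]; omega
  | j + 2 => simp only [letterPos]; omega

theorem commute_letter (c K i j : ℕ) : Commute (letter c K i) (letter c K j) := by
  by_cases hij : i = j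
  · rw [hij]
  rcases letter_cases c K i with h | ⟨hi, hi1, h⟩ | ⟨rfl, h⟩
  · rw [h]; exact Commute.one_left _
  · rcases letter_cases c K j with h' | ⟨hj, hj1, h'⟩ | ⟨rfl, h'⟩
    · rw [h']; exact Commute.one_right _
    · rw [h, h']
      rcases le_total (letterPos c K i) (letterPos c K j) with hl | hl
      · exact (commute_bmp (letterPos_add_two_le hi hj hij hl hi1)).symm
      · exact commute_bmp (letterPos_add_two_le hj hi (Ne.symm hij) hl hj1)
    · rw [h, h']
      exact (commute_x_bmp (letterPos_lt hi hi1)).symm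
  · rcases letter_cases c K j with h' | ⟨hj, hj1, h'⟩ | ⟨rfl, h'⟩
    · rw [h']; exact Commute.one_right _
    · rw [h, h']
      exact commute_x_bmp (letterPos_lt hj hj1)
    · exact absurd rfl hij

theorem lslope_letter_ne {c K j : ℕ} {d : ℚ} (h : lslope (letter c K j) d ≠ 0) :
    j < 2 * K + 2 ∧ letterPos c K j < (act (letter c K j))⁻¹ d ∧
      (act (letter c K j))⁻¹ d ≤ letterPos c K j + 2 := by
  rcases letter_cases c K j with e | ⟨hi, hi1, e⟩ | ⟨rfl, e⟩
  · rw [e, lslope_one] at h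
    exact absurd rfl h
  · rw [e] at h ⊢
    exact ⟨hi, act_bmp_inv_mem _ _ (lslope_bmp_ne _ _ h)⟩
  · rw [e] at h ⊢
    refine ⟨by omega, ?_⟩
    rw [lslope_x] at h
    rw [act_x, gen_inv_apply]
    grind

theorem jump_letter_ne {c K j : ℕ} {d : ℚ} (h : jump (letter c K j) d ≠ 0) :
    j < 2 * K + 2 ∧ letterPos c K j ≤ d ∧ d ≤ letterPos c K j + 2 := by
  rcases letter_cases c K j with e | ⟨hi, hi1, e⟩ | ⟨rfl, e⟩
  · rw [e, jump_one] at h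
    exact absurd rfl h
  · rw [e] at h
    exact ⟨hi, jump_bmp_ne _ _ h⟩
  · rw [e, jump, lslope_x, rslope_x] at h
    refine ⟨by omega, ?_⟩
    grind

/-- The contact point of a pair is fixed by every letter, so the partial products in the cocycle do
not displace it. -/
theorem act_letter_inv_eq (c K j : ℕ) {m : ℕ} (hm : m < K) :
    (act (letter c K j))⁻¹ (5 * m + 5 + c : ℕ) = (5 * m + 5 + c : ℕ) := by
  rcases letter_cases c K j with e | ⟨hi, hi1, e⟩ | ⟨rfl, e⟩
  · rw [e, map_one, inv_one, Equiv.Perm.one_apply]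
  · rw [e]
    apply act_bmp_inv_eq
    have : 5 * m + 5 + c ≤ letterPos c K j ∨ letterPos c K j + 2 ≤ 5 * m + 5 + c := by
      match j with
      | 0 => simp only [letterPos]; omega
      | j + 2 => simp only [letterPos]; omega
    exact_mod_cast this
  · rw [e, act_x, gen_inv_apply, if_pos]
    have : 5 * m + 5 + c ≤ letterPos c K 1 := by simp only [letterPos]; omega
    exact_mod_cast this

/-- Two letters interact only if their supports touch, with the left-slope letter on the left. That
leaves the two members of one pair, in order, at their contact point. -/
theorem exists_of_lslope_jump_ne {c K i j : ℕ} (hij : i ≠ j) {d : ℚ}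
    (h1 : lslope (letter c K i) d ≠ 0) (h2 : jump (letter c K j) ((act (letter c K i))⁻¹ d) ≠ 0) :
    ∃ m < K, i = 2 * m + 2 ∧ j = 2 * m + 3 ∧ d = (5 * m + 5 + c : ℕ) := by
  obtain ⟨hi, l1, u1⟩ := lslope_letter_ne h1
  obtain ⟨hj, l2, u2⟩ := jump_letter_ne h2
  -- Strict, because the left slope vanishes at the left end of the support; this rules out the
  -- reversed pair.
  have a1 : letterPos c K i < letterPos c K j + 2 := by exact_mod_cast l1.trans_le u2
  have a2 : letterPos c K j ≤ letterPos c K i + 2 := by exact_mod_cast l2.trans u1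
  obtain ⟨m, hm, e1, e2⟩ : ∃ m < K, i = 2 * m + 2 ∧ j = 2 * m + 3 := by
    match i, j with
    | 0, 0 => omega
    | 0, 1 => simp only [letterPos] at *; omega
    | 0, j + 2 => simp only [letterPos] at *; omega
    | 1, 0 => simp only [letterPos] at *; omega
    | 1, 1 => omega
    | 1, j + 2 => simp only [letterPos] at *; omega
    | i + 2, 0 => simp only [letterPos] at *; omega
    | i + 2, 1 => simp only [letterPos] at *; omega
    | i + 2, j + 2 =>
      simp only [letterPos] at *
      exact ⟨i / 2, by omega, by omega, by omega⟩
  refine ⟨m, hm, e1, e2, ?_⟩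
  have p1 : letterPos c K i + 2 = 5 * m + 5 + c := by
    rw [e1]; simp only [letterPos]; omega
  have p2 : letterPos c K j = 5 * m + 5 + c := by
    rw [e2]; simp only [letterPos]; omega
  apply (act (letter c K i))⁻¹.injective
  rw [act_letter_inv_eq c K i hm]
  rw [p2] at l2
  have u3 : (act (letter c K i))⁻¹ d ≤ (5 * m + 5 + c : ℕ) := by
    rw [← p1]; exact_mod_cast u1
  exact le_antisymm u3 l2

theorem act_partialProd_letter_inv_eq (c K : ℕ) {m n : ℕ} (hm : m < K) (r : Fin n → ℕ)
    (i : Fin (n + 1)) : (act (Fin.partialProd (fun j => letter c K (r j)) i))⁻¹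
      (5 * m + 5 + c : ℕ) = (5 * m + 5 + c : ℕ) := by
  induction i using Fin.induction with
  | zero => rw [Fin.partialProd_zero, map_one, inv_one, Equiv.Perm.one_apply]
  | succ i ih =>
    rw [Fin.partialProd_succ, map_mul, mul_inv_rev, Equiv.Perm.mul_apply, ih,
      act_letter_inv_eq c K _ hm]

theorem prod_range_two_mul_sign (k : ℕ) :
    ∏ j ∈ Finset.range (2 * k), (if j % 2 = 0 then (1 : ℤ) else -1) = (-1) ^ k := by
  induction k with
  | zero => simp
  | succ k ih =>
    rw [show 2 * (k + 1) = 2 * k + 1 + 1 by ring, Finset.prod_range_succ, Finset.prod_range_succ, ih,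
      if_pos (by omega), if_neg (by omega), mul_one, pow_succ]

theorem exists_of_prod_gvFactor_ne {c K k : ℕ} {r : Fin (2 * k) → ℕ} (hr : Function.Injective r)
    {d : IncTuple k} (h : ∏ j, gvFactor k j (letter c K (r j))
      ((Fin.partialProd (fun j => letter c K (r j)) j.castSucc)⁻¹ • d) ≠ 0) (i : Fin k) :
    ∃ m < K, r ⟨2 * i, by omega⟩ = 2 * m + 2 ∧ r ⟨2 * i + 1, by omega⟩ = 2 * m + 3 ∧
      d.1 i = (5 * m + 5 + c : ℕ) := by
  have h1 := Finset.prod_ne_zero_iff.1 h ⟨2 * i, by omega⟩ (Finset.mem_univ _)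
  have h2 := Finset.prod_ne_zero_iff.1 h ⟨2 * i + 1, by omega⟩ (Finset.mem_univ _)
  have e := gvFactor_partialProd (fun j => letter c K (r j)) d i
  rw [e.1] at h1
  rw [e.2] at h2
  obtain ⟨m, hm, e1, e2, e3⟩ := exists_of_lslope_jump_ne
    (fun e => absurd (congrArg Fin.val (hr e)) (by simp)) h1 h2
  refine ⟨m, hm, e1, e2, ?_⟩
  rw [← act_partialProd_letter_inv_eq c K hm r] at e3
  exact Equiv.injective _ e3

/-- The `m`-th pairs of letters occur in increasing order. -/
def IsPairing (K : ℕ) {k : ℕ} (r : Fin (2 * k) → ℕ) (m : Fin k → ℕ) : Prop :=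
  StrictMono m ∧ ∀ i, m i < K ∧ r ⟨2 * i, by omega⟩ = 2 * m i + 2 ∧ r ⟨2 * i + 1, by omega⟩ = 2 * m i + 3

/-- A nonzero summand puts the entries of the tuple at contact points, and increasing entries force
the pairs to occur in increasing order. -/
theorem exists_isPairing {c K k : ℕ} {r : Fin (2 * k) → ℕ} (hr : Function.Injective r)
    (h : (gvCocycle k).1 (fun j => letter c K (r j)) ≠ 0) : ∃ m, IsPairing K r m := by
  rw [gvCocycle_apply] at h
  obtain ⟨d, hd⟩ : ∃ d : IncTuple k, ∏ j, gvFactor k j (letter c K (r j))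
      ((Fin.partialProd (fun j => letter c K (r j)) j.castSucc)⁻¹ • d) ≠ 0 := by
    by_contra! h'
    exact h (finsum_eq_zero_of_forall_eq_zero h')
  choose m h0 h1 h2 h3 using exists_of_prod_gvFactor_ne hr hd
  refine ⟨m, fun i j hij => ?_, fun i => ⟨h0 i, h1 i, h2 i⟩⟩
  have := d.2 hij
  rw [h3, h3, Nat.cast_lt] at this
  omega

/-- Exactly one tuple contributes, that of the contact points, and each pair gives the factor -1. -/
theorem gvCocycle_letter {c K k : ℕ} {r : Fin (2 * k) → ℕ} (hr : Function.Injective r)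
    {m : Fin k → ℕ} (h : IsPairing K r m) :
    (gvCocycle k).1 (fun j => letter c K (r j)) = (-1) ^ k := by
  let d : IncTuple k := ⟨fun i => (5 * m i + 5 + c : ℕ), fun i j hij => by
    have := h.1 hij
    exact Nat.cast_lt.2 (by omega)⟩
  rw [gvCocycle_apply, finsum_eq_single _ d]
  · rw [← prod_range_two_mul_sign, ← Fin.prod_univ_eq_prod_range]
    refine Finset.prod_congr rfl fun j _ => ?_
    have hm := (h.2 ⟨j / 2, by omega⟩).1
    rw [gvFactor]
    split_ifs with hj
    · have e : r j = 2 * m ⟨j / 2, by omega⟩ + 2 := by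
        rw [← (h.2 ⟨j / 2, by omega⟩).2.1]
        congr 1
        ext
        simp only
        omega
      rw [smul_val, map_inv, act_partialProd_letter_inv_eq c K hm r, e]
      have : letter c K (2 * m ⟨j / 2, by omega⟩ + 2) = bmp (5 * m ⟨j / 2, by omega⟩ + 3 + c) := by
        simp only [letter]
        rw [if_pos (by omega)]
        congr 1
        omega
      rw [this, show ((5 * m ⟨j / 2, by omega⟩ + 5 + c : ℕ) : ℚ) =
        (5 * m ⟨j / 2, by omega⟩ + 3 + c : ℕ) + 2 by push_cast; ring, lslope_bmp_right]
    · have e : r j = 2 * m ⟨j / 2, by omega⟩ + 3 := by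
        rw [← (h.2 ⟨j / 2, by omega⟩).2.2]
        congr 1
        ext
        simp only
        omega
      rw [smul_val, map_inv, act_partialProd_letter_inv_eq c K hm r, e]
      have : letter c K (2 * m ⟨j / 2, by omega⟩ + 3) = bmp (5 * m ⟨j / 2, by omega⟩ + 5 + c) := by
        simp only [letter]
        rw [if_pos (by omega)]
        congr 1
        omega
      rw [this, jump_bmp_left]
  · intro d' hd'
    by_contra hne
    refine hd' (Subtype.ext (funext fun i => ?_))
    obtain ⟨m', -, e1, -, e3⟩ := exists_of_prod_gvFactor_ne hr hne i
    rw [(h.2 i).2.1] at e1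
    rw [e3]
    congr 1
    omega

end ThompsonF

/-! ### Duality between the mixed cocycles and the tori -/

namespace ThompsonF

open groupCohomology

theorem deg_letter (c K j : ℕ) : (deg (letter c K j)).toAdd = if j = 1 then 1 else 0 := by
  match j with
  | 0 => simp [letter, deg_bmp]
  | 1 => simp [letter]
  | j + 2 =>
    simp only [letter]
    split_ifs <;> simp_all [deg_bmp]

theorem deg₀_letter (c K j : ℕ) : (deg₀ (letter c K j)).toAdd = if j = 0 then 1 else 0 := by
  match j with
  | 0 => simp [letter, deg₀_bmp_zero]
  | 1 => simp [letter]
  | j + 2 =>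
    rw [if_neg (by omega), letter]
    by_cases h : j < 2 * K
    · rw [if_pos h, show 5 * (j / 2) + 2 * (j % 2) + 3 + c =
        (5 * (j / 2) + 2 * (j % 2) + 2 + c) + 1 by ring, deg₀_bmp_succ, toAdd_one]
    · rw [if_neg h, map_one, toAdd_one]

/-- The cocycle of `φ`, or the unit. -/
def optCocycle {G : Type} [Group G] (φ : G →* Multiplicative ℤ) : (e : Bool) → (delta (G := G) e.toNat).ker
  | false => oneCocycle G
  | true => homCocycle φ

/-- The product of (some of) `deg₀`, the `k`-th divided power and `deg`. -/
noncomputable def mixedCocycle (e₀ : Bool) (k : ℕ) (e₁ : Bool) {n : ℕ}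
    (h : e₀.toNat + 2 * k + e₁.toNat = n) : (delta (G := ThompsonF) n).ker :=
  cupCocycle h (cupCocycle rfl (optCocycle deg₀ e₀) (gvCocycle k)) (optCocycle deg e₁)

/-- The numbers of the letters in the torus dual to `mixedCocycle`. -/
def dualIndex (e₀ : Bool) (k : ℕ) (n : ℕ) (j : Fin n) : ℕ :=
  if (j : ℕ) < e₀.toNat then 0 else if (j : ℕ) < e₀.toNat + 2 * k then j - e₀.toNat + 2 else 1

theorem dualIndex_injective (e₀ : Bool) (k : ℕ) (e₁ : Bool) {n : ℕ}
    (h : e₀.toNat + 2 * k + e₁.toNat = n) : Function.Injective (dualIndex e₀ k n) := by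
  intro i j hij
  simp only [dualIndex] at hij
  ext
  have := i.2
  have := j.2
  have := e₀.toNat_le
  have := e₁.toNat_le
  split_ifs at hij <;> omega

theorem mixedCocycle_apply (e₀ : Bool) (k : ℕ) (e₁ : Bool) {n : ℕ}
    (h : e₀.toNat + 2 * k + e₁.toNat = n) (y : Fin n → ThompsonF) :
    (mixedCocycle e₀ k e₁ h).1 y = (optCocycle deg₀ e₀).1 (fun i => y ⟨i, by omega⟩) *
      (gvCocycle k).1 (fun j => y ⟨e₀.toNat + j, by omega⟩) *
        (optCocycle deg e₁).1 (fun i => y ⟨e₀.toNat + 2 * k + i, by omega⟩) := rfl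

theorem optCocycle_letter (φ : ThompsonF →* Multiplicative ℤ) (a c K : ℕ)
    (hφ : ∀ j, (φ (letter c K j)).toAdd = if j = a then 1 else 0) (e : Bool) (r : Fin e.toNat → ℕ) :
    ((∀ i, r i = a) → (optCocycle φ e).1 (fun i => letter c K (r i)) = 1) ∧
    ((optCocycle φ e).1 (fun i => letter c K (r i)) ≠ 0 → ∀ i, r i = a) := by
  cases e with
  | false => exact ⟨fun _ => rfl, fun _ i => i.elim0⟩
  | true =>
    have : (optCocycle φ true).1 (fun i => letter c K (r i)) = if r ⟨0, Nat.one_pos⟩ = a then 1 else 0 :=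
      hφ _
    rw [this]
    constructor
    · intro h
      rw [if_pos (h _)]
    · intro h i
      obtain rfl : i = ⟨0, Nat.one_pos⟩ := Fin.ext (Nat.lt_one_iff.1 i.2)
      simpa using h

theorem exists_of_mixedCocycle_ne {c K : ℕ} {e₀ : Bool} {k : ℕ} {e₁ : Bool} {n : ℕ}
    (h : e₀.toNat + 2 * k + e₁.toNat = n) {r : Fin n → ℕ} (hr : Function.Injective r)
    (hne : (mixedCocycle e₀ k e₁ h).1 (fun i => letter c K (r i)) ≠ 0) :
    (∀ i : Fin e₀.toNat, r ⟨i, by omega⟩ = 0) ∧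
    (∀ i : Fin e₁.toNat, r ⟨e₀.toNat + 2 * k + i, by omega⟩ = 1) ∧
    ∃ m, IsPairing K (fun j : Fin (2 * k) => r ⟨e₀.toNat + j, by omega⟩) m := by
  rw [mixedCocycle_apply] at hne
  refine ⟨(optCocycle_letter _ _ _ _ (deg₀_letter c K) _ _).2 fun h0 => hne (by rw [h0]; ring),
    (optCocycle_letter _ _ _ _ (deg_letter c K) _ _).2 fun h0 => hne (by rw [h0]; ring),
    exists_isPairing (c := c) (fun i j hij => ?_) fun h0 => hne (by rw [h0]; ring)⟩
  have := congrArg Fin.val (hr hij)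
  ext
  simpa using this

/-- Each factor of the cocycle consumes specific letters: `deg₀` needs letter 0, `deg` needs letter
1, and the divided power needs complete pairs in increasing order. This fixes both the cocycle and
the arrangement. -/
theorem eq_of_mixedCocycle_ne {c k : ℕ} {e₀ e₁ : Bool} {n : ℕ}
    (h : e₀.toNat + 2 * k + e₁.toNat = n) {e₀' e₁' : Bool} {k' : ℕ}
    (h' : e₀'.toNat + 2 * k' + e₁'.toNat = n) {σ : Equiv.Perm (Fin n)}
    (hne : (mixedCocycle e₀' k' e₁' h').1 (fun i => letter c k (dualIndex e₀ k n (σ i))) ≠ 0) :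
    e₀' = e₀ ∧ k' = k ∧ e₁' = e₁ ∧ σ = 1 := by
  have hinj := dualIndex_injective e₀ k e₁ h
  obtain ⟨h0, h1, m, hm, h2⟩ := exists_of_mixedCocycle_ne h' (hinj.comp σ.injective) hne
  have l0 : e₀'.toNat ≤ e₀.toNat := by
    cases e₀' with
    | false => simp
    | true =>
      by_contra hlt
      have := h0 ⟨0, by simp⟩
      have h₀ := e₀.toNat_le
      have ht : true.toNat = 1 := rfl
      simp only [Function.comp_apply, dualIndex] at this
      split_ifs at this
      omega
  have l1 : e₁'.toNat ≤ e₁.toNat := by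
    cases e₁' with
    | false => simp
    | true =>
      by_contra hlt
      have ht : true.toNat = 1 := rfl
      have := h1 ⟨0, by simp⟩
      simp only [Function.comp_apply, dualIndex] at this
      have := (σ ⟨e₀'.toNat + 2 * k' + 0, by omega⟩).2
      split_ifs at * <;> omega
  have lk : k' ≤ k := by
    have : Function.Injective (fun i => (⟨m i, (h2 i).1⟩ : Fin k)) :=
      fun i j hij => hm.injective (congrArg Fin.val hij)
    simpa using Fintype.card_le_of_injective _ this
  -- Three inequalities between the summands of the same total degree force equality in each.
  have e0 : e₀'.toNat = e₀.toNat := by omega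
  have e1 : e₁'.toNat = e₁.toNat := by omega
  obtain rfl : e₀' = e₀ := by cases e₀ <;> cases e₀' <;> simp_all
  obtain rfl : e₁' = e₁ := by cases e₁ <;> cases e₁' <;> simp_all
  obtain rfl : k' = k := by omega
  refine ⟨rfl, rfl, rfl, ?_⟩
  -- A strictly increasing self-map of a finite ordinal is the identity.
  have hmi (i : Fin k') : m i = i := by
    have hs : StrictMono fun i => (⟨m i, (h2 i).1⟩ : Fin k') := fun i j hij => hm hij
    have := congrFun ((hs.range_inj strictMono_id).1 (by
      rw [Set.range_id, Set.range_eq_univ]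
      exact Finite.surjective_of_injective hs.injective)) i
    exact congrArg Fin.val this
  refine Equiv.ext fun j => hinj ?_
  rw [Equiv.Perm.one_apply]
  rcases lt_or_ge (j : ℕ) e₀'.toNat with hj | hj
  · refine (h0 ⟨j, hj⟩).trans ?_
    rw [dualIndex, if_pos hj]
  rcases lt_or_ge (j : ℕ) (e₀'.toNat + 2 * k') with hj' | hj'
  · rw [show dualIndex e₀' k' n j = j - e₀'.toNat + 2 by
      rw [dualIndex, if_neg (by omega), if_pos hj']]
    rcases Nat.even_or_odd' (j - e₀'.toNat) with ⟨i, hi | hi⟩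
    · have := (h2 ⟨i, by omega⟩).2.1
      rw [hmi] at this
      rw [hi, ← this]
      refine congrArg (fun j => dualIndex e₀' k' n (σ j)) (Fin.ext ?_)
      simp only
      omega
    · have := (h2 ⟨i, by omega⟩).2.2
      rw [hmi] at this
      rw [hi, ← this]
      refine congrArg (fun j => dualIndex e₀' k' n (σ j)) (Fin.ext ?_)
      simp only
      omega
  · have := h1 ⟨j - (e₀'.toNat + 2 * k'), by omega⟩
    rw [show dualIndex e₀' k' n j = 1 by rw [dualIndex, if_neg (by omega), if_neg (by omega)],
      ← this]
    refine congrArg (fun j => dualIndex e₀' k' n (σ j)) (Fin.ext ?_)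
    simp only
    omega

theorem torusEval_mixedCocycle (c : ℕ) {k : ℕ} {e₀ e₁ : Bool} {n : ℕ}
    (h : e₀.toNat + 2 * k + e₁.toNat = n) {e₀' e₁' : Bool} {k' : ℕ}
    (h' : e₀'.toNat + 2 * k' + e₁'.toNat = n) :
    torusEval (fun i => letter c k (dualIndex e₀ k n i)) (mixedCocycle e₀' k' e₁' h').1 =
      if e₀' = e₀ ∧ k' = k ∧ e₁' = e₁ then (-1) ^ k else 0 := by
  rw [torusEval_apply]
  split_ifs with he
  · obtain ⟨rfl, rfl, rfl⟩ := he
    rw [Fintype.sum_eq_single 1]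
    · rw [Equiv.Perm.sign_one, Units.val_one, one_mul]
      have hinj := dualIndex_injective e₀' k' e₁' h
      have hp : IsPairing k' (fun j : Fin (2 * k') => dualIndex e₀' k' n ⟨e₀'.toNat + j, by omega⟩)
          fun i => i := by
        refine ⟨fun i j hij => hij, fun i => ⟨i.2, ?_, ?_⟩⟩ <;> simp only [dualIndex] <;>
          rw [if_neg (by omega), if_pos (by omega)] <;> omega
      rw [mixedCocycle_apply]
      simp only [Equiv.Perm.one_apply]
      rw [(optCocycle_letter _ _ _ _ (deg₀_letter c k') _ _).1,
        (optCocycle_letter _ _ _ _ (deg_letter c k') _ _).1, gvCocycle_letter _ hp, one_mul, mul_one]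
      · intro i j hij
        have := congrArg Fin.val (hinj hij)
        ext
        simpa using this
      · intro i
        rw [dualIndex, if_neg (by simp only; omega), if_neg (by simp only; omega)]
      · intro i
        rw [dualIndex, if_pos i.2]
    · intro σ hσ
      rw [mul_eq_zero]
      right
      by_contra hne
      exact hσ (eq_of_mixedCocycle_ne h h' hne).2.2.2
  · refine Finset.sum_eq_zero fun σ _ => ?_
    rw [mul_eq_zero]
    right
    by_contra hne
    have := eq_of_mixedCocycle_ne h h' hne
    exact he ⟨this.1, this.2.1, this.2.2.1⟩

end ThompsonF

/-! ### The product with the first Godbillon-Vey class on tori -/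

/-- The permutation of `k` blocks of length `2`. -/
def blockPerm {k n : ℕ} (h : k * 2 = n) (τ : Equiv.Perm (Fin k)) : Equiv.Perm (Fin n) :=
  (finProdFinEquiv.trans (finCongr h)).permCongr (Equiv.prodCongrLeft fun _ : Fin 2 => τ)

/-- Blocks of even length can be permuted without sign, so the contributions of all shuffles add up
instead of cancelling. -/
theorem sign_blockPerm {k n : ℕ} (h : k * 2 = n) (τ : Equiv.Perm (Fin k)) :
    Equiv.Perm.sign (blockPerm h τ) = 1 := by
  rw [blockPerm, Equiv.Perm.sign_permCongr, Equiv.Perm.sign_prodCongrLeft]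
  simp

theorem blockPerm_apply {k n : ℕ} (h : k * 2 = n) (τ : Equiv.Perm (Fin k)) (i : Fin k) (a : ℕ)
    (ha : a < 2) (h' : 2 * (i : ℕ) + a < n) :
    (blockPerm h τ ⟨2 * i + a, h'⟩ : ℕ) = 2 * τ i + a := by
  have e : (⟨2 * i + a, h'⟩ : Fin n) = (finProdFinEquiv.trans (finCongr h)) (i, ⟨a, ha⟩) := by
    ext
    simp [add_comm]
  rw [e, blockPerm, Equiv.permCongr_apply, Equiv.symm_apply_apply]
  simp [add_comm]

namespace ThompsonF

open groupCohomology

theorem exists_of_cup_gvCocycle_ne {c K k n : ℕ} (h : 2 * 1 + 2 * k = n) {r : Fin n → ℕ}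
    (hr : Function.Injective r) (hne : cup h (gvCocycle 1).1 (gvCocycle k).1
      (fun j => letter c K (r j)) ≠ 0) : ∃ m : Fin (k + 1) → ℕ, StrictMono (fun i : Fin k => m i.succ) ∧
        ∀ i, m i < K ∧ r ⟨2 * i, by omega⟩ = 2 * m i + 2 ∧ r ⟨2 * i + 1, by omega⟩ = 2 * m i + 3 := by
  obtain ⟨m₁, -, h₁⟩ := exists_isPairing (c := c) (K := K)
    (r := fun j : Fin (2 * 1) => r ⟨j, by omega⟩)
    (fun i j hij => Fin.ext (by simpa using hr hij)) fun h0 => hne (mul_eq_zero_of_left h0 _)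
  obtain ⟨m₂, hm, h₂⟩ := exists_isPairing (c := c) (K := K)
    (r := fun j : Fin (2 * k) => r ⟨2 * 1 + j, by omega⟩)
    (fun i j hij => Fin.ext (by simpa using hr hij)) fun h0 => hne (mul_eq_zero_of_right _ h0)
  refine ⟨Fin.cons (m₁ 0) m₂, hm, Fin.cases ?_ fun i => ?_⟩
  · exact h₁ 0
  · obtain ⟨a1, a2, a3⟩ := h₂ i
    rw [Fin.cons_succ]
    refine ⟨a1, ?_, ?_⟩
    · rw [← a2]
      exact congrArg r (Fin.ext (by simp; ring))
    · rw [← a3]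
      exact congrArg r (Fin.ext (by simp; ring))

theorem cup_gvCocycle_letter {c K k n : ℕ} (h : 2 * 1 + 2 * k = n) {r : Fin n → ℕ}
    (hr : Function.Injective r) (m : Fin (k + 1) → ℕ) (hm : StrictMono (fun i : Fin k => m i.succ))
    (h' : ∀ i, m i < K ∧ r ⟨2 * i, by omega⟩ = 2 * m i + 2 ∧ r ⟨2 * i + 1, by omega⟩ = 2 * m i + 3) :
    cup h (gvCocycle 1).1 (gvCocycle k).1 (fun j => letter c K (r j)) = (-1) ^ (k + 1) := by
  rw [pow_succ', ← pow_one (-1 : ℤ), ← pow_mul]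
  refine congrArg₂ (· * ·) (gvCocycle_letter (k := 1) (m := fun _ => m 0)
    (fun i j hij => Fin.ext (by simpa using hr hij)) ⟨fun i j hij => absurd hij (by omega), fun i => ?_⟩)
    ((gvCocycle_letter (m := fun i => m i.succ)
    (fun i j hij => Fin.ext (by simpa using hr hij)) ⟨hm, fun i => ?_⟩).trans (by rw [one_mul]))
  · obtain rfl : i = 0 := Subsingleton.elim _ _
    exact h' 0
  · obtain ⟨a1, a2, a3⟩ := h' i.succ
    refine ⟨a1, ?_, ?_⟩
    · rw [← a2]
      exact congrArg r (Fin.ext (by simp; ring))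
    · rw [← a3]
      exact congrArg r (Fin.ext (by simp; ring))

/-- The product needs `k + 1` different pairs of letters, but only `k` are available. -/
theorem torusEval_cup_gvCocycle_of_card {c k n : ℕ} (h : 2 * 1 + 2 * k = n) {r : Fin n → ℕ}
    (hr : Function.Injective r) :
    torusEval (fun j => letter c k (r j)) (cup h (gvCocycle 1).1 (gvCocycle k).1) = 0 := by
  rw [torusEval_apply]
  refine Finset.sum_eq_zero fun σ _ => ?_
  rw [mul_eq_zero]
  right
  by_contra hne
  obtain ⟨m, -, h'⟩ := exists_of_cup_gvCocycle_ne h (r := fun j => r (σ j))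
    (hr.comp σ.injective) hne
  have hinj : Function.Injective fun i => (⟨m i, (h' i).1⟩ : Fin k) := by
    intro i j hij
    have e : m i = m j := congrArg Fin.val hij
    have := hr.comp σ.injective (((h' i).2.1.trans (by rw [e])).trans (h' j).2.1.symm)
    ext
    simpa using this
  simpa using Fintype.card_le_of_injective _ hinj

/-- The nonzero terms are the `(1, k)`-shuffles of the pairs: choose the pair read by the first
factor, the rest being read in increasing order. All have sign +1. -/
theorem torusEval_cup_gvCocycle {c k n : ℕ} (h : 2 * 1 + 2 * k = n) :
    torusEval (fun j => letter c (k + 1) (dualIndex false (k + 1) n j))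
      (cup h (gvCocycle 1).1 (gvCocycle k).1) = (k + 1) * (-1) ^ (k + 1) := by
  have hn : (k + 1) * 2 = n := by omega
  have hd (j : Fin n) : dualIndex false (k + 1) n j = j + 2 := by
    rw [dualIndex, if_neg (by simp), if_pos (by simp; omega)]
    simp
  have hinj : Function.Injective (dualIndex false (k + 1) n) :=
    dualIndex_injective false (k + 1) false (by simp; omega)
  -- The inverse of `p.cycleRange` brings `p` to the front and keeps the order of the others.
  let e (p : Fin (k + 1)) : Equiv.Perm (Fin n) := blockPerm hn p.cycleRange.symm
  have he0 (p : Fin (k + 1)) (i : Fin (k + 1)) (a : ℕ) (ha : a < 2) (h' : 2 * (i : ℕ) + a < n) :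
      dualIndex false (k + 1) n (e p ⟨2 * i + a, h'⟩) = 2 * p.cycleRange.symm i + 2 + a := by
    rw [hd, blockPerm_apply hn _ _ _ ha]
    omega
  have he : Function.Injective e := by
    intro p q hpq
    have h1 := he0 p 0 0 (by omega) (by simp; omega)
    have h2 := he0 q 0 0 (by omega) (by simp; omega)
    rw [hpq, h2, Fin.cycleRange_symm_zero, Fin.cycleRange_symm_zero] at h1
    ext
    omega
  rw [torusEval_apply, ← Fintype.sum_of_injective e he (fun _ => (-1) ^ (k + 1))]
  · simp
  · intro σ hσ
    rw [mul_eq_zero]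
    right
    by_contra hne
    obtain ⟨m, hm, h'⟩ := exists_of_cup_gvCocycle_ne h
      (r := fun j => dualIndex false (k + 1) n (σ j)) (hinj.comp σ.injective) hne
    simp only [hd] at h'
    let m' (i : Fin (k + 1)) : Fin (k + 1) := ⟨m i, (h' i).1⟩
    have hm' : Function.Injective m' := by
      intro i j hij
      have e : m i = m j := congrArg Fin.val hij
      have : σ ⟨2 * i, by omega⟩ = σ ⟨2 * j, by omega⟩ := by
        have h1 := (h' i).2.1
        have h2 := (h' j).2.1
        ext
        omega
      ext
      simpa using σ.injective this
    -- Both are increasing with image the complement of `m' 0`, hence equal; so `σ` is one of the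
    -- listed shuffles.
    have hs : (fun i : Fin k => m' i.succ) = (m' 0).succAbove := by
      have hs' : StrictMono fun i : Fin k => m' i.succ := hm
      refine (hs'.range_inj (Fin.strictMono_succAbove _)).1 ?_
      rw [Fin.range_succAbove]
      have h1 : Set.range (fun i : Fin k => m' i.succ) = m' '' (Set.range Fin.succ) :=
        Set.range_comp m' Fin.succ
      rw [h1, Fin.range_succ, Set.image_compl_eq
        (Finite.injective_iff_bijective.1 hm'), Set.image_singleton]
    have hτ (i : Fin (k + 1)) : (m' 0).cycleRange.symm i = m' i := by
      refine Fin.cases ?_ (fun i => ?_) i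
      · rw [Fin.cycleRange_symm_zero]
      · rw [Fin.cycleRange_symm_succ, ← hs]
    refine hσ ⟨m' 0, Equiv.ext fun j => hinj ?_⟩
    have hj : j = ⟨2 * (⟨j / 2, by omega⟩ : Fin (k + 1)) + j % 2, by simp only; omega⟩ :=
      Fin.ext (by simp only; omega)
    conv_lhs => rw [hj]
    rw [he0 _ _ _ (by omega), hτ, hd]
    change 2 * m _ + 2 + _ = _
    have := h' ⟨j / 2, by omega⟩
    rcases Nat.mod_two_eq_zero_or_one j with h0 | h0
    · rw [h0, add_zero, ← this.2.1]
      congr 3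
      ext
      simp only
      omega
    · rw [h0, show ∀ a, 2 * a + 2 + 1 = 2 * a + 3 from fun _ => rfl, ← this.2.2]
      congr 3
      ext
      simp only
      omega
  · intro p
    rw [sign_blockPerm, Units.val_one, one_mul]
    refine (cup_gvCocycle_letter h (r := fun j => dualIndex false (k + 1) n (e p j))
      (hinj.comp (e p).injective) (fun i => p.cycleRange.symm i) ?_ fun i => ⟨?_, ?_, ?_⟩).symm
    · simp only [Fin.cycleRange_symm_succ]
      exact fun i j hij => Fin.strictMono_succAbove p hij
    · exact Fin.is_lt _
    · exact he0 p i 0 (by omega) (by omega)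
    · exact he0 p i 1 (by omega) (by omega)

end ThompsonF

/-! ### The additive basis and the ring structure of the cohomology of F -/

/-- If `r` elements generate and `r` functionals are dual up to sign to some `w`, evaluating
generators gives a surjective endomorphism of `ℤ^r`, which is therefore injective. So the
functionals separate points and `w` generates. -/
theorem eq_sum_of_dual {r : ℕ} {M : Type*} [AddCommGroup M] (c : Fin r → M)
    (hc : ∀ x, ∃ m : Fin r → ℤ, x = ∑ i, m i • c i) (ε : Fin r → M →+ ℤ) (w : Fin r → M)
    (s : Fin r → ℤ) (hs : ∀ i, s i * s i = 1) (hw : ∀ i j, ε i (w j) = if i = j then s i else 0)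
    (x : M) : x = ∑ i, (s i * ε i x) • w i := by
  let ψ : (Fin r → ℤ) →ₗ[ℤ] (Fin r → ℤ) := LinearMap.pi fun i => ∑ j, ε i (c j) • LinearMap.proj j
  have hψ (m : Fin r → ℤ) (i : Fin r) : ψ m i = ε i (∑ j, m j • c j) := by
    simp [ψ, mul_comm]
  have hsum (v : Fin r → ℤ) (i : Fin r) : ε i (∑ j, (s j * v j) • w j) = v i := by
    simp only [map_sum, map_zsmul, hw, smul_eq_mul, mul_ite, mul_zero, Finset.sum_ite_eq,
      Finset.mem_univ, if_true]
    linear_combination v i * hs i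
  have hsurj : Function.Surjective ψ := by
    intro v
    obtain ⟨m, hm⟩ := hc (∑ j, (s j * v j) • w j)
    refine ⟨m, funext fun i => ?_⟩
    rw [hψ, ← hm, hsum]
  have hinj := OrzechProperty.injective_of_surjective_endomorphism ψ hsurj
  obtain ⟨m, hm⟩ := hc (x - ∑ i, (s i * ε i x) • w i)
  have : m = 0 := by
    apply hinj
    rw [map_zero]
    refine funext fun i => ?_
    rw [hψ, ← hm, map_sub, hsum, sub_self, Pi.zero_apply]
  rw [this] at hm
  simpa [sub_eq_zero] using hm

namespace CohomologyRing

open groupCohomology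

variable {G : Type} [Group G]

/-- The projection of the cohomology ring to its part of degree `n`. -/
noncomputable def proj (n : ℕ) : CohomologyRing G →+ IntCohomology G n :=
  DFinsupp.evalAddMonoidHom n

theorem proj_of_same (n : ℕ) (x : IntCohomology G n) : proj n (of n x) = x :=
  DirectSum.of_eq_same n x

theorem proj_of_ne {m n : ℕ} (h : m ≠ n) (x : IntCohomology G m) : proj n (of m x) = 0 :=
  DirectSum.of_eq_of_ne _ _ _ h.symm

theorem induction_on {p : CohomologyRing G → Prop} (x : CohomologyRing G) (h0 : p 0)
    (hof : ∀ n (f : (delta (G := G) n).ker), p (of n (cls n f))) (hadd : ∀ x y, p x → p y → p (x + y)) :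
    p x := by
  refine DirectSum.induction_on x h0 (fun n y => ?_) hadd
  obtain ⟨f, rfl⟩ := cls_surjective n y
  exact hof n f

theorem of_cls_mul {p q n : ℕ} (h : p + q = n) (f : (delta (G := G) p).ker)
    (g : (delta (G := G) q).ker) : of p (cls p f) * of q (cls q g) = of n (cls n (cupCocycle h f g)) := by
  subst h
  rw [of_mul_of, cupClass_cls]

theorem one_def : (1 : CohomologyRing G) = of 0 (cls 0 (oneCocycle G)) := rfl

end CohomologyRing

namespace ThompsonF

open groupCohomology CohomologyRing

/-- The indices of the basis of the cohomology ring. -/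
abbrev Idx : Type := ℕ × (Bool × Bool)

/-- The cohomological degree of an index. -/
def Idx.degree (I : Idx) : ℕ := I.2.1.toNat + 2 * I.1 + I.2.2.toNat

theorem Idx.degree_eq {I : Idx} {n : ℕ} (h : I.degree = n) : I.2.1.toNat + 2 * I.1 + I.2.2.toNat = n := h

/-- The class of `mixedCocycle`. -/
noncomputable def mixedClass (I : Idx) : CohomologyRing ThompsonF :=
  of I.degree (cls I.degree (mixedCocycle I.2.1 I.1 I.2.2 rfl))

theorem mixedClass_eq {I : Idx} {n : ℕ} (h : I.degree = n) :
    mixedClass I = of n (cls n (mixedCocycle I.2.1 I.1 I.2.2 (Idx.degree_eq h))) := by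
  subst h
  rfl

/-- The evaluation on the torus dual to `mixedClass I`. -/
noncomputable def dualEval (I : Idx) : CohomologyRing ThompsonF →+ ℤ :=
  (torusEvalClass (fun j => letter 0 I.1 (dualIndex I.2.1 I.1 I.degree j))
    fun _ _ => commute_letter _ _ _ _).comp (proj I.degree)

theorem dualEval_of_ne {I : Idx} {n : ℕ} (h : n ≠ I.degree) (x : IntCohomology ThompsonF n) :
    dualEval I (of n x) = 0 := by
  rw [dualEval, AddMonoidHom.comp_apply, proj_of_ne h, map_zero]

theorem dualEval_of_cls {I : Idx} {n : ℕ} (h : I.degree = n) (f : (delta (G := ThompsonF) n).ker) :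
    dualEval I (of n (cls n f)) =
      torusEval (fun j => letter 0 I.1 (dualIndex I.2.1 I.1 n j)) f.1 := by
  subst h
  rw [dualEval, AddMonoidHom.comp_apply, proj_of_same, torusEvalClass_cls]

theorem dualEval_mixedClass (I J : Idx) :
    dualEval I (mixedClass J) = if I = J then (-1) ^ I.1 else 0 := by
  by_cases h : J.degree = I.degree
  · rw [mixedClass_eq h, dualEval_of_cls rfl, torusEval_mixedCocycle 0 (Idx.degree_eq rfl)]
    congr 1
    ext
    rw [Prod.ext_iff, Prod.ext_iff]
    tauto
  · rw [mixedClass, dualEval_of_ne h, if_neg]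
    rintro rfl
    exact h rfl

theorem of_mem_span_mixedClass {n : ℕ} (L : Fin 2 → Idx) (hL : Function.Injective L)
    (hdeg : ∀ i, (L i).degree = n + 1) (x : IntCohomology ThompsonF (n + 1)) :
    of (n + 1) x ∈ Submodule.span ℤ (Set.range mixedClass) := by
  obtain ⟨c, hc⟩ := exists_span_intCohomology n
  rw [eq_sum_of_dual c hc (fun i => (dualEval (L i)).comp (of (n + 1)))
    (fun i => cls _ (mixedCocycle (L i).2.1 (L i).1 (L i).2.2 (Idx.degree_eq (hdeg i))))
    (fun i => (-1) ^ (L i).1) (fun i => by rw [← mul_pow]; simp) (fun i j => by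
      rw [AddMonoidHom.comp_apply, ← mixedClass_eq (hdeg j), dualEval_mixedClass]
      exact if_congr hL.eq_iff rfl rfl) x, map_sum]
  refine Submodule.sum_mem _ fun i _ => ?_
  rw [map_zsmul, ← mixedClass_eq (hdeg i)]
  exact Submodule.smul_mem _ _ (Submodule.subset_span ⟨_, rfl⟩)

/-- The `k`-th divided power of the class of degree `2`. -/
noncomputable def gvClass (k : ℕ) : CohomologyRing ThompsonF := of (2 * k) (cls (2 * k) (gvCocycle k))

/-- The class of a homomorphism to the integers. -/
noncomputable def homClass {G : Type} [Group G] (φ : G →* Multiplicative ℤ) : CohomologyRing G :=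
  of 1 (cls 1 (homCocycle φ))

theorem mixedClass_eq_mul (I : Idx) : mixedClass I =
    (if I.2.1 then homClass deg₀ else 1) * gvClass I.1 * (if I.2.2 then homClass deg else 1) := by
  have h (φ : ThompsonF →* Multiplicative ℤ) (e : Bool) : (if e then homClass φ else 1) =
      of e.toNat (cls e.toNat (optCocycle φ e)) := by
    cases e <;> rfl
  rw [h, h, gvClass, of_cls_mul rfl, of_cls_mul (n := I.degree) rfl]
  rfl

theorem gvClass_zero : gvClass 0 = 1 := by
  refine congrArg (fun f => of 0 (cls 0 f)) (Subtype.ext (funext fun y => ?_))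
  have : y = fun i => letter 0 0 (Fin.elim0 i) := funext fun i => i.elim0
  rw [this]
  exact gvCocycle_letter (k := 0) (fun i => i.elim0) (m := fun i => i.elim0)
    ⟨fun i => i.elim0, fun i => i.elim0⟩

/-- In each positive degree there are exactly two mixed classes, as many as the bound from the
resolution, and they are dual to tori. In degree 0 a cochain is a multiple of the unit. -/
theorem span_mixedClass : Submodule.span ℤ (Set.range mixedClass) = ⊤ := by
  refine eq_top_iff.2 fun x _ => ?_
  induction x using CohomologyRing.induction_on with
  | h0 => exact Submodule.zero_mem _
  | hadd x y hx hy => exact Submodule.add_mem _ (hx trivial) (hy trivial)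
  | hof n f =>
    rcases n with _ | n
    · have : of 0 (cls 0 f) = f.1 (fun i => i.elim0) • mixedClass (0, (false, false)) := by
        rw [mixedClass_eq_mul, gvClass_zero, if_neg (by simp), if_neg (by simp), one_mul, one_mul,
          one_def, ← map_zsmul, ← map_zsmul]
        refine congrArg (fun f => of 0 (cls 0 f)) (Subtype.ext (funext fun y => ?_))
        obtain rfl : y = fun i => i.elim0 := Subsingleton.elim _ _
        exact (mul_one _).symm
      rw [this]
      exact Submodule.smul_mem _ _ (Submodule.subset_span ⟨_, rfl⟩)
    · rcases Nat.even_or_odd' n with ⟨k, rfl | rfl⟩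
      · refine of_mem_span_mixedClass ![(k, (true, false)), (k, (false, true))] ?_ ?_ _
        · intro i j h
          fin_cases i <;> fin_cases j <;> simp_all
        · intro i
          fin_cases i <;> (simp [Idx.degree]; try omega)
      · refine of_mem_span_mixedClass ![(k + 1, (false, false)), (k, (true, true))] ?_ ?_ _
        · intro i j h
          fin_cases i <;> fin_cases j <;> simp_all
        · intro i
          fin_cases i <;> (simp [Idx.degree]; try omega)

theorem linearIndependent_of_dual {ι M : Type*} [AddCommGroup M] [DecidableEq ι] (w : ι → M)
    (ε : ι → M →+ ℤ) (s : ι → ℤ) (hs : ∀ i, s i ≠ 0)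
    (h : ∀ i j, ε i (w j) = if i = j then s i else 0) : LinearIndependent ℤ w := by
  rw [linearIndependent_iff']
  intro t g hg i hi
  have := congrArg (ε i) hg
  simp only [map_sum, map_zsmul, h, map_zero, smul_eq_mul, mul_ite, mul_zero, Finset.sum_ite_eq,
    if_pos hi] at this
  exact (mul_eq_zero.1 this).resolve_right (hs i)

/-- The additive basis of the cohomology ring. -/
noncomputable def mixedBasis : Module.Basis Idx ℤ (CohomologyRing ThompsonF) :=
  Module.Basis.mk (linearIndependent_of_dual mixedClass dualEval (fun I => (-1) ^ I.1) (by simp)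
    dualEval_mixedClass) span_mixedClass.ge

theorem mixedBasis_apply (I : Idx) : mixedBasis I = mixedClass I := Module.Basis.mk_apply _ _ _

/-- The evaluations are, up to sign, the coordinates in the basis; identities in the ring may be
checked on the dual tori. -/
theorem eq_zero_of_dualEval (x : CohomologyRing ThompsonF) (h : ∀ I, dualEval I x = 0) : x = 0 := by
  apply mixedBasis.repr.injective
  rw [map_zero]
  ext I
  have := h I
  rw [← mixedBasis.linearCombination_repr x, Finsupp.linearCombination_apply, Finsupp.sum,
    map_sum] at this
  simp only [map_zsmul, mixedBasis_apply, dualEval_mixedClass, smul_eq_mul, mul_ite, mul_zero,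
    Finset.sum_ite_eq] at this
  by_contra hne
  rw [if_pos (Finsupp.mem_support_iff.2 hne)] at this
  simp at this
  exact hne this

/-- Graded commutativity is needed only for a factor of degree 1, and on a torus it is a rotation of
the arguments. -/
theorem homClass_mul (φ : ThompsonF →* Multiplicative ℤ) (n : ℕ) (f : (delta (G := ThompsonF) n).ker) :
    homClass φ * of n (cls n f) = (-1) ^ n * (of n (cls n f) * homClass φ) := by
  have e : (-1 : CohomologyRing ThompsonF) ^ n = (((-1) ^ n : ℤ) : CohomologyRing ThompsonF) := by simp
  rw [← sub_eq_zero, e, ← zsmul_eq_mul]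
  apply eq_zero_of_dualEval
  intro I
  rw [homClass, of_cls_mul (add_comm 1 n), of_cls_mul rfl, map_sub, map_zsmul]
  by_cases h : I.degree = n + 1
  · rw [dualEval_of_cls h, dualEval_of_cls h, sub_eq_zero, smul_eq_mul]
    exact torusEval_cup_comm _ _ _ (add_comm 1 n)
  · rw [dualEval_of_ne (Ne.symm h), dualEval_of_ne (Ne.symm h)]
    simp

theorem homClass_mul_gvClass (φ : ThompsonF →* Multiplicative ℤ) (k : ℕ) :
    homClass φ * gvClass k = gvClass k * homClass φ := by
  rw [gvClass, homClass_mul, Even.neg_one_pow (even_two_mul k), one_mul]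

theorem homClass_mul_homClass (φ ψ : ThompsonF →* Multiplicative ℤ) :
    homClass φ * homClass ψ = -(homClass ψ * homClass φ) := by
  rw [homClass, homClass, ← homClass, homClass_mul, pow_one, neg_one_mul]

instance : IsAddTorsionFree (CohomologyRing ThompsonF) where
  nsmul_right_injective n hn x y hxy := by
    rw [← sub_eq_zero]
    apply eq_zero_of_dualEval
    intro I
    have := congrArg (dualEval I) hxy
    simp only [map_nsmul] at this
    rw [map_sub, nsmul_right_injective hn this, sub_self]

theorem homClass_mul_self (φ : ThompsonF →* Multiplicative ℤ) : homClass φ * homClass φ = 0 :=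
  self_eq_neg.1 (homClass_mul_homClass φ φ)

/-- In this degree there are only two dual tori: one counts the shuffles, the other has too few
pairs. -/
theorem gvClass_one_mul (k : ℕ) : gvClass 1 * gvClass k = (k + 1) • gvClass (k + 1) := by
  have e : gvClass (k + 1) = mixedClass (k + 1, (false, false)) := by
    rw [mixedClass_eq_mul]
    simp
  rw [← sub_eq_zero, e, ← natCast_zsmul]
  apply eq_zero_of_dualEval
  intro I
  rw [map_sub, map_zsmul, dualEval_mixedClass, gvClass, gvClass,
    of_cls_mul (show 2 * 1 + 2 * k = 2 * (k + 1) by ring)]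
  by_cases h : I.degree = 2 * (k + 1)
  · rw [dualEval_of_cls h]
    obtain ⟨i, e₀, e₁⟩ := I
    cases e₀ <;> cases e₁ <;> simp [Idx.degree] at h
    · obtain rfl : i = k + 1 := by omega
      rw [if_pos rfl, smul_eq_mul]
      refine sub_eq_zero.2 ((torusEval_cup_gvCocycle
        (show 2 * 1 + 2 * k = 2 * (k + 1) by ring)).trans ?_)
      push_cast
      rfl
    · omega
    · omega
    -- The torus through the letters 0 and 1 has the same dimension but only `k` pairs, so the
    -- product vanishes on it.
    · obtain rfl : i = k := by omega
      rw [if_neg (by simp), smul_zero, sub_zero]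
      exact torusEval_cup_gvCocycle_of_card (show 2 * 1 + 2 * i = 2 * (i + 1) by ring)
        (dualIndex_injective true i true (by simp; omega))
  · rw [dualEval_of_ne (Ne.symm h), if_neg]
    · simp
    · rintro rfl
      exact h (by simp [Idx.degree])

theorem gvClass_one_pow (k : ℕ) : gvClass 1 ^ k = k.factorial • gvClass k := by
  induction k with
  | zero => simp [gvClass_zero]
  | succ k ih => rw [pow_succ', ih, mul_smul_comm, gvClass_one_mul, smul_smul, Nat.factorial_succ,
      mul_comm]

/-- The factorial multiples of the divided powers are powers of the degree 2 class; torsion-freeness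
allows the factorials to be cancelled. -/
theorem gvClass_mul (i j : ℕ) : gvClass i * gvClass j = (i + j).choose i • gvClass (i + j) := by
  apply nsmul_right_injective (mul_ne_zero i.factorial_ne_zero j.factorial_ne_zero)
  simp only
  rw [← smul_mul_smul_comm, ← gvClass_one_pow, ← gvClass_one_pow, ← pow_add, gvClass_one_pow, smul_smul]
  congr 1
  rw [← Nat.add_choose_mul_factorial_mul_factorial, Nat.choose_symm_add]
  ring

end ThompsonF

/-! ### Cohomology of a telescope of groups -/

namespace groupCohomology

section telescope
variable {D P : Type} [Group D] [Group P] {T : D →* D} {j : ℕ → D →* P}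

theorem pull_surjective (hT : Function.Injective T) (n : ℕ) : Function.Surjective (pull T n) := by
  intro f
  have hinj : Function.Injective fun (x : Fin n → D) i => T (x i) :=
    fun x y h => funext fun i => hT (congrFun h i)
  exact ⟨Function.extend (fun (x : Fin n → D) i => T (x i)) f 0,
    funext fun x => hinj.extend_apply _ _ _⟩

/-- Cochains can be extended by zero along an injective homomorphism, so coboundaries lift to
coboundaries. -/
theorem exists_isCoboundary_pull_eq (hT : Function.Injective T) {n : ℕ} {f : IntCochain D n}
    (hf : IsCoboundary n f) : ∃ f', IsCoboundary n f' ∧ pull T n f' = f := by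
  cases n with
  | zero => exact ⟨0, isCoboundary_zero 0, (map_zero _).trans (show f = 0 from hf).symm⟩
  | succ n =>
    obtain ⟨g, rfl⟩ := hf
    obtain ⟨g, rfl⟩ := pull_surjective hT n g
    exact ⟨delta n g, ⟨g, rfl⟩, (delta_pull T g).symm⟩

theorem telescope_iterate (hj : ∀ k g, j (k + 1) (T g) = j k g) (k l : ℕ) (g : D) :
    j (k + l) (T^[l] g) = j k g := by
  induction l generalizing g with
  | zero => rfl
  | succ l ih => rw [← add_assoc, Function.iterate_succ_apply', hj, ih]

theorem exists_tuple_lift (hj : ∀ k g, j (k + 1) (T g) = j k g) (hsurj : ∀ p, ∃ k g, j k g = p)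
    {n : ℕ} (y : Fin n → P) : ∃ k, ∃ g : Fin n → D, (fun i => j k (g i)) = y := by
  choose k g hg using fun i => hsurj (y i)
  refine ⟨∑ i, k i, fun i => T^[∑ i, k i - k i] (g i), funext fun i => ?_⟩
  have : k i ≤ ∑ i, k i := Finset.single_le_sum (fun _ _ => Nat.zero_le _) (Finset.mem_univ i)
  obtain ⟨l, hl⟩ := Nat.exists_eq_add_of_le this
  beta_reduce
  rw [← hg i, hl, Nat.add_sub_cancel_left, telescope_iterate hj]

/-- A cochain on the union is the same as a strictly compatible family; finite tuples always lie in
one stage. -/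
theorem exists_glue (hj : ∀ k g, j (k + 1) (T g) = j k g) (hsurj : ∀ p, ∃ k g, j k g = p)
    (hinj : ∀ k, Function.Injective (j k)) {n : ℕ} (h : ℕ → IntCochain D n)
    (hh : ∀ k, pull T n (h (k + 1)) = h k) : ∃ H : IntCochain P n, ∀ k, pull (j k) n H = h k := by
  have hit (k l : ℕ) (g : Fin n → D) : h (k + l) (fun i => T^[l] (g i)) = h k g := by
    induction l generalizing g with
    | zero => rfl
    | succ l ih =>
      simp only [Function.iterate_succ_apply']
      exact (congrFun (hh (k + l)) _).trans (ih g)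
  have hle {k l : ℕ} (hkl : k ≤ l) {g g' : Fin n → D}
      (e : (fun i => j k (g i)) = fun i => j l (g' i)) : h k g = h l g' := by
    obtain ⟨m, rfl⟩ := Nat.exists_eq_add_of_le hkl
    have : g' = fun i => T^[m] (g i) := funext fun i => hinj (k + m) (by
      rw [telescope_iterate hj, ← congrFun e i])
    rw [this, hit]
  have hwd {k l : ℕ} {g g' : Fin n → D}
      (e : (fun i => j k (g i)) = fun i => j l (g' i)) : h k g = h l g' :=
    (le_total k l).elim (fun hkl => hle hkl e) fun hkl => (hle hkl e.symm).symm
  choose k g hg using fun y : Fin n → P => exists_tuple_lift hj hsurj y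
  exact ⟨fun y => h (k y) (g y), fun l => funext fun y => hwd (hg _)⟩

/-- The vanishing of the `lim¹` term in the cohomology of the direct limit of a telescope, under
the Mittag-Leffler condition. -/
theorem isCoboundary_of_telescope (hj : ∀ k g, j (k + 1) (T g) = j k g)
    (hsurj : ∀ p, ∃ k g, j k g = p) (hinj : ∀ k, Function.Injective (j k)) {n : ℕ}
    (hML : ∀ c : (delta (G := D) n).ker, ∃ c' : (delta (G := D) n).ker,
      IsCoboundary n (pull T n c.1 - pull T n (pull T n c'.1)))
    (f : IntCochain P (n + 1)) (hf : ∀ k, IsCoboundary (n + 1) (pull (j k) (n + 1) f)) :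
    IsCoboundary (n + 1) f := by
  have hT : Function.Injective T := fun a b hab => hinj 0 (by rw [← hj 0 a, ← hj 0 b, hab])
  choose h' hh' using hf
  have hpull (k m : ℕ) (u : IntCochain P m) : pull T m (pull (j (k + 1)) m u) = pull (j k) m u :=
    funext fun y => congrArg u (funext fun i => hj k (y i))
  have hTh (k : ℕ) : delta n (pull T n (h' (k + 1))) = pull (j k) (n + 1) f := by
    rw [delta_pull, hh', hpull]
  -- The primitives on the stages fail to be compatible by these cocycles. Indices start at `k + 1`
  -- because everything is corrected only after one more pullback along `T`, where the hypothesis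
  -- applies.
  let c (k : ℕ) : (delta (G := D) n).ker := ⟨h' (k + 1) - pull T n (h' (k + 2)), by
    rw [AddMonoidHom.mem_ker, map_sub, hh', hTh, sub_self]⟩
  choose Z hZ using hML
  choose B hB hB' using fun f : {f : IntCochain D n // IsCoboundary n f} =>
    exists_isCoboundary_pull_eq hT f.2
  -- The correction has two parts: a cocycle, supplied by the Mittag-Leffler hypothesis, and a
  -- coboundary lifted through `T` which makes the compatibility hold on cochains and not only on
  -- classes.
  let step (k : ℕ) (s : (delta (G := D) n).ker × {f : IntCochain D n // IsCoboundary n f}) :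
      (delta (G := D) n).ker × {f : IntCochain D n // IsCoboundary n f} :=
    (Z (c k + s.1), ⟨_, hB ⟨_, isCoboundary_add (hZ (c k + s.1)) s.2.2⟩⟩)
  let s (k : ℕ) : (delta (G := D) n).ker × {f : IntCochain D n // IsCoboundary n f} :=
    Nat.rec (0, ⟨0, isCoboundary_zero n⟩) step k
  have hs (k : ℕ) : pull T n (pull T n (s (k + 1)).1.1) + pull T n (s (k + 1)).2.1 =
      pull T n ((c k).1 + (s k).1.1) + (s k).2.1 := by
    have h1 : (s (k + 1)).1 = Z (c k + (s k).1) := rfl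
    have h2 : pull T n (s (k + 1)).2.1 = pull T n (c k + (s k).1).1 -
      pull T n (pull T n (Z (c k + (s k).1)).1) + (s k).2.1 := hB' ⟨_, _⟩
    rw [h2, h1, AddSubgroup.coe_add]
    abel
  obtain ⟨H, hH⟩ := exists_glue hj hsurj hinj
    (fun k => pull T n (h' (k + 1)) + pull T n (s k).1.1 + (s k).2.1) (fun k => by
      have := hs k
      simp only [c, map_add, map_sub] at this ⊢
      linear_combination this)
  refine ⟨H, funext fun y => ?_⟩
  obtain ⟨k, g, rfl⟩ := exists_tuple_lift hj hsurj y
  have : pull (j k) (n + 1) (delta n H) = pull (j k) (n + 1) f := by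
    rw [← delta_pull, hH, map_add, map_add, hTh, delta_pull, show delta n (s k).1.1 = 0 from (s k).1.2,
      delta_of_isCoboundary (s k).2.2, map_zero, add_zero, add_zero]
  exact congrFun this g

end telescope

end groupCohomology

/-! ### The commutator subgroup as a telescope -/

namespace ThompsonF

open groupCohomology

theorem deg_shift (g : ThompsonF) : deg (shift g) = deg g :=
  DFunLike.congr_fun (hom_ext (f := deg.comp shift) (g := deg) fun i => by simp) g

theorem deg₀_shift (g : ThompsonF) : deg₀ (shift g) = 1 :=
  DFunLike.congr_fun (hom_ext (f := deg₀.comp shift) (g := 1) fun i => by simp) g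

theorem abelianization_of_x (i : ℕ) : Abelianization.of (x (i + 1)) = Abelianization.of (x 1) := by
  induction i with
  | zero => rfl
  | succ i ih =>
    rw [← ih]
    have := congrArg Abelianization.of (x_mul_x (show 0 < i + 1 by omega))
    rw [map_mul, map_mul, mul_comm] at this
    exact (mul_left_cancel this).symm

theorem abelianization_of_eq (g : ThompsonF) : Abelianization.of g =
    Abelianization.of (x 0) ^ (deg₀ g).toAdd * Abelianization.of (x 1) ^ ((deg g).toAdd - (deg₀ g).toAdd) := by
  refine DFunLike.congr_fun (hom_ext (f := Abelianization.of)
    (g := (zpowersHom _ (Abelianization.of (x 0))).comp deg₀ *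
      (zpowersHom _ (Abelianization.of (x 1))).comp (deg / deg₀)) fun i => ?_) g
  cases i with
  | zero => simp
  | succ i => simp [abelianization_of_x]

/-- The relations identify all `x (i + 1)` in the abelianization, which is thus generated by the
classes of `x 0` and `x 1`, with exponents read off by the two degrees. -/
theorem mem_commutator_iff (g : ThompsonF) : g ∈ commutator ThompsonF ↔ deg g = 1 ∧ deg₀ g = 1 := by
  constructor
  · intro h
    exact ⟨Abelianization.commutator_subset_ker deg h, Abelianization.commutator_subset_ker deg₀ h⟩
  · rintro ⟨h1, h2⟩
    rw [← Abelianization.ker_of, MonoidHom.mem_ker, abelianization_of_eq, h1, h2]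
    simp

/-- The restriction of the shift to the kernel of the degree. -/
def shiftKer : degKer →* degKer :=
  (shift.comp degKer.subtype).codRestrict degKer fun g => by
    rw [MonoidHom.mem_ker, MonoidHom.comp_apply, deg_shift]
    exact g.2

theorem coe_shiftKer (g : degKer) : (shiftKer g : ThompsonF) = shift g := rfl

/-- The homomorphisms from the kernel of the degree to the commutator subgroup, conjugate in `F`,
whose images exhaust the commutator subgroup. -/
def toCommutator (k : ℕ) : degKer →* commutator ThompsonF :=
  (((MulAut.conj (x 0 ^ k)).toMonoidHom.comp shift).comp degKer.subtype).codRestrict _ fun g => by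
    have h1 : deg g = 1 := g.2
    have h2 : (((MulAut.conj (x 0 ^ k)).toMonoidHom.comp shift).comp degKer.subtype) g =
      x 0 ^ k * shift g * (x 0 ^ k)⁻¹ := rfl
    rw [h2, mem_commutator_iff, map_mul, map_mul, map_mul, map_mul, deg_shift, deg₀_shift, h1, map_inv,
      map_inv, mul_one, mul_one, mul_inv_cancel, mul_inv_cancel]
    exact ⟨rfl, rfl⟩

theorem coe_toCommutator (k : ℕ) (g : degKer) :
    (toCommutator k g : ThompsonF) = x 0 ^ k * shift g * (x 0 ^ k)⁻¹ := rfl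

theorem toCommutator_injective (k : ℕ) : Function.Injective (toCommutator k) := by
  intro g h e
  have := congrArg Subtype.val e
  rw [coe_toCommutator, coe_toCommutator, mul_left_inj, mul_right_inj] at this
  exact Subtype.ext (shift_injective this)

theorem toCommutator_succ (k : ℕ) (g : degKer) : toCommutator (k + 1) (shiftKer g) = toCommutator k g := by
  apply Subtype.ext
  rw [coe_toCommutator, coe_toCommutator, coe_shiftKer, shift_shift, pow_succ]
  group

theorem x_mul_pow (i k : ℕ) : x (i + 1) * x 0 ^ k = x 0 ^ k * x (i + k + 1) := by
  induction k with
  | zero => simp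
  | succ k ih =>
    rw [pow_succ, ← mul_assoc, ih, mul_assoc, x_mul_x (by omega), ← mul_assoc]
    rfl

/-- F is an ascending extension of the image of the shift by the letter `x 0`: powers of `x 0` can
be collected on both sides, since `x 0` conjugates the shifted copy into itself. -/
theorem exists_eq_conj_shift (h : ThompsonF) :
    ∃ k l g, h = x 0 ^ k * shift g * (x 0 ^ l)⁻¹ := by
  induction h using induction_on with
  | h1 => exact ⟨0, 0, 1, by simp⟩
  | hx i h ih =>
    obtain ⟨k, l, g, rfl⟩ := ih
    cases i with
    | zero => exact ⟨k + 1, l, g, by rw [pow_succ']; group⟩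
    | succ i =>
      refine ⟨k, l, x (i + k) * g, ?_⟩
      rw [map_mul, shift_x, ← mul_assoc, ← mul_assoc, x_mul_pow]
      group
  | hi i h ih =>
    obtain ⟨k, l, g, rfl⟩ := ih
    cases i with
    | zero =>
      cases k with
      | zero => exact ⟨0, l + 1, shift g, by rw [shift_shift, pow_succ']; group⟩
      | succ k => exact ⟨k, l, g, by rw [pow_succ']; group⟩
    | succ i =>
      refine ⟨k, l, (x (i + k))⁻¹ * g, ?_⟩
      have e : (x (i + 1))⁻¹ * x 0 ^ k = x 0 ^ k * (x (i + k + 1))⁻¹ := by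
        rw [inv_mul_eq_iff_eq_mul, ← mul_assoc, x_mul_pow, mul_inv_cancel_right]
      rw [map_mul, map_inv, shift_x, ← mul_assoc, ← mul_assoc, e]
      group

/-- Vanishing of `deg₀` equates the two exponents of `x 0`, and vanishing of `deg` then puts `g` in
the kernel. -/
theorem exists_toCommutator_eq (h : commutator ThompsonF) : ∃ k g, toCommutator k g = h := by
  obtain ⟨h, hh⟩ := h
  obtain ⟨h1, h2⟩ := (mem_commutator_iff h).1 hh
  obtain ⟨k, l, g, rfl⟩ := exists_eq_conj_shift h
  simp only [map_mul, map_pow, map_inv, deg_x, deg₀_x, deg₀_shift, deg_shift, if_true, mul_one] at h1 h2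
  obtain rfl : k = l := by
    have := congrArg Multiplicative.toAdd h2
    simp at this
    omega
  refine ⟨k, ⟨g, ?_⟩, Subtype.ext rfl⟩
  rw [MonoidHom.mem_ker]
  rwa [mul_right_comm, mul_inv_cancel, one_mul] at h1

end ThompsonF

/-! ### Functoriality of the cohomology ring -/

namespace CohomologyRing

open groupCohomology

variable {G H : Type} [Group G] [Group H]

/-- The map induced by a homomorphism of groups on cohomology. -/
noncomputable def pullClass (φ : G →* H) (n : ℕ) : IntCohomology H n →+ IntCohomology G n :=
  descend ((cls n).comp (pullCocycle φ n)) fun f hf => by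
    rw [AddMonoidHom.comp_apply, cls_eq_zero_iff_isCoboundary]
    exact isCoboundary_pull φ hf

theorem pullClass_cls (φ : G →* H) (n : ℕ) (f : (delta (G := H) n).ker) :
    pullClass φ n (cls n f) = cls n (pullCocycle φ n f) := descend_cls _ _ f

/-- The additive map induced by a homomorphism of groups on the cohomology ring. -/
noncomputable def pullAux (φ : G →* H) : CohomologyRing H →+ CohomologyRing G :=
  DirectSum.toAddMonoid fun n => (of n).comp (pullClass φ n)

theorem pullAux_of (φ : G →* H) (n : ℕ) (f : (delta (G := H) n).ker) :
    pullAux φ (of n (cls n f)) = of n (cls n (pullCocycle φ n f)) :=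
  (DirectSum.toAddMonoid_of _ _ _).trans (congrArg (of n) (pullClass_cls φ n f))

/-- The ring homomorphism induced by a homomorphism of groups on cohomology. -/
noncomputable def pullRing (φ : G →* H) : CohomologyRing H →+* CohomologyRing G where
  __ := pullAux φ
  map_one' := pullAux_of φ 0 (oneCocycle H)
  map_mul' x y := by
    change pullAux φ (x * y) = pullAux φ x * pullAux φ y
    induction x using CohomologyRing.induction_on with
    | h0 => rw [zero_mul, map_zero, zero_mul]
    | hadd x x' h h' => rw [add_mul, map_add, map_add, add_mul, h, h']
    | hof n f =>
      induction y using CohomologyRing.induction_on with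
      | h0 => rw [mul_zero, map_zero, mul_zero]
      | hadd y y' h h' => rw [mul_add, map_add, map_add, mul_add, h, h']
      | hof m g =>
        rw [of_cls_mul rfl, pullAux_of, pullAux_of, pullAux_of, of_cls_mul rfl]
        rfl

theorem pullRing_of (φ : G →* H) (n : ℕ) (f : (delta (G := H) n).ker) :
    pullRing φ (of n (cls n f)) = of n (cls n (pullCocycle φ n f)) := pullAux_of φ n f

theorem pullRing_mem_grading (φ : G →* H) {n : ℕ} {x : CohomologyRing H} (hx : x ∈ grading H n) :
    pullRing φ x ∈ grading G n := by
  obtain ⟨x, rfl⟩ := hx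
  obtain ⟨f, rfl⟩ := cls_surjective n x
  rw [pullRing_of]
  exact ⟨_, rfl⟩

theorem pullRing_comp {K : Type} [Group K] (φ : G →* H) (ψ : H →* K) (x : CohomologyRing K) :
    pullRing φ (pullRing ψ x) = pullRing (ψ.comp φ) x := by
  induction x using CohomologyRing.induction_on with
  | h0 => simp only [map_zero]
  | hadd x y h h' => simp only [map_add, h, h']
  | hof n f => rw [pullRing_of, pullRing_of, pullRing_of]; rfl

theorem pullRing_id (x : CohomologyRing G) : pullRing (MonoidHom.id G) x = x := by
  induction x using CohomologyRing.induction_on with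
  | h0 => simp only [map_zero]
  | hadd x y h h' => simp only [map_add, h, h']
  | hof n f => rw [pullRing_of]; rfl

theorem of_cls_eq_zero {n : ℕ} {f : (delta (G := G) n).ker} (h : IsCoboundary n f.1) :
    of n (cls n f) = 0 := by
  rw [(cls_eq_zero_iff_isCoboundary n f).2 h, map_zero]

end CohomologyRing

/-! ### Cohomology of the kernel of the degree and of the commutator subgroup -/

namespace ThompsonF

open groupCohomology CohomologyRing

theorem torusEval_fin_zero {G : Type} [Group G] (t : Fin 0 → G) (f : IntCochain G 0) :
    torusEval t f = f t := by
  rw [torusEval_apply, Fintype.sum_unique]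
  simp

theorem isCoboundary_of_torusEval_zero {G : Type} [Group G] {t : Fin 0 → G} {f : IntCochain G 0}
    (h : torusEval t f = 0) : IsCoboundary 0 f := by
  rw [torusEval_fin_zero] at h
  exact funext fun y => (congrArg f (Subsingleton.elim _ _)).trans h

section degKer
variable {e₀ : Bool} {k n : ℕ} (hn : e₀.toNat + 2 * k + false.toNat = n)
include hn

/-- The tori in the kernel of the degree. -/
def kerTorus (c : ℕ) (i : Fin n) : degKer :=
  ⟨letter c k (dualIndex e₀ k n i), by
    have h : dualIndex e₀ k n i ≠ 1 := by
      have := i.2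
      rw [dualIndex]
      simp only [Bool.toNat_false] at hn
      split_ifs <;> omega
    have := deg_letter c k (dualIndex e₀ k n i)
    rw [if_neg h] at this
    exact this⟩

theorem commute_kerTorus (c : ℕ) (i j : Fin n) : Commute (kerTorus hn c i) (kerTorus hn c j) :=
  Subtype.ext (commute_letter _ _ _ _)

theorem torusEval_kerTorus (c : ℕ) : torusEval (kerTorus hn c)
    (pull degKer.subtype n (mixedCocycle e₀ k false hn).1) = (-1) ^ k := by
  rw [torusEval_pull]
  refine (torusEval_mixedCocycle c hn hn).trans (if_pos ⟨rfl, rfl, rfl⟩)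

/-- In positive degree the group is cyclic and one of its elements evaluates to ±1, so evaluation on
this torus is injective. -/
theorem isCoboundary_of_kerTorus (c : ℕ) {f : IntCochain degKer n} (hf : delta n f = 0)
    (h : torusEval (kerTorus hn c) f = 0) : IsCoboundary n f := by
  cases n with
  | zero => exact isCoboundary_of_torusEval_zero h
  | succ n =>
    obtain ⟨g, hg⟩ := exists_generator_degKer n
    let ε := torusEvalClass (kerTorus hn c) (commute_kerTorus hn c)
    obtain ⟨m, hm⟩ := hg (cls _ ⟨f, hf⟩)
    obtain ⟨m', hm'⟩ := hg (cls _ (pullCocycle degKer.subtype _ (mixedCocycle e₀ k false hn)))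
    have h1 : m * ε g = 0 := by
      rw [← smul_eq_mul, ← map_zsmul, ← hm]
      exact (torusEvalClass_cls _ _ _).trans h
    have h2 : m' * ε g = (-1) ^ k := by
      rw [← smul_eq_mul, ← map_zsmul, ← hm']
      exact (torusEvalClass_cls _ _ _).trans (torusEval_kerTorus hn c)
    have h3 : m = 0 := (mul_eq_zero.1 h1).resolve_right fun h0 => by
      rw [h0, mul_zero] at h2
      exact pow_ne_zero k (by norm_num) h2.symm
    rw [h3, zero_smul] at hm
    exact (cls_eq_zero_iff_isCoboundary _ _).1 hm

theorem isCoboundary_sub_mixedCocycle (c : ℕ) {f : IntCochain degKer n} (hf : delta n f = 0) :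
    IsCoboundary n (f - ((-1) ^ k * torusEval (kerTorus hn c) f) •
      pull degKer.subtype n (mixedCocycle e₀ k false hn).1) := by
  refine isCoboundary_of_kerTorus hn c ?_ ?_
  · rw [map_sub, map_zsmul, delta_pull, show delta n (mixedCocycle e₀ k false hn).1 = 0 from
      (mixedCocycle e₀ k false hn).2, map_zero, smul_zero, hf, sub_zero]
  · rw [map_sub, map_zsmul, torusEval_kerTorus, smul_eq_mul]
    have : (-1 : ℤ) ^ k * (-1) ^ k = 1 := by rw [← mul_pow]; simp
    linear_combination -torusEval (kerTorus hn c) f * this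

/-- Every class is a multiple of a mixed one, whose value does not depend on the position `c` of the
torus. -/
theorem torusEval_kerTorus_eq (c : ℕ) {f : IntCochain degKer n} (hf : delta n f = 0) :
    torusEval (kerTorus hn c) f = torusEval (kerTorus hn 0) f := by
  have := torusEval_of_isCoboundary _ (commute_kerTorus hn c) (isCoboundary_sub_mixedCocycle hn 0 hf)
  rw [map_sub, map_zsmul, torusEval_kerTorus, smul_eq_mul] at this
  have h : (-1 : ℤ) ^ k * (-1) ^ k = 1 := by rw [← mul_pow]; simp
  linear_combination this + torusEval (kerTorus hn 0) f * h

end degKer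

theorem shift_letter (c K j : ℕ) (hj : j ≠ 0) : shift (letter c K j) = letter (c + 1) K j := by
  match j with
  | 1 => simp [letter]; rfl
  | j + 2 =>
    simp only [letter]
    split_ifs
    · exact shift_bmp _
    · exact map_one _

theorem dualIndex_false_ne_zero (k n : ℕ) (i : Fin n) : dualIndex false k n i ≠ 0 := by
  rw [dualIndex, if_neg (by simp)]
  split_ifs <;> omega

/-- The shift acts as the identity on the cohomology of even degree of the kernel of the degree. -/
theorem isCoboundary_pull_shiftKer_sub {k : ℕ} {f : IntCochain degKer (2 * k)} (hf : delta (2 * k) f = 0) :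
    IsCoboundary (2 * k) (pull shiftKer (2 * k) f - f) := by
  have hn : false.toNat + 2 * k + false.toNat = 2 * k := by simp
  refine isCoboundary_of_kerTorus hn 0 ?_ ?_
  · rw [map_sub, delta_pull, hf, map_zero, sub_zero]
  -- The shift carries the torus with offset 0 to that with offset 1. In even degree the letter 0,
  -- which does not shift this way, is absent.
  · rw [map_sub, torusEval_pull, sub_eq_zero, ← torusEval_kerTorus_eq hn 1 hf]
    refine congrArg (fun t => torusEval t f) (funext fun i => Subtype.ext ?_)
    exact shift_letter _ _ _ (dualIndex_false_ne_zero _ _ _)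

/-- The shift acts as zero on the cohomology of odd degree of the kernel of the degree. -/
theorem isCoboundary_pull_shiftKer {k : ℕ} {f : IntCochain degKer (2 * k + 1)}
    (hf : delta (2 * k + 1) f = 0) : IsCoboundary (2 * k + 1) (pull shiftKer (2 * k + 1) f) := by
  have hn : true.toNat + 2 * k + false.toNat = 2 * k + 1 := by simp; ring
  -- The generator in odd degree has the factor `deg₀`, which dies on the image of the shift.
  have h0 : pull shiftKer (2 * k + 1) (pull degKer.subtype (2 * k + 1)
      (mixedCocycle true k false hn).1) = 0 := by
    refine funext fun y => ?_
    rw [pull_apply, pull_apply, mixedCocycle_apply]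
    refine mul_eq_zero_of_left (mul_eq_zero_of_left ?_ _) _
    change (deg₀ (shift _)).toAdd = 0
    rw [deg₀_shift, toAdd_one]
  have := isCoboundary_pull shiftKer (isCoboundary_sub_mixedCocycle hn 0 hf)
  rwa [map_sub, map_zsmul, h0, smul_zero, sub_zero] at this

theorem pull_toCommutator_succ (k : ℕ) {n : ℕ} (f : IntCochain (commutator ThompsonF) n) :
    pull shiftKer n (pull (toCommutator (k + 1)) n f) = pull (toCommutator k) n f :=
  funext fun y => congrArg f (funext fun i => toCommutator_succ k (y i))

theorem isCoboundary_commutator_odd {k : ℕ} {f : IntCochain (commutator ThompsonF) (2 * k + 1)}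
    (hf : delta (2 * k + 1) f = 0) : IsCoboundary (2 * k + 1) f := by
  refine isCoboundary_of_telescope toCommutator_succ exists_toCommutator_eq toCommutator_injective
    (fun c => ⟨c, ?_⟩) f fun l => ?_
  -- Mittag-Leffler in even degree: the shift is the identity there, so `c' = c` works.
  · rw [← map_sub, ← neg_sub, map_neg, map_sub, ← map_sub]
    exact isCoboundary_neg (isCoboundary_pull _ (isCoboundary_pull_shiftKer_sub c.2))
  -- Each restriction to a stage factors through the shift, which is zero in odd degree.
  · rw [← pull_toCommutator_succ]
    refine isCoboundary_pull_shiftKer ?_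
    rw [delta_pull, hf, map_zero]

/-- The tori in the commutator subgroup. -/
def commTorus (k : ℕ) (i : Fin (2 * k)) : commutator ThompsonF :=
  toCommutator 0 (kerTorus (e₀ := false) (k := k) (by simp) 0 i)

theorem commute_commTorus (k : ℕ) (i j : Fin (2 * k)) : Commute (commTorus k i) (commTorus k j) :=
  (commute_kerTorus _ _ _ _).map (toCommutator 0)

/-- The shift is the identity in even degree, so a class vanishing on stage 0 vanishes on all
stages; and there is no lim¹ from odd degree. -/
theorem isCoboundary_of_commTorus {k : ℕ} {f : IntCochain (commutator ThompsonF) (2 * k)}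
    (hf : delta (2 * k) f = 0) (h : torusEval (commTorus k) f = 0) : IsCoboundary (2 * k) f := by
  cases k with
  | zero => exact isCoboundary_of_torusEval_zero h
  | succ k =>
    refine isCoboundary_of_telescope toCommutator_succ exists_toCommutator_eq toCommutator_injective
      (n := 2 * k + 1) (fun c => ⟨0, ?_⟩) f fun l => ?_
    -- Mittag-Leffler in odd degree: the shift is zero there, so `c' = 0` works.
    · refine isCoboundary_sub (isCoboundary_pull_shiftKer c.2) ?_
      rw [AddSubgroup.coe_zero, map_zero, map_zero]
      exact isCoboundary_zero _
    · have hl (l : ℕ) : delta (2 * (k + 1)) (pull (toCommutator l) (2 * (k + 1)) f) = 0 := by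
        rw [delta_pull, hf, map_zero]
      induction l with
      | zero => exact isCoboundary_of_kerTorus (e₀ := false) (k := k + 1) (by simp; ring) 0 (hl 0) h
      | succ l ih =>
        have := isCoboundary_pull_shiftKer_sub (hl (l + 1))
        rw [pull_toCommutator_succ] at this
        exact (congrArg (IsCoboundary _) (sub_sub_cancel _ _)).mp (isCoboundary_sub ih this)

theorem torusEval_commTorus (k : ℕ) : torusEval (commTorus k)
    (pull (commutator ThompsonF).subtype (2 * k) (gvCocycle k).1) = (-1) ^ k := by
  have hn : false.toNat + 2 * k + false.toNat = 2 * k := by simp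
  have h0 : (mixedCocycle false k false hn).1 = (gvCocycle k).1 := by
    refine funext fun y => (mixedCocycle_apply _ _ _ _ _).trans ?_
    simp only [optCocycle, oneCocycle, one_mul, mul_one]
    exact congrArg _ (funext fun i => congrArg y (Fin.ext (by simp)))
  -- Stage 0 embeds by the shift, so the torus appears in F with offset 1.
  rw [torusEval_pull, ← h0, ← (torusEval_mixedCocycle 1 hn hn).trans (if_pos ⟨rfl, rfl, rfl⟩)]
  refine congrArg (fun t => torusEval t (mixedCocycle false k false hn).1) (funext fun i => ?_)
  refine (coe_toCommutator 0 _).trans ?_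
  rw [pow_zero, one_mul, inv_one, mul_one]
  exact shift_letter _ _ _ (dualIndex_false_ne_zero _ _ _)

/-- The restriction of `gvClass k` to the commutator subgroup. -/
noncomputable def commClass (k : ℕ) : CohomologyRing (commutator ThompsonF) :=
  pullRing (commutator ThompsonF).subtype (gvClass k)

theorem commClass_eq (k : ℕ) : commClass k = of (2 * k)
    (cls (2 * k) (pullCocycle (commutator ThompsonF).subtype (2 * k) (gvCocycle k))) :=
  pullRing_of _ _ _

/-- The evaluation on the torus dual to `commClass k`. -/
noncomputable def commEval (k : ℕ) : CohomologyRing (commutator ThompsonF) →+ ℤ :=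
  (torusEvalClass (commTorus k) (commute_commTorus k)).comp (proj (2 * k))

theorem commEval_of (k : ℕ) (f : (delta (G := commutator ThompsonF) (2 * k)).ker) :
    commEval k (of (2 * k) (cls (2 * k) f)) = torusEval (commTorus k) f.1 := by
  rw [commEval, AddMonoidHom.comp_apply, proj_of_same, torusEvalClass_cls]

theorem commEval_commClass (k l : ℕ) : commEval k (commClass l) = if k = l then (-1) ^ k else 0 := by
  rw [commClass_eq]
  split_ifs with h
  · subst h
    rw [commEval_of]
    exact torusEval_commTorus k
  · rw [commEval, AddMonoidHom.comp_apply, proj_of_ne (by omega), map_zero]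

theorem span_commClass : Submodule.span ℤ (Set.range commClass) = ⊤ := by
  refine eq_top_iff.2 fun x _ => ?_
  induction x using CohomologyRing.induction_on with
  | h0 => exact Submodule.zero_mem _
  | hadd x y hx hy => exact Submodule.add_mem _ (hx trivial) (hy trivial)
  | hof n f =>
    rcases Nat.even_or_odd' n with ⟨k, rfl | rfl⟩
    · have : of (2 * k) (cls (2 * k) f) =
          ((-1) ^ k * torusEval (commTorus k) f.1) • commClass k := by
        rw [← sub_eq_zero, commClass_eq, ← map_zsmul, ← map_zsmul, ← map_sub, ← map_sub]
        refine of_cls_eq_zero (isCoboundary_of_commTorus (AddMonoidHom.mem_ker.1 (Subtype.prop _)) ?_)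
        have h : (-1 : ℤ) ^ k * (-1) ^ k = 1 := by rw [← mul_pow]; simp
        rw [AddSubgroup.coe_sub, AddSubgroup.coe_zsmul, map_sub, map_zsmul]
        refine (congrArg (fun z => torusEval (commTorus k) f.1 -
          ((-1) ^ k * torusEval (commTorus k) f.1) • z) (torusEval_commTorus k)).trans ?_
        rw [smul_eq_mul]
        linear_combination -torusEval (commTorus k) f.1 * h
      rw [this]
      exact Submodule.smul_mem _ _ (Submodule.subset_span ⟨_, rfl⟩)
    · rw [of_cls_eq_zero (isCoboundary_commutator_odd f.2)]
      exact Submodule.zero_mem _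

/-- The additive basis of the cohomology ring of the commutator subgroup. -/
noncomputable def commBasis : Module.Basis ℕ ℤ (CohomologyRing (commutator ThompsonF)) :=
  Module.Basis.mk (linearIndependent_of_dual commClass commEval (fun k => (-1) ^ k) (by simp)
    commEval_commClass) span_commClass.ge

theorem commBasis_apply (k : ℕ) : commBasis k = commClass k := Module.Basis.mk_apply _ _ _

theorem commClass_mul (i j : ℕ) : commClass i * commClass j = (i + j).choose i • commClass (i + j) := by
  rw [commClass, commClass, ← map_mul, gvClass_mul, map_nsmul, commClass]

end ThompsonF

/-! ### Cohomology of the abelianization -/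

/-- The monomials in two anticommuting elements of square zero. -/
def extMonomial {R : Type*} [Ring R] (a b : R) (e : Bool × Bool) : R :=
  (if e.1 then a else 1) * (if e.2 then b else 1)

/-- The structure constants of the exterior algebra on two generators. -/
def extCoeff (e f : Bool × Bool) : ℤ :=
  if (e.1 && f.1) || (e.2 && f.2) then 0 else if e.2 && f.1 then -1 else 1

theorem extMonomial_mul {R : Type*} [Ring R] {a b : R} (ha : a * a = 0) (hb : b * b = 0)
    (hab : b * a = -(a * b)) (e f : Bool × Bool) : extMonomial a b e * extMonomial a b f =
      extCoeff e f • extMonomial a b (e.1 || f.1, e.2 || f.2) := by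
  have h1 : a * (a * b) = 0 := by rw [← mul_assoc, ha, zero_mul]
  have h2 : a * b * a = 0 := by rw [mul_assoc, hab, mul_neg, h1, neg_zero]
  have h3 : a * b * b = 0 := by rw [mul_assoc, hb, mul_zero]
  have h4 : b * (a * b) = 0 := by rw [← mul_assoc, hab, neg_mul, h3, neg_zero]
  have h5 : a * b * (a * b) = 0 := by rw [← mul_assoc, h2, zero_mul]
  obtain ⟨e₀, e₁⟩ := e
  obtain ⟨f₀, f₁⟩ := f
  cases e₀ <;> cases e₁ <;> cases f₀ <;> cases f₁ <;> simp [extMonomial, extCoeff, *]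

theorem map_extMonomial {R S : Type*} [Ring R] [Ring S] (φ : R →+* S) (a b : R) (e : Bool × Bool) :
    φ (extMonomial a b e) = extMonomial (φ a) (φ b) e := by
  obtain ⟨e₀, e₁⟩ := e
  cases e₀ <;> cases e₁ <;> simp [extMonomial]

namespace ThompsonF

open groupCohomology CohomologyRing

theorem pullRing_homClass {G H : Type} [Group G] [Group H] (φ : G →* H) (ψ : H →* Multiplicative ℤ) :
    pullRing φ (homClass ψ) = homClass (ψ.comp φ) := pullRing_of _ _ _

theorem mixedClass_eq_extMonomial (I : Idx) :
    mixedClass I = gvClass I.1 * extMonomial (homClass deg₀) (homClass deg) I.2 := by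
  rw [mixedClass_eq_mul, extMonomial, ← mul_assoc]
  congr 1
  split_ifs
  · exact homClass_mul_gvClass _ _
  · rw [one_mul, mul_one]

/-- The endomorphism with commutative image inducing the identity on the abelianization. -/
def retraction : ThompsonF →* ThompsonF where
  toFun g := bmp 0 ^ (deg₀ g).toAdd * x 2 ^ (deg g).toAdd
  map_one' := by simp
  map_mul' g h := by
    have : Commute (x 2 ^ (deg g).toAdd) (bmp 0 ^ (deg₀ h).toAdd) :=
      (commute_x_bmp (i := 0) (n := 2) le_rfl).zpow_zpow _ _
    rw [map_mul deg₀, map_mul deg, toAdd_mul, toAdd_mul, zpow_add, zpow_add, mul_assoc, mul_assoc,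
      ← mul_assoc (bmp 0 ^ (deg₀ h).toAdd), ← this.eq, mul_assoc]

theorem retraction_apply (g : ThompsonF) :
    retraction g = bmp 0 ^ (deg₀ g).toAdd * x 2 ^ (deg g).toAdd := rfl

/-- A section of the projection to the abelianization. -/
def abSection : Abelianization ThompsonF →* ThompsonF :=
  QuotientGroup.lift (commutator ThompsonF) retraction fun g hg => by
    obtain ⟨h1, h2⟩ := (mem_commutator_iff g).1 hg
    rw [MonoidHom.mem_ker, retraction_apply, h1, h2]
    simp

theorem of_comp_abSection : Abelianization.of.comp abSection = MonoidHom.id (Abelianization ThompsonF) := by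
  refine Abelianization.hom_ext _ _ (MonoidHom.ext fun g => ?_)
  change Abelianization.of (retraction g) = Abelianization.of g
  rw [abelianization_of_eq g, retraction_apply, bmp]
  simp only [map_mul, map_zpow, map_inv, abelianization_of_x 1, mul_zpow, inv_zpow, zpow_sub, zero_add]
  rw [mul_assoc, mul_comm (Abelianization.of (x 1) ^ (deg g).toAdd)]

theorem deg₀_comp_retraction : deg₀.comp retraction = deg₀ := by
  refine MonoidHom.ext fun g => ?_
  rw [MonoidHom.comp_apply, retraction_apply, map_mul, map_zpow, map_zpow, deg₀_bmp_zero]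
  apply Multiplicative.toAdd.injective
  simp

theorem deg_comp_retraction : deg.comp retraction = deg := by
  refine MonoidHom.ext fun g => ?_
  rw [MonoidHom.comp_apply, retraction_apply, map_mul, map_zpow, map_zpow, deg_bmp]
  apply Multiplicative.toAdd.injective
  simp

/-- The basis of the cohomology ring of the abelianization. -/
noncomputable def abClass (e : Bool × Bool) : CohomologyRing (Abelianization ThompsonF) :=
  extMonomial (pullRing abSection (homClass deg₀)) (pullRing abSection (homClass deg)) e

theorem pullRing_abSection_mixedClass (e : Bool × Bool) :
    pullRing abSection (mixedClass (0, e)) = abClass e := by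
  rw [mixedClass_eq_extMonomial, gvClass_zero, one_mul, map_extMonomial, abClass]

theorem pullRing_of_abClass (e : Bool × Bool) :
    pullRing Abelianization.of (abClass e) = mixedClass (0, e) := by
  rw [abClass, map_extMonomial, pullRing_comp, pullRing_comp, pullRing_homClass, pullRing_homClass,
    mixedClass_eq_extMonomial, gvClass_zero, one_mul,
    show abSection.comp Abelianization.of = retraction from rfl,
    deg₀_comp_retraction, deg_comp_retraction]

theorem mixedBasis_repr (x : CohomologyRing ThompsonF) (I : Idx) :
    mixedBasis.repr x I = (-1) ^ I.1 * dualEval I x := by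
  conv_rhs => rw [← mixedBasis.linearCombination_repr x, Finsupp.linearCombination_apply, Finsupp.sum,
    map_sum]
  simp only [map_zsmul, mixedBasis_apply, dualEval_mixedClass, smul_eq_mul, mul_ite, mul_zero,
    Finset.sum_ite_eq]
  have : (-1 : ℤ) ^ I.1 * (-1) ^ I.1 = 1 := by rw [← mul_pow]; simp
  split_ifs with h
  · linear_combination -mixedBasis.repr x I * this
  · simpa using h

/-- A pair of letters consists of two bumps that die in the abelianization, so the image torus has a
repeated entry and carries no class. -/
theorem dualEval_pullRing_of (I : Idx) (hI : I.1 ≠ 0) (x : CohomologyRing (Abelianization ThompsonF)) :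
    dualEval I (pullRing Abelianization.of x) = 0 := by
  induction x using CohomologyRing.induction_on with
  | h0 => simp only [map_zero]
  | hadd x y h h' => rw [map_add, map_add, h, h', add_zero]
  | hof n f =>
    rw [pullRing_of]
    by_cases hn : I.degree = n
    · rw [dualEval_of_cls hn]
      have hlt : I.2.1.toNat + 2 * I.1 ≤ n := by
        have := Idx.degree_eq hn
        omega
      refine (torusEval_pull _ _ _).trans (torusEval_eq_zero_of_eq _
        (i := ⟨I.2.1.toNat, by omega⟩) (j := ⟨I.2.1.toNat + 1, by omega⟩) (by simp) ?_ _)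
      have h (i : ℕ) : Abelianization.of (bmp (i + 1)) = 1 := by
        rw [bmp, map_mul, map_inv, abelianization_of_x i, abelianization_of_x (i + 1), mul_inv_cancel]
      have h0 : dualIndex I.2.1 I.1 n ⟨I.2.1.toNat, by omega⟩ = 2 := by
        rw [dualIndex, if_neg (by simp), if_pos (by simp; omega)]
        simp
      have h1 : dualIndex I.2.1 I.1 n ⟨I.2.1.toNat + 1, by omega⟩ = 3 := by
        rw [dualIndex, if_neg (by simp), if_pos (by simp; omega)]
        simp
      rw [h0, h1, letter, letter, if_pos (by omega), if_pos (by omega)]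
      exact (h _).trans (h _).symm
    · exact dualEval_of_ne (Ne.symm hn) _

/-- Pulling back to F and then along the section is the identity, and only basis elements without
divided powers occur in between. -/
theorem span_abClass : Submodule.span ℤ (Set.range abClass) = ⊤ := by
  refine eq_top_iff.2 fun y _ => ?_
  have : y = pullRing abSection (pullRing Abelianization.of y) := by
    rw [pullRing_comp, of_comp_abSection, pullRing_id]
  rw [this, ← mixedBasis.linearCombination_repr (pullRing Abelianization.of y),
    Finsupp.linearCombination_apply, Finsupp.sum, map_sum]
  refine Submodule.sum_mem _ fun I hI => ?_
  have h0 : I.1 = 0 := by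
    by_contra h
    rw [Finsupp.mem_support_iff, mixedBasis_repr, dualEval_pullRing_of I h, mul_zero] at hI
    exact hI rfl
  obtain ⟨k, e⟩ := I
  obtain rfl : k = 0 := h0
  rw [map_zsmul, mixedBasis_apply, pullRing_abSection_mixedClass]
  exact Submodule.smul_mem _ _ (Submodule.subset_span ⟨_, rfl⟩)

/-- The additive basis of the cohomology ring of the abelianization. -/
noncomputable def abBasis : Module.Basis (Bool × Bool) ℤ (CohomologyRing (Abelianization ThompsonF)) :=
  Module.Basis.mk (linearIndependent_of_dual abClass (fun e => (dualEval (0, e)).comp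
    (pullRing Abelianization.of).toAddMonoidHom) (fun _ => 1) (by simp) fun e f => by
      refine (congrArg (dualEval (0, e)) (pullRing_of_abClass f)).trans ?_
      rw [dualEval_mixedClass]
      simp) span_abClass.ge

theorem abBasis_apply (e : Bool × Bool) : abBasis e = abClass e := Module.Basis.mk_apply _ _ _

theorem abClass_mul (e f : Bool × Bool) :
    abClass e * abClass f = extCoeff e f • abClass (e.1 || f.1, e.2 || f.2) := by
  refine extMonomial_mul ?_ ?_ ?_ e f
  · rw [← map_mul, homClass_mul_self, map_zero]
  · rw [← map_mul, homClass_mul_self, map_zero]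
  · rw [← map_mul, homClass_mul_homClass, map_neg, map_mul]

theorem mixedClass_mul (I J : Idx) : mixedClass I * mixedClass J =
    (((I.1 + J.1).choose I.1 : ℤ) * extCoeff I.2 J.2) •
      mixedClass (I.1 + J.1, (I.2.1 || J.2.1, I.2.2 || J.2.2)) := by
  have hc (k : ℕ) (e : Bool × Bool) :
      Commute (extMonomial (homClass deg₀) (homClass deg) e) (gvClass k) := by
    refine Commute.mul_left ?_ ?_
    · split_ifs
      · exact homClass_mul_gvClass _ _
      · exact Commute.one_left _
    · split_ifs
      · exact homClass_mul_gvClass _ _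
      · exact Commute.one_left _
  rw [mixedClass_eq_extMonomial, mixedClass_eq_extMonomial, mixedClass_eq_extMonomial, mul_assoc,
    ← mul_assoc _ (gvClass J.1), (hc _ _).eq, mul_assoc, ← mul_assoc, gvClass_mul,
    extMonomial_mul (homClass_mul_self _) (homClass_mul_self _) (homClass_mul_homClass _ _),
    ← natCast_zsmul, smul_mul_smul_comm]

end ThompsonF

/-! ### Graded rings with bases and structure constants -/

/-- An additive basis, consisting of homogeneous elements, of a graded ring, whose products are
multiples of basis elements. -/
structure GradedBasis {R A ι : Type*} [CommRing R] [Ring A] [Algebra R A] (𝒜 : ℕ → Submodule R A) (d : ι → ℕ)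
    (m : ι → ι → ℤ) (p : ι → ι → ι) where
  /-- The basis. -/
  basis : Module.Basis ι R A
  mul (i j : ι) : basis i * basis j = (m i j : A) * basis (p i j)
  span (n : ℕ) : 𝒜 n = Submodule.span R (basis '' {i | d i = n})

namespace GradedBasis

variable {R A B ι κ : Type*} [CommRing R] [Ring A] [Algebra R A] [Ring B] [Algebra R B]
  {𝒜 : ℕ → Submodule R A} {ℬ : ℕ → Submodule R B}

/-- A basis of homogeneous elements, in a graded algebra. -/
def ofMem [GradedAlgebra 𝒜] {d : ι → ℕ} {m : ι → ι → ℤ} {p : ι → ι → ι} (b : Module.Basis ι R A)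
    (hmul : ∀ i j, b i * b j = (m i j : A) * b (p i j)) (hmem : ∀ i, b i ∈ 𝒜 (d i)) :
    GradedBasis 𝒜 d m p where
  basis := b
  mul := hmul
  span n := by
    apply le_antisymm
    · have h : (⊤ : Submodule R A).map (GradedAlgebra.proj 𝒜 n) ≤
          Submodule.span R (b '' {i | d i = n}) := by
        rw [← b.span_eq, Submodule.map_span_le]
        rintro _ ⟨i, rfl⟩
        rw [GradedAlgebra.proj_apply]
        by_cases hi : d i = n
        · rw [DirectSum.decompose_of_mem_same 𝒜 (hi ▸ hmem i)]
          exact Submodule.subset_span ⟨i, hi, rfl⟩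
        · rw [DirectSum.decompose_of_mem_ne 𝒜 (hmem i) hi]
          exact Submodule.zero_mem _
      intro x hx
      have := h (Submodule.mem_map_of_mem (Submodule.mem_top (x := x)))
      rwa [GradedAlgebra.proj_apply, DirectSum.decompose_of_mem_same 𝒜 hx] at this
    · rw [Submodule.span_le]
      rintro _ ⟨i, rfl, rfl⟩
      exact hmem i

variable {d : ι → ℕ} {m : ι → ι → ℤ} {p : ι → ι → ι}

theorem mem (b : GradedBasis 𝒜 d m p) (i : ι) : b.basis i ∈ 𝒜 (d i) := by
  rw [b.span]
  exact Submodule.subset_span ⟨i, rfl, rfl⟩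

/-- Graded rings with corresponding bases are isomorphic. -/
theorem exists_ringEquiv (b : GradedBasis 𝒜 d m p) (c : GradedBasis ℬ d m p) :
    ∃ e : A ≃+* B, ∀ n x, e x ∈ ℬ n ↔ x ∈ 𝒜 n := by
  let e : A ≃ₗ[R] B := b.basis.equiv c.basis (Equiv.refl ι)
  have he (i : ι) : e (b.basis i) = c.basis i := by
    simp [e, Module.Basis.equiv_apply]
  -- Both sides are bilinear, so equal structure constants give multiplicativity.
  have hmul : (LinearMap.mul R A).compr₂ e.toLinearMap =
      (LinearMap.mul R B).compl₁₂ e.toLinearMap e.toLinearMap := by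
    refine b.basis.ext fun i => b.basis.ext fun j => ?_
    simp only [LinearMap.compr₂_apply, LinearMap.mul_apply', LinearMap.compl₁₂_apply,
      LinearEquiv.coe_coe, he, b.mul, c.mul, ← zsmul_eq_mul, map_zsmul]
  refine ⟨{ e with map_mul' := fun x y => LinearMap.congr_fun₂ hmul x y }, fun n x => ?_⟩
  change e x ∈ ℬ n ↔ _
  have hs : ℬ n = (𝒜 n).map e.toLinearMap := by
    rw [b.span, c.span, Submodule.map_span, ← Set.image_comp]
    congr 1
    exact Set.image_congr fun i _ => (he i).symm
  rw [hs]
  exact ⟨fun ⟨y, hy, hyx⟩ => e.injective hyx ▸ hy, fun hx => ⟨x, hx, rfl⟩⟩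

theorem zsmul_tmul [GradedAlgebra 𝒜] [GradedAlgebra ℬ] (k l : ℤ) (x : A) (y : B) :
    ((k : A) * x) ᵍ⊗ₜ[R] ((l : B) * y) =
      (((k * l : ℤ) : 𝒜 ᵍ⊗[R] ℬ)) * (x ᵍ⊗ₜ[R] y : 𝒜 ᵍ⊗[R] ℬ) := by
  have h1 (y : B) : (k • x) ᵍ⊗ₜ[R] y = k • (x ᵍ⊗ₜ[R] y : 𝒜 ᵍ⊗[R] ℬ) :=
    map_zsmul ((GradedTensorProduct.of R 𝒜 ℬ).toLinearMap ∘ₗ (TensorProduct.mk R A B).flip y) k x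
  have h2 : x ᵍ⊗ₜ[R] (l • y) = l • (x ᵍ⊗ₜ[R] y : 𝒜 ᵍ⊗[R] ℬ) :=
    map_zsmul ((GradedTensorProduct.of R 𝒜 ℬ).toLinearMap ∘ₗ TensorProduct.mk R A B x) l y
  rw [← zsmul_eq_mul, ← zsmul_eq_mul, ← zsmul_eq_mul, h1, h2, smul_smul]

/-- The basis of a tensor product, if the degrees in the first factor are even. -/
noncomputable def tensor [GradedAlgebra 𝒜] [GradedAlgebra ℬ] {d' : κ → ℕ} {m' : κ → κ → ℤ}
    {p' : κ → κ → κ} (b : GradedBasis 𝒜 d m p) (c : GradedBasis ℬ d' m' p') (hd : ∀ i, Even (d i)) :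
    GradedBasis (tensorGrading 𝒜 ℬ) (fun i : ι × κ => d i.1 + d' i.2)
      (fun i j => m i.1 j.1 * m' i.2 j.2) (fun i j => (p i.1 j.1, p' i.2 j.2)) where
  basis := (b.basis.tensorProduct c.basis).map (GradedTensorProduct.of R 𝒜 ℬ)
  mul i j := by
    simp only [Module.Basis.map_apply, Module.Basis.tensorProduct_apply']
    refine (GradedTensorProduct.tmul_coe_mul_coe_tmul 𝒜 ℬ (b.basis i.1) ⟨_, c.mem i.2⟩
      ⟨_, b.mem j.1⟩ (c.basis j.2)).trans ?_
    -- The Koszul sign disappears because the first factor lives in even degrees.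
    have : (-1 : ℤˣ) ^ (d' i.2 * d j.1) = 1 := Even.neg_one_pow ((hd j.1).mul_left _)
    rw [this, one_smul, b.mul, c.mul, zsmul_tmul]
  span n := by
    apply le_antisymm
    · rw [tensorGrading, Submodule.span_le]
      rintro _ ⟨i, j, rfl, x, hx, y, hy, rfl⟩
      rw [b.span] at hx
      rw [c.span] at hy
      have := Submodule.apply_mem_map₂ ((TensorProduct.mk R A B).compr₂
        (GradedTensorProduct.of R 𝒜 ℬ).toLinearMap) hx hy
      rw [Submodule.map₂_span_span] at this
      refine Submodule.span_mono ?_ this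
      rintro _ ⟨_, ⟨s, rfl, rfl⟩, _, ⟨t, rfl, rfl⟩, rfl⟩
      exact ⟨(s, t), rfl, by simp⟩
    · rw [Submodule.span_le]
      rintro _ ⟨⟨s, t⟩, rfl, rfl⟩
      exact Submodule.subset_span ⟨_, _, rfl, _, b.mem s, _, c.mem t, by simp⟩

end GradedBasis

/-! ### The bases of all rings involved, and the theorem -/

/-- The degrees of the monomials in two elements of degree `1`. -/
def extDegree (e : Bool × Bool) : ℕ := e.1.toNat + e.2.toNat

namespace ThompsonF

open groupCohomology CohomologyRing

/-- The divided powers are a basis of the cohomology of the commutator subgroup. -/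
noncomputable def commGradedBasis : GradedBasis (CohomologyRing.grading (commutator ThompsonF))
    (fun k : ℕ => 2 * k) (fun i j => ((i + j).choose i : ℤ)) (· + ·) :=
  .ofMem commBasis (fun i j => by
    simp only [commBasis_apply]
    rw [commClass_mul, nsmul_eq_mul, Int.cast_natCast]) fun i => by
      rw [commBasis_apply, commClass_eq]
      exact ⟨_, rfl⟩

/-- The monomials are a basis of the cohomology of the abelianization. -/
noncomputable def abGradedBasis : GradedBasis (CohomologyRing.grading (Abelianization ThompsonF))
    extDegree extCoeff (fun e f => (e.1 || f.1, e.2 || f.2)) :=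
  .ofMem abBasis (fun i j => by
    simp only [abBasis_apply]
    rw [abClass_mul, zsmul_eq_mul]) fun e => by
      rw [abBasis_apply, ← pullRing_abSection_mixedClass]
      refine pullRing_mem_grading _ ?_
      have : extDegree e = Idx.degree (0, e) := by simp [extDegree, Idx.degree]
      rw [this]
      exact ⟨_, rfl⟩

/-- The products of divided powers and monomials are a basis of the cohomology of `F`. -/
noncomputable def mixedGradedBasis : GradedBasis (CohomologyRing.grading ThompsonF)
    (fun I : Idx => 2 * I.1 + extDegree I.2)
    (fun I J => ((I.1 + J.1).choose I.1 : ℤ) * extCoeff I.2 J.2)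
    (fun I J => (I.1 + J.1, (I.2.1 || J.2.1, I.2.2 || J.2.2))) :=
  .ofMem mixedBasis (fun I J => by
    simp only [mixedBasis_apply]
    rw [mixedClass_mul, zsmul_eq_mul]) fun I => by
      have : 2 * I.1 + extDegree I.2 = I.degree := by simp only [extDegree, Idx.degree]; ring
      rw [mixedBasis_apply, this]
      exact ⟨_, rfl⟩

/-- The linear map from the generators of the exterior algebra to the cohomology of the
abelianization. -/
noncomputable def extToAb : (Fin 2 → ℤ) →ₗ[ℤ] CohomologyRing (Abelianization ThompsonF) :=
  Fintype.linearCombination ℤ ![abClass (true, false), abClass (false, true)]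

theorem extToAb_apply (v : Fin 2 → ℤ) :
    extToAb v = v 0 • abClass (true, false) + v 1 • abClass (false, true) := by
  rw [extToAb, Fintype.linearCombination_apply, Fin.sum_univ_two]
  rfl

/-- The squares vanish and the two mixed products are opposite, so the universal property of the
exterior algebra applies. -/
theorem extToAb_mul_self (v : Fin 2 → ℤ) : extToAb v * extToAb v = 0 := by
  rw [extToAb_apply, mul_add, add_mul, add_mul]
  simp only [smul_mul_smul_comm, abClass_mul]
  simp only [extCoeff, Bool.and_self, Bool.or_true, Bool.and_true, Bool.and_false,
    Bool.or_false, if_true, zero_smul, smul_zero, add_zero, zero_add]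
  simp [mul_comm]

end ThompsonF

namespace ExteriorAlgebra

open ThompsonF

/-- The monomials in the generators. -/
noncomputable def genMonomial (e : Bool × Bool) : ExteriorAlgebra ℤ (Fin 2 → ℤ) :=
  extMonomial (ι ℤ (Pi.single 0 1)) (ι ℤ (Pi.single 1 1)) e

theorem genMonomial_mul (e f : Bool × Bool) :
    genMonomial e * genMonomial f = extCoeff e f • genMonomial (e.1 || f.1, e.2 || f.2) :=
  extMonomial_mul (ι_sq_zero _) (ι_sq_zero _) (eq_neg_of_add_eq_zero_left (ι_add_mul_swap _ _)) e f

theorem span_genMonomial : Submodule.span ℤ (Set.range genMonomial) = ⊤ := by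
  let S : Subalgebra ℤ (ExteriorAlgebra ℤ (Fin 2 → ℤ)) :=
    (Submodule.span ℤ (Set.range genMonomial)).toSubalgebra
      (Submodule.subset_span ⟨(false, false), by simp [genMonomial, extMonomial]⟩) fun x y hx hy => by
        have := Submodule.mul_mem_mul hx hy
        rw [Submodule.span_mul_span] at this
        refine Submodule.span_le.2 ?_ this
        rintro _ ⟨_, ⟨e, rfl⟩, _, ⟨f, rfl⟩, rfl⟩
        simp only [genMonomial_mul]
        exact Submodule.smul_mem _ _ (Submodule.subset_span ⟨_, rfl⟩)
  have hS : S = ⊤ := by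
    rw [eq_top_iff, ← CliffordAlgebra.adjoin_range_ι, Algebra.adjoin_le_iff]
    rintro _ ⟨v, rfl⟩
    change ι ℤ v ∈ Submodule.span ℤ (Set.range genMonomial)
    have : v = v 0 • Pi.single 0 1 + v 1 • Pi.single 1 1 := by
      ext i
      fin_cases i <;> simp
    rw [this, map_add, map_smul, map_smul]
    refine Submodule.add_mem _ (Submodule.smul_mem _ _ (Submodule.subset_span ⟨(true, false), ?_⟩))
      (Submodule.smul_mem _ _ (Submodule.subset_span ⟨(false, true), ?_⟩))
    · simp [genMonomial, extMonomial]
    · simp [genMonomial, extMonomial]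
  exact congrArg Subalgebra.toSubmodule hS

/-- Independence is inherited from the cohomology of the abelianization, where the images of the
monomials form a basis. -/
theorem linearIndependent_genMonomial : LinearIndependent ℤ genMonomial := by
  let φ := lift ℤ ⟨extToAb, extToAb_mul_self⟩
  have h (e : Bool × Bool) : φ (genMonomial e) = abBasis e := by
    rw [abBasis_apply, genMonomial]
    refine (map_extMonomial φ.toRingHom _ _ e).trans ?_
    have h0 : φ.toRingHom (ι ℤ (Pi.single 0 1)) = abClass (true, false) :=
      (lift_ι_apply ℤ _ _ _).trans ((extToAb_apply _).trans (by simp))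
    have h1 : φ.toRingHom (ι ℤ (Pi.single 1 1)) = abClass (false, true) :=
      (lift_ι_apply ℤ _ _ _).trans ((extToAb_apply _).trans (by simp))
    rw [h0, h1]
    simp [abClass, extMonomial]
  refine LinearIndependent.of_comp φ.toLinearMap ?_
  have : φ.toLinearMap ∘ genMonomial = abBasis := funext h
  rw [this]
  exact abBasis.linearIndependent

/-- The monomials are a basis of the exterior algebra on two generators. -/
noncomputable def genGradedBasis :
    GradedBasis exteriorGrading extDegree extCoeff (fun e f => (e.1 || f.1, e.2 || f.2)) :=
  .ofMem (Module.Basis.mk linearIndependent_genMonomial span_genMonomial.ge) (fun i j => by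
    simp only [Module.Basis.mk_apply]
    rw [genMonomial_mul, zsmul_eq_mul]) fun e => by
      rw [Module.Basis.mk_apply, genMonomial, extMonomial]
      have h (v : Fin 2 → ℤ) (e : Bool) : (if e then ι ℤ v else 1) ∈ exteriorGrading e.toNat := by
        cases e
        · exact SetLike.GradedOne.one_mem
        · change _ ∈ _ ^ 1
          rw [pow_one]
          exact ⟨v, rfl⟩
      exact SetLike.GradedMul.mul_mem (h _ _) (h _ _)

end ExteriorAlgebra

namespace DividedPolynomialRing

/-- The divided powers as elements of the divided polynomial ring. -/
noncomputable def dpow (k : ℕ) : DividedPolynomialRing :=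
  ⟨dividedPow k, AddSubgroup.subset_closure (Set.mem_range_self k)⟩

theorem coeff_dpow (i k : ℕ) :
    (dpow k : Polynomial ℚ).coeff i = if i = k then (k.factorial : ℚ)⁻¹ else 0 := by
  simp [dpow, dividedPow, Polynomial.coeff_monomial, eq_comm]

theorem linearIndependent_dpow : LinearIndependent ℤ dpow := by
  rw [linearIndependent_iff']
  intro t g hg i hi
  have := congrArg (fun x : DividedPolynomialRing => (x : Polynomial ℚ).coeff i) hg
  simp only [AddSubmonoidClass.coe_finsetSum, Polynomial.finsetSum_coeff] at this
  have h (k : ℕ) : ((g k • dpow k : DividedPolynomialRing) : Polynomial ℚ).coeff i =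
      if i = k then g k * (k.factorial : ℚ)⁻¹ else 0 := by
    rw [← mul_ite_zero, ← coeff_dpow]
    simp
  simp only [h, Finset.sum_ite_eq, if_pos hi] at this
  simpa [Nat.factorial_ne_zero] using this

theorem span_dpow : Submodule.span ℤ (Set.range dpow) = ⊤ := by
  refine eq_top_iff.2 fun x _ => ?_
  obtain ⟨x, hx⟩ := x
  have hx' : x ∈ AddSubgroup.closure (Set.range dividedPow) := hx
  induction hx' using AddSubgroup.closure_induction with
  | mem x h =>
    obtain ⟨k, rfl⟩ := h
    exact Submodule.subset_span ⟨k, rfl⟩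
  | zero => exact Submodule.zero_mem _
  | add x y hx' hy' h h' => exact Submodule.add_mem _ (h hx' trivial) (h' hy' trivial)
  | neg x hx' h => exact Submodule.neg_mem _ (h hx' trivial)

/-- The divided powers are a basis of the divided polynomial ring. -/
noncomputable def gradedBasis : GradedBasis grading (fun k : ℕ => 2 * k)
    (fun i j => ((i + j).choose i : ℤ)) (· + ·) :=
  .ofMem (Module.Basis.mk linearIndependent_dpow span_dpow.ge) (fun i j => by
    simp only [Module.Basis.mk_apply]
    ext1
    refine (dividedPow_mul i j).trans ?_
    simp [dpow]) fun k => by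
      rw [Module.Basis.mk_apply]
      intro i hi
      rw [coeff_dpow, if_neg (by omega)]

end DividedPolynomialRing

namespace ThompsonF

open groupCohomology CohomologyRing

/-- The product of the two degrees is a basis element, detected by the torus through the letters 0
and 1. -/
theorem exists_cupClass_ne_zero :
    ∃ x y : IntCohomology ThompsonF 1, cupClass (rfl : 1 + 1 = 2) x y ≠ 0 := by
  refine ⟨cls 1 (homCocycle deg₀), cls 1 (homCocycle deg), fun h => ?_⟩
  have h1 : mixedClass (0, (true, true)) = homClass deg₀ * homClass deg := by
    rw [mixedClass_eq_extMonomial, gvClass_zero, one_mul]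
    rfl
  have h2 := dualEval_mixedClass (0, (true, true)) (0, (true, true))
  rw [h1, homClass, homClass, of_mul_of, h, map_zero, map_zero] at h2
  simp at h2

end ThompsonF

theorem theorem2 :
    -- `H^*(F') ≅ Γ(u)` with `deg u = 2`
    (∃ e : CohomologyRing (commutator ThompsonF) ≃+* DividedPolynomialRing,
      ∀ n x, e x ∈ DividedPolynomialRing.grading n ↔
        x ∈ CohomologyRing.grading (commutator ThompsonF) n) ∧
    -- `H^*(F) ≅ H^*(F') ⊗ H^*(F_ab)`
    (∃ e : CohomologyRing ThompsonF ≃+*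
        (CohomologyRing.grading (commutator ThompsonF) ᵍ⊗[ℤ]
          CohomologyRing.grading (Abelianization ThompsonF)),
      ∀ n x, e x ∈ tensorGrading (CohomologyRing.grading (commutator ThompsonF))
          (CohomologyRing.grading (Abelianization ThompsonF)) n ↔
        x ∈ CohomologyRing.grading ThompsonF n) ∧
    -- `H^*(F') ⊗ H^*(F_ab) ≅ Γ(u) ⊗ Λ(a, b)` with `deg a = deg b = 1`, `deg u = 2`
    (∃ e : (CohomologyRing.grading (commutator ThompsonF) ᵍ⊗[ℤ]
          CohomologyRing.grading (Abelianization ThompsonF)) ≃+*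
        (DividedPolynomialRing.grading ᵍ⊗[ℤ] exteriorGrading),
      ∀ n x, e x ∈ tensorGrading DividedPolynomialRing.grading exteriorGrading n ↔
        x ∈ tensorGrading (CohomologyRing.grading (commutator ThompsonF))
          (CohomologyRing.grading (Abelianization ThompsonF)) n) ∧
    -- the cup product `H^1(F) ⊗ H^1(F) → H^2(F)` is nontrivial
    (∃ x y : groupCohomology.IntCohomology ThompsonF 1,
      groupCohomology.cupClass (rfl : 1 + 1 = 2) x y ≠ 0) :=
  ⟨ThompsonF.commGradedBasis.exists_ringEquiv DividedPolynomialRing.gradedBasis,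
    ThompsonF.mixedGradedBasis.exists_ringEquiv
      (ThompsonF.commGradedBasis.tensor ThompsonF.abGradedBasis even_two_mul),
    (ThompsonF.commGradedBasis.tensor ThompsonF.abGradedBasis even_two_mul).exists_ringEquiv
      (DividedPolynomialRing.gradedBasis.tensor ExteriorAlgebra.genGradedBasis even_two_mul),
    ThompsonF.exists_cupClass_ne_zero⟩
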